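/- Machine model. A quantum algorithm is one program (the same for all inputs) for a classical word RAM with words of $O(\log n)$ bits that controls a memory of qubits, initially all $|0\rangle$. Its basic operations are: word operations and tests; loads and stores in a classical memory; Hadamard, $\pi/8$, NOT, CNOT and Toffoli gates; measurement of one qubit in the computational basis; looking up a classical memory cell whose index may be in superposition ($|i\rangle|z\rangle\mapsto|i\rangle|z\oplus \mathrm{mem}[\mathrm{base}+i]\rangle$); and reading the input, classically or by a quantum query $|i\rangle|j\rangle|z\rangle\mapsto|i\rangle|j\rangle|z\oplus x_{ij}\rangle$. The time of a run is the number of basic operations it makes. The input is an undirected simple graph $G$ with vertices $0,\dots,n-1$ and $m$ edges; in the matrix model it is given by $n$ and its adjacency matrix $(x_{ij})$, in the list model by $n$, the degrees of the vertices and, for every vertex, an array with its neighbours in arbitrary order. A colouring by extraction of $G$ with $k$ colours is obtained as follows: for $i=1,2,\dots$, as long as there are vertices left, choose a maximal independent set of the graph that is left, give its vertices the colour $i$, and delete them; $k$ is the number of colours used. It is a proper colouring. Theorem. (Matrix model) There are a quantum algorithm and a constant $C$ such that for every $n\ge 2$ and every graph $G$ with $n$ vertices, the following holds with probability greater than $1-1/n$: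 the algorithm stops, it outputs a proper colouring of $G$ with exactly $k$ colours that is a colouring by extraction (together with the number $k$), and its running time is at most $C\,k\,n^{1.5}\log^2 n$. (List model) There are a quantum algorithm and a constant $C$ such that for every $n\ge 2$, every graph $G$ with $n$ vertices and $m$ edges, and all adjacency lists of $G$, the following holds with probability greater than $1-1/n$: the algorithm stops, it outputs a proper colouring of $G$ with exactly $k$ colours that is a colouring by extraction (together with the number $k$), and its running time is at most $C\,k\sqrt{n\cdot\max(n,m)}\,\log^2 n$. (This is $O(k\sqrt{nm}\,\log^2 n)$ for graphs with $m\ge n$ and, more generally, whenever $n=O(m)$, for example for graphs without isolated vertices.) -/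

import Mathlib

/-! ## The machine model

A classical word RAM with a quantum co-memory.  It has finitely many (per program) classical
registers, a random access memory of classical words, and a memory of qubits.  The time of a run is
the number of basic operations it performs: word operations, tests, elementary gates, one-qubit
measurements, queries to the input, and look-ups of a classical memory cell whose index may be in
superposition (quantum read access to classical memory) each count one. -/

namespace QRam

/-- A computational basis state of the qubit memory (qubits are numbered by `ℕ`). -/
abbrev Basis := ℕ → Bool

/-- A vector of the Hilbert space spanned by the basis states; in each state reached by a program
only finitely many amplitudes are nonzero. -/
abbrev QVec := Basis →₀ ℂ

/-- The squared norm of a vector. -/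
noncomputable def normSq (ψ : QVec) : ℝ := ψ.sum fun _ a => ‖a‖ ^ 2

/-- The linear extension of a map that is given on basis states. -/
noncomputable def linExt (g : Basis → QVec) (ψ : QVec) : QVec := ψ.sum fun x a => a • g x

/-- The linear extension of a permutation of the basis states. -/
noncomputable def permute (g : Basis → Basis) (ψ : QVec) : QVec :=
  linExt (fun x => Finsupp.single (g x) 1) ψ

/-- Flip qubit `q`. -/
def flipQubit (q : ℕ) (x : Basis) : Basis := Function.update x q (!x q)

/-- The Hadamard gate on qubit `q`. -/
noncomputable def hGate (q : ℕ) : QVec → QVec :=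
  linExt fun x =>
    Finsupp.single (Function.update x q false) ((1 / Real.sqrt 2 : ℝ) : ℂ) +
    Finsupp.single (Function.update x q true)
      (if x q then -((1 / Real.sqrt 2 : ℝ) : ℂ) else ((1 / Real.sqrt 2 : ℝ) : ℂ))

/-- The `π/8` gate on qubit `q`: `|0⟩ ↦ |0⟩`, `|1⟩ ↦ exp(iπ/4) |1⟩`. -/
noncomputable def tGate (q : ℕ) : QVec → QVec :=
  linExt fun x =>
    Finsupp.single x (if x q then Complex.exp (Complex.I * (Real.pi / 4 : ℝ)) else 1)

/-- The NOT gate on qubit `q`. -/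
noncomputable def xGate (q : ℕ) : QVec → QVec := permute (flipQubit q)

/-- The CNOT gate with control `a` and target `t` (no effect if `a = t`). -/
noncomputable def cxGate (a t : ℕ) : QVec → QVec :=
  permute fun x => if a ≠ t ∧ x a then flipQubit t x else x

/-- The Toffoli gate with controls `a`, `b` and target `t` (no effect if `t` is a control). -/
noncomputable def ccxGate (a b t : ℕ) : QVec → QVec :=
  permute fun x => if (a ≠ t ∧ b ≠ t) ∧ (x a ∧ x b) then flipQubit t x else x

/-- The number written, least significant bit first, in the `len` qubits from `q` on. -/
def blockVal (len q : ℕ) (x : Basis) : ℕ :=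
  ∑ j ∈ Finset.range len, if x (q + j) then 2 ^ j else 0

/-- Add the `len` low bits of the number `v` modulo two to the `len` qubits from `t` on. -/
def xorBlock (len t v : ℕ) (x : Basis) : Basis := fun q =>
  if t ≤ q ∧ q < t + len then xor (x q) (v.testBit (q - t)) else x q

/-- The blocks of `len` qubits that start at `a` and at `b` are disjoint. -/
def BlocksDisjoint (len a b : ℕ) : Prop := a + len ≤ b ∨ b + len ≤ a

instance (len a b : ℕ) : Decidable (BlocksDisjoint len a b) :=
  inferInstanceAs (Decidable (_ ∨ _))

/-- `|i⟩|z⟩ ↦ |i⟩|z ⊕ f i⟩`, where `i` and `z` are in the blocks of `len` qubits that start at `qi`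
and `qt` (no effect if these overlap). -/
noncomputable def lookupGate (len : ℕ) (f : ℕ → ℕ) (qi qt : ℕ) : QVec → QVec :=
  permute fun x => if BlocksDisjoint len qi qt then xorBlock len qt (f (blockVal len qi x)) x else x

/-- `|i⟩|j⟩|z⟩ ↦ |i⟩|j⟩|z ⊕ f i j⟩`, where `i`, `j` and `z` are in the blocks of `len` qubits that
start at `qi`, `qj` and `qt` (no effect if the last one overlaps with one of the others). -/
noncomputable def queryGate (len : ℕ) (f : ℕ → ℕ → ℕ) (qi qj qt : ℕ) : QVec → QVec :=
  permute fun x =>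
    if BlocksDisjoint len qi qt ∧ BlocksDisjoint len qj qt then
      xorBlock len qt (f (blockVal len qi x) (blockVal len qj x)) x
    else x

/-- Programs.  The arguments are names of classical registers, except for the constant `c` and the
name `tab` of an input table.  Gates find the numbers of the qubits (or of the first qubit of a
block) that they act on in the registers they name. -/
inductive Prog : Type
  /-- `d := c` -/
  | const (d c : ℕ)
  /-- `d := a` -/
  | move (d a : ℕ)
  /-- `d := a + b` -/
  | add (d a b : ℕ)
  /-- `d := max (a - b) 0` -/
  | sub (d a b : ℕ)
  /-- `d := ⌊a / 2⌋` -/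
  | half (d a : ℕ)
  /-- `d := mem[a]` -/
  | load (d a : ℕ)
  /-- `mem[a] := b` -/
  | store (a b : ℕ)
  /-- `d :=` the entry `(i, j)` of the input table `tab` -/
  | read (tab d i j : ℕ)
  /-- the Hadamard gate -/
  | had (q : ℕ)
  /-- the `π/8` gate -/
  | tee (q : ℕ)
  /-- the NOT gate -/
  | not (q : ℕ)
  /-- the CNOT gate -/
  | cnot (a t : ℕ)
  /-- the Toffoli gate -/
  | toffoli (a b t : ℕ)
  /-- measure a qubit in the computational basis and put the result into `d` -/
  | measure (d q : ℕ)
  /-- `|i⟩|z⟩ ↦ |i⟩|z ⊕ mem[base + i]⟩` -/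
  | lookup (base i t : ℕ)
  /-- `|i⟩|j⟩|z⟩ ↦ |i⟩|j⟩|z ⊕ (entry (i, j) of the input table tab)⟩` -/
  | query (tab i j t : ℕ)
  /-- `p; p'` -/
  | seq (p p' : Prog)
  /-- `if r ≠ 0 then p else p'` -/
  | ite (r : ℕ) (p p' : Prog)
  /-- `while r ≠ 0 do p` -/
  | loop (r : ℕ) (p : Prog)

/-- A state of the machine on one branch of the computation (that is, for one sequence of
measurement results).  The vector `vec` is not renormalised after a measurement, so its squared norm
is the probability of the branch. -/
structure State where
  /-- the classical registers -/
  reg : ℕ → ℕ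
  /-- the classical memory -/
  mem : ℕ → ℕ
  /-- the quantum memory -/
  vec : QVec
  /-- the number of basic operations made so far -/
  time : ℕ

/-- Count one operation. -/
def State.tick (s : State) : State := { s with time := s.time + 1 }

/-- Assign the value `v` to register `d`. -/
def State.setReg (s : State) (d v : ℕ) : State := { s with reg := Function.update s.reg d v }

/-- Assign the value `v` to memory cell `a`. -/
def State.setMem (s : State) (a v : ℕ) : State := { s with mem := Function.update s.mem a v }

/-- Apply a gate to the quantum memory. -/
def State.gate (s : State) (g : QVec → QVec) : State := { s with vec := g s.vec }

/-- The branch of a measurement of qubit `q` with result `b`: the vector is projected. -/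
noncomputable def State.project (s : State) (q : ℕ) (b : Bool) : State :=
  { s with vec := s.vec.filter fun x => x q = b }

/-- `while r ≠ 0 do body`; branches that need `fuel` rounds or more are dropped. -/
def whileLoop (r : ℕ) (body : State → List State) : (fuel : ℕ) → State → List State
  | 0, _ => []
  | fuel + 1, s =>
    if s.reg r = 0 then [s.tick] else (body s.tick).flatMap (whileLoop r body fuel)

/-- The list of all branches on which the program stops (with less than `fuel` rounds of each
execution of a loop), started in a given state.  Words have `w` bits, index blocks in the quantum
memory have `len` qubits, and `input tab i j` is the entry `(i, j)` of the input table `tab`. -/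
noncomputable def exec (w len : ℕ) (input : ℕ → ℕ → ℕ → ℕ) (fuel : ℕ) :
    Prog → State → List State
  | .const d c, s => [s.tick.setReg d (c % 2 ^ w)]
  | .move d a, s => [s.tick.setReg d (s.reg a)]
  | .add d a b, s => [s.tick.setReg d ((s.reg a + s.reg b) % 2 ^ w)]
  | .sub d a b, s => [s.tick.setReg d (s.reg a - s.reg b)]
  | .half d a, s => [s.tick.setReg d (s.reg a / 2)]
  | .load d a, s => [s.tick.setReg d (s.mem (s.reg a))]
  | .store a b, s => [s.tick.setMem (s.reg a) (s.reg b)]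
  | .read tab d i j, s => [s.tick.setReg d (input tab (s.reg i) (s.reg j) % 2 ^ w)]
  | .had q, s => [s.tick.gate (hGate (s.reg q))]
  | .tee q, s => [s.tick.gate (tGate (s.reg q))]
  | .not q, s => [s.tick.gate (xGate (s.reg q))]
  | .cnot a t, s => [s.tick.gate (cxGate (s.reg a) (s.reg t))]
  | .toffoli a b t, s => [s.tick.gate (ccxGate (s.reg a) (s.reg b) (s.reg t))]
  | .measure d q, s =>
    [(s.tick.project (s.reg q) false).setReg d 0, (s.tick.project (s.reg q) true).setReg d 1]
  | .lookup base i t, s =>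
    [s.tick.gate (lookupGate len (fun v => s.mem (s.reg base + v)) (s.reg i) (s.reg t))]
  | .query tab i j t, s =>
    [s.tick.gate (queryGate len (input tab) (s.reg i) (s.reg j) (s.reg t))]
  | .seq p p', s => (exec w len input fuel p s).flatMap (exec w len input fuel p')
  | .ite r p p', s =>
    if s.reg r = 0 then exec w len input fuel p' s.tick else exec w len input fuel p s.tick
  | .loop r p, s => whileLoop r (exec w len input fuel p) fuel s

/-- A quantum algorithm for graph problems: one program for all inputs.  On graphs with `n` vertices
it works with words of `wordFactor * ⌈log₂ (n + 1)⌉` bits. -/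
structure Algorithm where
  /-- the word length, as a multiple of the length of `n` in binary -/
  wordFactor : ℕ
  /-- the program -/
  prog : Prog

/-- At the start register `0` holds the number `n` of vertices, all other registers and memory cells
hold `0`, and all qubits are in the state `|0⟩`. -/
noncomputable def initState (n : ℕ) : State where
  reg := Function.update (fun _ => 0) 0 n
  mem := fun _ => 0
  vec := Finsupp.single (fun _ => false) 1
  time := 0

/-- The branches on which the algorithm stops. -/
noncomputable def Algorithm.run (A : Algorithm) (n : ℕ) (input : ℕ → ℕ → ℕ → ℕ) (fuel : ℕ) :
    List State :=
  exec (A.wordFactor * n.size) n.size input fuel A.prog (initState n)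

open Classical in
/-- The probability that the computation stops, on one of the given branches, in a state that
satisfies `P`. -/
noncomputable def prob (branches : List State) (P : State → Prop) : ℝ :=
  (branches.map fun s => if P s then normSq s.vec else 0).sum

end QRam

/-! ## Graphs as inputs, and colourings -/

open Classical in
/-- The adjacency matrix model: every table is the adjacency matrix (entries outside of it are
`0`). -/
noncomputable def matrixInput {n : ℕ} (G : SimpleGraph (Fin n)) (_tab i j : ℕ) : ℕ :=
  if ∃ (hi : i < n) (hj : j < n), G.Adj ⟨i, hi⟩ ⟨j, hj⟩ then 1 else 0

/-- The degree of a vertex. -/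
noncomputable def vertexDegree {n : ℕ} (G : SimpleGraph (Fin n)) (v : Fin n) : ℕ :=
  (G.neighborSet v).ncard

/-- Adjacency lists of a graph: for every vertex an array with its neighbours, in any order. -/
abbrev AdjacencyLists {n : ℕ} (G : SimpleGraph (Fin n)) : Type :=
  ∀ v : Fin n, Fin (vertexDegree G v) ≃ G.neighborSet v

/-- The adjacency list model: table `0` holds the degrees (row `i` is constantly the degree of `i`),
and entry `(i, j)` of the other tables is the neighbour number `j` of `i`, counted from `0`.  Rows
that do not exist hold degree `0`; reading after the end of a list yields the end mark `n`, which is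
not a vertex. -/
noncomputable def listInput {n : ℕ} (G : SimpleGraph (Fin n)) (L : AdjacencyLists G)
    (tab i j : ℕ) : ℕ :=
  if hi : i < n then
    if tab = 0 then vertexDegree G ⟨i, hi⟩
    else if hj : j < vertexDegree G ⟨i, hi⟩ then ((L ⟨i, hi⟩ ⟨j, hj⟩ : Fin n) : ℕ) else n
  else if tab = 0 then 0 else n

/-- `W` is a maximal independent set of the subgraph of `G` induced by the vertex set `R`. -/
def IsMaximalIndepSetOf {V : Type*} (G : SimpleGraph V) (R W : Set V) : Prop :=
  Maximal (fun S => S ⊆ R ∧ G.IsIndepSet S) W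

/-- `c` is a proper colouring of `G` with exactly the `k` colours `1, …, k`, obtained by repeatedly
extracting a maximal independent set: as long as there are vertices left, a maximal independent set
of the graph that is left gets the next colour and is deleted. -/
structure IsColouringByExtraction {V : Type*} (G : SimpleGraph V) (k : ℕ) (c : V → ℕ) : Prop where
  /-- endpoints of an edge have different colours -/
  proper : ∀ u v, G.Adj u v → c u ≠ c v
  /-- the colours that occur are `1, …, k` -/
  colours : Set.range c = Set.Icc 1 k
  /-- class number `i` is a maximal independent set of what the earlier classes have left -/
  extraction : ∀ i ∈ Set.Icc 1 k, IsMaximalIndepSetOf G {v | i ≤ c v} {v | c v = i}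

/-- The final state of a run holds a colouring by extraction of maximal independent sets: the number
of colours in register `0`, and the colour of vertex `v` in memory cell `v`. -/
def OutputsColouring {n : ℕ} (G : SimpleGraph (Fin n)) (s : QRam.State) : Prop :=
  IsColouringByExtraction G (s.reg 0) fun v => s.mem v

/-! ## Gates, pointwise -/

namespace QRam

/-! Colour classes are extracted by the greedy rule: in every round the vertices are treated in the
order of their numbers, and an uncoloured vertex joins the current class unless it already has a
neighbour there. A rejected vertex has a neighbour in the class, so the finished class is maximal
independent in what was left (`PartialColouring.next_class`). Every class is nonempty, hence there
are at most n rounds and at most n² tests whether a vertex has a neighbour in the current class.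

Each test is a Grover search (`search_wp`), over the row of the vertex in the matrix model and over
its neighbour list in the list model. If sin²θ is the proportion of marked indices, then j
iterations turn the uniform state into one of angle (2j+1)θ (`Amplitudes.step`,
`TwoValued.grover_step`). The proportion is unknown, so j runs through 0, 1, 3, 7, …; the factor
2j+1 at most triples from one value to the next, and therefore some angle falls between π/4 and
3π/4, where the chance of success is at least 1/2 (`exists_good_iteration`). The iteration numbers
form a geometric series, so such a search round over N indices costs O(√N log N) operations. A hit
is never reported wrongly, and `3 * len` search rounds, where `len` is the binary length of n, push
the error below n⁻³. By Bernoulli's inequality all n² tests are correct with probability greater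
than 1 − 1/n (`lt_reliability_pow`).

Up to a constant factor one colour costs the sum of √N over the vertices, times log² n. This sum is
of order n√n for the matrix, and by Cauchy–Schwarz of order √(n(n+m)) for the lists (`sum_list_le`).
Marks never have to be cleared, because each colour uses a fresh array.

Programs are analysed by two relations. `Runs` is for programs without branching. `Wp` exhibits
finitely many branches on which a value adds up to at least a given number; only lower bounds are
needed, so bad branches may be dropped. The invariants of loops with measurements are real
functions: the squared norm of the branch times the success probability that the remaining rounds
still guarantee, and zero where the invariant fails (`mass`). Every search ends by resetting its
qubits, so that searches can be composed. -/

theorem permute_eq_mapDomain (g : Basis → Basis) (ψ : QVec) :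
    permute g ψ = Finsupp.mapDomain g ψ := by
  simp [permute, linExt, Finsupp.mapDomain]

/-- The permutations behind the gates are involutions, so pulling an amplitude back needs no inverse
map. -/
theorem permute_apply {g : Basis → Basis} (hg : Function.Involutive g) (ψ : QVec) (x : Basis) :
    permute g ψ x = ψ (g x) := by
  rw [permute_eq_mapDomain]
  conv_lhs => rw [← hg x]
  exact Finsupp.mapDomain_apply hg.injective ψ (g x)

theorem tGate_apply (q : ℕ) (ψ : QVec) (x : Basis) :
    tGate q ψ x = (if x q then Complex.exp (Complex.I * (Real.pi / 4 : ℝ)) else 1) * ψ x := by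
  unfold tGate linExt
  induction ψ using Finsupp.induction_linear with
  | zero => simp
  | add f g hf hg =>
    rw [Finsupp.sum_add_index' (by simp) (by intros; rw [add_smul]), Finsupp.add_apply, hf, hg,
      Finsupp.add_apply, mul_add]
  | single y a =>
    rw [Finsupp.sum_single_index (by simp)]
    by_cases h : y = x
    · subst h; simp [mul_comm]
    · simp [h]

/-- The gate set has no phase flip; four `π/8` gates make one. -/
theorem tGate_four (q : ℕ) (ψ : QVec) (x : Basis) :
    tGate q (tGate q (tGate q (tGate q ψ))) x = (if x q then -1 else 1) * ψ x := by
  have h : Complex.exp (Complex.I * (Real.pi / 4 : ℝ)) ^ 4 = -1 := by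
    rw [← Complex.exp_nat_mul, ← Complex.exp_pi_mul_I]
    congr 1; push_cast; ring
  simp only [tGate_apply]
  split_ifs
  · rw [← h]; ring
  · ring

theorem hGate_apply (q : ℕ) (ψ : QVec) (x : Basis) :
    hGate q ψ x = ((1 / Real.sqrt 2 : ℝ) : ℂ) *
      (ψ (Function.update x q false) + (if x q then -1 else 1) * ψ (Function.update x q true)) := by
  classical
  unfold hGate linExt
  induction ψ using Finsupp.induction_linear with
  | zero => simp
  | add f g hf hg =>
    rw [Finsupp.sum_add_index' (by simp) (by intros; rw [add_smul]), Finsupp.add_apply, hf, hg,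
      Finsupp.add_apply, Finsupp.add_apply]
    ring
  | single y a =>
    rw [Finsupp.sum_single_index (by simp)]
    -- A basis state `y` contributes to the amplitude at `x` only if the two agree outside of qubit
    -- `q`. `key` and `key2` isolate this condition, so that one case distinction settles both
    -- sides.
    have key : ∀ b : Bool, (Function.update y q b = x) ↔
        (x q = b ∧ y = Function.update x q (y q)) := by
      intro b
      constructor
      · rintro rfl; simp
      · rintro ⟨h1, h2⟩
        rw [h2, ← h1]; simp
    have key2 : ∀ b : Bool, (y = Function.update x q b) ↔
        (y q = b ∧ y = Function.update x q (y q)) := by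
      intro b
      constructor
      · intro h
        have : y q = b := by rw [h]; simp
        exact ⟨this, by rw [this]; exact h⟩
      · rintro ⟨h1, h2⟩; rw [h1] at h2; exact h2
    simp only [Finsupp.smul_apply, Finsupp.add_apply, Finsupp.single_apply, smul_eq_mul]
    by_cases h : y = Function.update x q (y q)
    · have k1 := fun b => (key b).trans (and_iff_left h)
      have k2 := fun b => (key2 b).trans (and_iff_left h)
      simp only [k1, k2]
      cases hx : x q <;> cases hy : y q <;> simp [mul_comm]
    · have k1 := fun b => (key b).trans (iff_of_false (fun h' => h h'.2) not_false)
      have k2 := fun b => (key2 b).trans (iff_of_false (fun h' => h h'.2) not_false)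
      simp [k1, k2]

theorem flipQubit_involutive (q : ℕ) : Function.Involutive (flipQubit q) := by
  intro x; simp [flipQubit]

theorem flipQubit_self (q : ℕ) (x : Basis) : flipQubit q x q = !x q := by simp [flipQubit]

theorem flipQubit_of_ne {q r : ℕ} (h : r ≠ q) (x : Basis) : flipQubit q x r = x r := by
  simp [flipQubit, h]

theorem hGate_add (q : ℕ) (ψ φ : QVec) : hGate q (ψ + φ) = hGate q ψ + hGate q φ := by
  ext x; simp only [hGate_apply, Finsupp.add_apply]; ring

theorem hGate_smul (q : ℕ) (c : ℂ) (ψ : QVec) : hGate q (c • ψ) = c • hGate q ψ := by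
  ext x; simp only [hGate_apply, Finsupp.smul_apply, smul_eq_mul]; ring

theorem inv_sqrt_two_sq : ((1 / Real.sqrt 2 : ℝ) : ℂ) * ((1 / Real.sqrt 2 : ℝ) : ℂ) = 1 / 2 := by
  rw [← Complex.ofReal_mul, div_mul_div_comm, Real.mul_self_sqrt (by norm_num)]
  norm_num

theorem hGate_hGate (q : ℕ) (ψ : QVec) : hGate q (hGate q ψ) = ψ := by
  ext x
  simp only [hGate_apply, Function.update_idem, Function.update_self, Bool.false_eq_true, if_false,
    if_true]
  have := inv_sqrt_two_sq
  cases hx : x q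
  · have h2 : Function.update x q false = x := by rw [← hx]; simp
    simp only [h2, Bool.false_eq_true, if_false]
    linear_combination 2 * ψ x * this
  · have h2 : Function.update x q true = x := by rw [← hx]; simp
    simp only [h2, if_true]
    linear_combination 2 * ψ x * this

theorem hGate_apply_of_false {q : ℕ} {x : Basis} (h : x q = false) (ψ : QVec) :
    hGate q ψ x = ((1 / Real.sqrt 2 : ℝ) : ℂ) * (ψ x + ψ (flipQubit q x)) := by
  have h2 : Function.update x q false = x := by rw [← h]; simp
  have h3 : Function.update x q true = flipQubit q x := by simp [flipQubit, h]
  rw [hGate_apply, h2, h3]; simp [h]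

/-! ## Blocks -/

theorem testBit_blockVal (len q : ℕ) (x : Basis) :
    blockVal len q x < 2 ^ len ∧
      ∀ j, (blockVal len q x).testBit j = (decide (j < len) && x (q + j)) := by
  induction len with
  | zero => simp [blockVal]
  | succ l ih =>
    obtain ⟨h1, h2⟩ := ih
    have e : blockVal (l + 1) q x = blockVal l q x + if x (q + l) then 2 ^ l else 0 := by
      simp [blockVal, Finset.sum_range_succ]
    constructor
    · rw [e, pow_succ]; split_ifs <;> omega
    · intro j
      rw [e]
      split_ifs with h
      · rw [add_comm]
        rcases lt_trichotomy j l with hj | hj | hj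
        · rw [Nat.testBit_two_pow_add_gt hj, h2]
          simp [hj, Nat.lt_succ_of_lt hj]
        · subst hj
          rw [Nat.testBit_two_pow_add_eq, h2]
          simp [h]
        · have : ¬ j < l + 1 := by omega
          simp only [this, decide_false, Bool.false_and]
          apply Nat.testBit_lt_two_pow
          calc _ < 2 ^ (l + 1) := by rw [pow_succ]; omega
            _ ≤ 2 ^ j := Nat.pow_le_pow_right (by norm_num) (by omega)
      · rw [add_zero, h2]
        rcases lt_trichotomy j l with hj | hj | hj
        · simp [hj, Nat.lt_succ_of_lt hj]
        · subst hj; simp [h]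
        · simp [not_lt.2 hj.le, show ¬ j < l + 1 by omega]

theorem blockVal_lt (len q : ℕ) (x : Basis) : blockVal len q x < 2 ^ len :=
  (testBit_blockVal len q x).1

theorem blockVal_congr {len q : ℕ} {x y : Basis} (h : ∀ r, q ≤ r → r < q + len → x r = y r) :
    blockVal len q x = blockVal len q y := by
  refine Finset.sum_congr rfl fun j hj => ?_
  rw [h (q + j) (by omega) (by have := Finset.mem_range.1 hj; omega)]

theorem blockVal_eq_of_bits {len q v : ℕ} {x : Basis} (hv : v < 2 ^ len)
    (h : ∀ j < len, x (q + j) = v.testBit j) : blockVal len q x = v := by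
  apply Nat.eq_of_testBit_eq
  intro j
  rw [(testBit_blockVal len q x).2]
  by_cases hj : j < len
  · simp [hj, h j hj]
  · simp only [hj, decide_false, Bool.false_and]
    exact (Nat.testBit_lt_two_pow (hv.trans_le
      (Nat.pow_le_pow_right (by norm_num) (not_lt.1 hj)))).symm

theorem blockVal_eq_zero_iff {len q : ℕ} {x : Basis} :
    blockVal len q x = 0 ↔ ∀ j < len, x (q + j) = false := by
  constructor
  · intro h j hj
    have := (testBit_blockVal len q x).2 j
    simpa [h, hj] using this.symm
  · intro h
    exact blockVal_eq_of_bits (by positivity) (by simpa using h)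

theorem xorBlock_outside {len t v q : ℕ} (h : q < t ∨ t + len ≤ q) (x : Basis) :
    xorBlock len t v x q = x q := by
  have : ¬ (t ≤ q ∧ q < t + len) := by omega
  simp [xorBlock, this]

theorem xorBlock_inside {len t v j : ℕ} (h : j < len) (x : Basis) :
    xorBlock len t v x (t + j) = xor (x (t + j)) (v.testBit j) := by
  simp [xorBlock, h]

theorem xorBlock_xorBlock (len t v : ℕ) (x : Basis) :
    xorBlock len t v (xorBlock len t v x) = x := by
  funext q; simp only [xorBlock]; split_ifs <;> simp

theorem blockVal_xorBlock_of_disjoint {len a t : ℕ} (h : BlocksDisjoint len a t) (v : ℕ)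
    (x : Basis) : blockVal len a (xorBlock len t v x) = blockVal len a x :=
  blockVal_congr fun r h1 h2 => xorBlock_outside (by unfold BlocksDisjoint at h; omega) x

theorem blockVal_xorBlock_self {len t v : ℕ} {x : Basis} (hx : ∀ j < len, x (t + j) = false)
    (hv : v < 2 ^ len) : blockVal len t (xorBlock len t v x) = v :=
  blockVal_eq_of_bits hv fun j hj => by simp [xorBlock_inside hj, hx j hj]

/-- The permutation of the basis states behind `lookupGate`. -/
def lookupMap (len : ℕ) (f : ℕ → ℕ) (qi qt : ℕ) (x : Basis) : Basis :=
  if BlocksDisjoint len qi qt then xorBlock len qt (f (blockVal len qi x)) x else x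

/-- The permutation of the basis states behind `queryGate`. -/
def queryMap (len : ℕ) (f : ℕ → ℕ → ℕ) (qi qj qt : ℕ) (x : Basis) : Basis :=
  if BlocksDisjoint len qi qt ∧ BlocksDisjoint len qj qt then
    xorBlock len qt (f (blockVal len qi x) (blockVal len qj x)) x
  else x

/-- The permutation of the basis states behind `ccxGate`. -/
def ccxMap (a b t : ℕ) (x : Basis) : Basis :=
  if (a ≠ t ∧ b ≠ t) ∧ (x a ∧ x b) then flipQubit t x else x

theorem lookupGate_eq (len : ℕ) (f : ℕ → ℕ) (qi qt : ℕ) :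
    lookupGate len f qi qt = permute (lookupMap len f qi qt) := rfl

theorem queryGate_eq (len : ℕ) (f : ℕ → ℕ → ℕ) (qi qj qt : ℕ) :
    queryGate len f qi qj qt = permute (queryMap len f qi qj qt) := rfl

theorem ccxGate_eq (a b t : ℕ) : ccxGate a b t = permute (ccxMap a b t) := rfl

/-- Disjointness of the blocks keeps the index intact, so the second application adds the same
number again. -/
theorem lookupMap_involutive (len : ℕ) (f : ℕ → ℕ) (qi qt : ℕ) :
    Function.Involutive (lookupMap len f qi qt) := by
  intro x
  unfold lookupMap
  split_ifs with h
  · rw [blockVal_xorBlock_of_disjoint h, xorBlock_xorBlock]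
  · rfl

theorem queryMap_involutive (len : ℕ) (f : ℕ → ℕ → ℕ) (qi qj qt : ℕ) :
    Function.Involutive (queryMap len f qi qj qt) := by
  intro x
  unfold queryMap
  split_ifs with h
  · rw [blockVal_xorBlock_of_disjoint h.1, blockVal_xorBlock_of_disjoint h.2, xorBlock_xorBlock]
  · rfl

theorem ccxMap_involutive (a b t : ℕ) : Function.Involutive (ccxMap a b t) := by
  intro x
  by_cases h : (a ≠ t ∧ b ≠ t) ∧ (x a ∧ x b)
  · have h' : (a ≠ t ∧ b ≠ t) ∧ (flipQubit t x a ∧ flipQubit t x b) := by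
      rw [flipQubit_of_ne h.1.1, flipQubit_of_ne h.1.2]; exact h
    simp only [ccxMap, if_pos h, if_pos h', flipQubit_involutive t x]
  · simp only [ccxMap, if_neg h]

/-! ## Norms -/

theorem normSq_nonneg (ψ : QVec) : 0 ≤ normSq ψ :=
  Finset.sum_nonneg fun _ _ => by positivity

theorem normSq_eq_sum {T : Finset Basis} {ψ : QVec} (h : ∀ x, ψ x ≠ 0 → x ∈ T) :
    normSq ψ = ∑ x ∈ T, ‖ψ x‖ ^ 2 :=
  Finsupp.sum_of_support_subset _ (fun x hx => h x (Finsupp.mem_support_iff.1 hx)) _ (by simp)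

theorem normSq_permute {g : Basis → Basis} (hg : Function.Injective g) (ψ : QVec) :
    normSq (permute g ψ) = normSq ψ := by
  rw [permute_eq_mapDomain]
  exact Finsupp.sum_mapDomain_index_inj hg

/-- The two outcomes of a measurement share the weight of the state before it. -/
theorem normSq_filter_add (p : Basis → Prop) [DecidablePred p] (p' : Basis → Prop)
    [DecidablePred p'] (h : ∀ x, p' x ↔ ¬ p x) (ψ : QVec) :
    normSq (ψ.filter p) + normSq (ψ.filter p') = normSq ψ := by
  have hs : ∀ x, ψ x ≠ 0 → x ∈ ψ.support := fun x hx => Finsupp.mem_support_iff.2 hx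
  rw [normSq_eq_sum hs, normSq_eq_sum (T := ψ.support) (ψ := ψ.filter p),
    normSq_eq_sum (T := ψ.support) (ψ := ψ.filter p'), ← Finset.sum_add_distrib]
  · refine Finset.sum_congr rfl fun x _ => ?_
    by_cases hp : p x <;> simp [h, hp]
  · intro x hx; rw [Finsupp.filter_apply] at hx; split_ifs at hx <;> simp_all
  · intro x hx; rw [Finsupp.filter_apply] at hx; split_ifs at hx <;> simp_all

/-! ## Hadamard transforms of a block of qubits -/

/-- Hadamard gates on the qubits `0, …, c - 1`, in this order. -/
noncomputable def hadUp : ℕ → QVec → QVec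
  | 0, ψ => ψ
  | c + 1, ψ => hGate c (hadUp c ψ)

/-- Hadamard gates on the qubits `c - 1, …, 0`, in this order. -/
noncomputable def hadDown : ℕ → QVec → QVec
  | 0, ψ => ψ
  | c + 1, ψ => hadDown c (hGate c ψ)

/-- The opposite orders let the gates cancel in pairs from the inside; no gates on different qubits
have to be commuted. -/
theorem hadUp_hadDown (c : ℕ) (ψ : QVec) : hadUp c (hadDown c ψ) = ψ := by
  induction c generalizing ψ with
  | zero => rfl
  | succ c ih => rw [hadUp, hadDown, ih, hGate_hGate]

theorem hadUp_add (c : ℕ) (ψ φ : QVec) : hadUp c (ψ + φ) = hadUp c ψ + hadUp c φ := by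
  induction c with
  | zero => rfl
  | succ c ih => simp only [hadUp, ih, hGate_add]

theorem hadUp_smul (c : ℕ) (a : ℂ) (ψ : QVec) : hadUp c (a • ψ) = a • hadUp c ψ := by
  induction c with
  | zero => rfl
  | succ c ih => simp only [hadUp, ih, hGate_smul]

open Classical in
/-- The basis states that agree with `x` from qubit `c` on. -/
noncomputable def cube (x : Basis) : ℕ → Finset Basis
  | 0 => {x}
  | c + 1 => cube x c ∪ (cube x c).image (flipQubit c)

theorem mem_cube {x y : Basis} {c : ℕ} : y ∈ cube x c ↔ ∀ q, c ≤ q → y q = x q := by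
  induction c generalizing y with
  | zero => simp [cube, funext_iff]
  | succ c ih =>
    simp only [cube, Finset.mem_union, Finset.mem_image]
    constructor
    · rintro (h | ⟨z, h, rfl⟩) q hq
      · exact ih.1 h q (by omega)
      · rw [flipQubit_of_ne (by omega)]; exact ih.1 h q (by omega)
    · intro h
      by_cases hc : y c = x c
      · left
        refine ih.2 fun q hq => ?_
        rcases hq.eq_or_lt with rfl | hq
        · exact hc
        · exact h q hq
      · right
        refine ⟨flipQubit c y, ih.2 fun q hq => ?_, flipQubit_involutive c y⟩
        rcases hq.eq_or_lt with rfl | hq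
        · rw [flipQubit_self]; cases hy : y c <;> cases hx : x c <;> simp_all
        · rw [flipQubit_of_ne (by omega)]; exact h q hq

theorem self_mem_cube (x : Basis) (c : ℕ) : x ∈ cube x c := mem_cube.2 fun _ _ => rfl

theorem disjoint_cube_flip (x : Basis) (c : ℕ) {y : Basis} (hy : y ∈ cube x c) :
    flipQubit c y ∉ cube x c := by
  intro h
  have h1 := mem_cube.1 h c le_rfl
  rw [flipQubit_self, mem_cube.1 hy c le_rfl] at h1
  simp at h1

theorem sum_cube_succ {M : Type*} [AddCommMonoid M] (x : Basis) (c : ℕ) (h : Basis → M) :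
    ∑ y ∈ cube x (c + 1), h y = ∑ y ∈ cube x c, (h y + h (flipQubit c y)) := by
  classical
  rw [cube, Finset.sum_union, Finset.sum_image, Finset.sum_add_distrib]
  · intro a _ b _ hab; exact (flipQubit_involutive c).injective hab
  · rw [Finset.disjoint_right]
    intro z hz
    obtain ⟨y, hy, rfl⟩ := Finset.mem_image.1 hz
    exact disjoint_cube_flip x c hy

theorem card_cube (x : Basis) (c : ℕ) : (cube x c).card = 2 ^ c := by
  induction c with
  | zero => simp [cube]
  | succ c ih =>
    have := sum_cube_succ x c fun _ => 1
    simp only [Finset.sum_const, smul_eq_mul, mul_one] at this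
    rw [this, ih, pow_succ]

/-- Diffusion needs the amplitude of the transform only where the index qubits are zero. There all
signs of the Hadamard matrix are positive, and what remains is a plain sum. -/
theorem hadDown_apply {x : Basis} {c : ℕ} (hx : ∀ q < c, x q = false) (ψ : QVec) :
    hadDown c ψ x = ((1 / Real.sqrt 2 : ℝ) : ℂ) ^ c * ∑ y ∈ cube x c, ψ y := by
  induction c generalizing ψ with
  | zero => simp [hadDown, cube]
  | succ c ih =>
    rw [hadDown, ih (fun q hq => hx q (by omega)), sum_cube_succ, pow_succ, mul_assoc]
    congr 1
    rw [Finset.mul_sum]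
    refine Finset.sum_congr rfl fun y hy => ?_
    exact hGate_apply_of_false (by rw [mem_cube.1 hy c le_rfl]; exact hx c (by omega)) ψ

theorem hGate_support {x : Basis} {c q : ℕ} (hq : q < c) {ψ : QVec}
    (h : ∀ y, ψ y ≠ 0 → y ∈ cube x c) (y : Basis) (hy : hGate q ψ y ≠ 0) : y ∈ cube x c := by
  by_contra hc
  have key : ∀ b, ψ (Function.update y q b) = 0 := by
    intro b
    by_contra hb
    have h1 := mem_cube.1 (h _ hb)
    refine hc (mem_cube.2 fun r hr => ?_)
    rw [← h1 r hr, Function.update_of_ne (by omega)]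
  exact hy (by rw [hGate_apply, key, key]; simp)

theorem hadDown_support {x : Basis} {c d : ℕ} (hd : d ≤ c) {ψ : QVec}
    (h : ∀ y, ψ y ≠ 0 → y ∈ cube x c) (y : Basis) (hy : hadDown d ψ y ≠ 0) : y ∈ cube x c := by
  induction d generalizing ψ with
  | zero => exact h y hy
  | succ d ih => exact ih (by omega) (hGate_support (by omega) h) hy

theorem hadUp_single_apply {x : Basis} {c : ℕ} (hx : ∀ q < c, x q = false) (y : Basis)
    [Decidable (y ∈ cube x c)] :
    hadUp c (Finsupp.single x 1) y =
      if y ∈ cube x c then ((1 / Real.sqrt 2 : ℝ) : ℂ) ^ c else 0 := by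
  classical
  induction c generalizing y with
  | zero => simp [hadUp, cube, Finsupp.single_apply, eq_comm]
  | succ c ih =>
    have ih := fun y => ih (fun q hq => hx q (by omega)) y
    -- Since `x` is zero at qubit `c`, setting this qubit to one leaves the smaller cube; only one
    -- of the two terms of `hGate_apply` survives.
    have h1 : ∀ b : Bool, Function.update y c b ∈ cube x c ↔ b = false ∧ y ∈ cube x (c + 1) := by
      intro b
      rw [mem_cube, mem_cube]
      constructor
      · intro h
        have := h c le_rfl
        rw [Function.update_self, hx c (by omega)] at this
        exact ⟨this, fun q hq => by rw [← h q (by omega), Function.update_of_ne (by omega)]⟩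
      · rintro ⟨rfl, h⟩ q hq
        rcases hq.eq_or_lt with rfl | hq
        · rw [Function.update_self, hx c (by omega)]
        · rw [Function.update_of_ne (by omega)]; exact h q hq
    rw [hadUp, hGate_apply, ih, ih]
    simp only [h1]
    by_cases hy : y ∈ cube x (c + 1)
    · simp only [hy, if_true, and_true, Bool.true_eq_false, if_false, mul_zero, add_zero]
      rw [pow_succ, mul_comm]
    · simp [hy]

end QRam

/-! ## A program logic -/

namespace QRam

/-! ### Program relations and their proof rules -/

section Logic

variable {w len : ℕ} {input : ℕ → ℕ → ℕ → ℕ}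

/-- The program has one branch, which ends in `s'`. -/
def Runs (w len : ℕ) (input : ℕ → ℕ → ℕ → ℕ) (p : Prog) (s s' : State) : Prop :=
  ∃ F, ∀ fuel ≥ F, exec w len input fuel p s = [s']

/-- Among the branches of the program there are some on which the values of `φ` in the final state
add up to at least `c`. -/
def Wp (w len : ℕ) (input : ℕ → ℕ → ℕ → ℕ) (p : Prog) (s : State) (φ : State → ℝ) (c : ℝ) : Prop :=
  ∃ (L : List State) (F : ℕ), (∀ fuel ≥ F, L.Sublist (exec w len input fuel p s)) ∧
    c ≤ (L.map φ).sum

/-- `Runs` for a loop whose bound on the number of rounds is separated from the fuel. -/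
def LoopRuns (w len : ℕ) (input : ℕ → ℕ → ℕ → ℕ) (r : ℕ) (p : Prog) (s s' : State) : Prop :=
  ∃ F, ∀ fuel ≥ F, ∀ k ≥ F, whileLoop r (exec w len input fuel p) k s = [s']

/-- `Wp` for a loop whose bound on the number of rounds is separated from the fuel. -/
def LoopWp (w len : ℕ) (input : ℕ → ℕ → ℕ → ℕ) (r : ℕ) (p : Prog) (s : State) (φ : State → ℝ)
    (c : ℝ) : Prop :=
  ∃ (L : List State) (F : ℕ),
    (∀ fuel ≥ F, ∀ k ≥ F, L.Sublist (whileLoop r (exec w len input fuel p) k s)) ∧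
    c ≤ (L.map φ).sum

theorem Runs.of_exec {p : Prog} {s s' : State} (h : ∀ fuel, exec w len input fuel p s = [s']) :
    Runs w len input p s s' := ⟨0, fun _ _ => h _⟩

theorem Runs.seq {p p' : Prog} {s s' s'' : State} (h : Runs w len input p s s')
    (h' : Runs w len input p' s' s'') : Runs w len input (.seq p p') s s'' := by
  obtain ⟨F, h⟩ := h
  obtain ⟨F', h'⟩ := h'
  refine ⟨max F F', fun fuel hf => ?_⟩
  simp [exec, h fuel (le_trans (le_max_left _ _) hf), h' fuel (le_trans (le_max_right _ _) hf)]

theorem Runs.ite_pos {p p' : Prog} {r : ℕ} {s s' : State} (hr : s.reg r ≠ 0)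
    (h : Runs w len input p s.tick s') : Runs w len input (.ite r p p') s s' := by
  obtain ⟨F, h⟩ := h
  exact ⟨F, fun fuel hf => by simp [exec, hr, h fuel hf]⟩

theorem Runs.ite_neg {p p' : Prog} {r : ℕ} {s s' : State} (hr : s.reg r = 0)
    (h : Runs w len input p' s.tick s') : Runs w len input (.ite r p p') s s' := by
  obtain ⟨F, h⟩ := h
  exact ⟨F, fun fuel hf => by simp [exec, hr, h fuel hf]⟩

theorem Runs.wp {p : Prog} {s s' : State} (h : Runs w len input p s s') {φ : State → ℝ} {c : ℝ}
    (hc : c ≤ φ s') : Wp w len input p s φ c := by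
  obtain ⟨F, h⟩ := h
  exact ⟨[s'], F, fun fuel hf => by rw [h fuel hf], by simpa using hc⟩

/-- The empty list of branches is a witness. This disposes of all states that violate an invariant,
since their value is zero. -/
theorem Wp.of_nonpos {p : Prog} {s : State} {φ : State → ℝ} {c : ℝ} (hc : c ≤ 0) :
    Wp w len input p s φ c := ⟨[], 0, fun _ _ => List.nil_sublist _, by simpa using hc⟩

theorem Wp.mono {p : Prog} {s : State} {φ φ' : State → ℝ} {c c' : ℝ} (h : Wp w len input p s φ c)
    (hc : c' ≤ c) (hφ : ∀ s, φ s ≤ φ' s) : Wp w len input p s φ' c' := by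
  obtain ⟨L, F, h, h'⟩ := h
  exact ⟨L, F, h, hc.trans (h'.trans (List.sum_le_sum fun s _ => hφ s))⟩

theorem Wp.const_mul {p : Prog} {s : State} {φ : State → ℝ} {c a : ℝ} (h : Wp w len input p s φ c)
    (ha : 0 ≤ a) : Wp w len input p s (fun s => a * φ s) (a * c) := by
  obtain ⟨L, F, h, h'⟩ := h
  exact ⟨L, F, h, by rw [List.sum_map_mul_left]; exact mul_le_mul_of_nonneg_left h' ha⟩

/-- Common part of the rules for sequences and loops. -/
theorem exists_sublist_flatMap {L : List State} {ψ φ : State → ℝ} {c : ℝ}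
    (hc : c ≤ (L.map ψ).sum) {R : ℕ → State → List State → Prop}
    (hR : ∀ {F F' s K}, F ≤ F' → R F s K → R F' s K)
    (h : ∀ s, ∃ K F, R F s K ∧ ψ s ≤ (K.map φ).sum) :
    ∃ (K : State → List State) (F : ℕ), (∀ s ∈ L, R F s (K s)) ∧
      c ≤ ((L.flatMap K).map φ).sum := by
  choose K F hK hs using h
  -- The sum of finitely many fuel bounds serves as a common bound.
  refine ⟨K, (L.map F).sum, fun s hs => hR ?_ (hK s), hc.trans ?_⟩
  · exact List.single_le_sum (by simp) _ (List.mem_map_of_mem hs)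
  · clear hc
    induction L with
    | nil => simp
    | cons s L ih =>
      simp only [List.map_cons, List.sum_cons, List.flatMap_cons, List.map_append, List.sum_append]
      exact add_le_add (hs s) ih

theorem Wp.seq {p p' : Prog} {s : State} {ψ φ : State → ℝ} {c : ℝ} (h : Wp w len input p s ψ c)
    (h' : ∀ s', Wp w len input p' s' φ (ψ s')) : Wp w len input (.seq p p') s φ c := by
  obtain ⟨L, F, h, hc⟩ := h
  obtain ⟨K, F', hK, hc'⟩ := exists_sublist_flatMap hc
    (R := fun F s K => ∀ fuel ≥ F, K.Sublist (exec w len input fuel p' s))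
    (fun hF h fuel hf => h fuel (hF.trans hf))
    (fun s' => by obtain ⟨K, F, h1, h2⟩ := h' s'; exact ⟨K, F, h1, h2⟩)
  refine ⟨L.flatMap K, max F F', fun fuel hf => ?_, hc'⟩
  refine List.Sublist.trans ?_ ((h fuel (le_trans (le_max_left _ _) hf)).flatMap _)
  exact List.Sublist.flatMap_right _ fun s hs => hK s hs fuel (le_trans (le_max_right _ _) hf)

theorem Runs.seq_wp {p p' : Prog} {s s' : State} {φ : State → ℝ} {c : ℝ}
    (h : Runs w len input p s s') (h' : Wp w len input p' s' φ c) :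
    Wp w len input (.seq p p') s φ c := by
  obtain ⟨F, h⟩ := h
  obtain ⟨L, F', h', hc⟩ := h'
  refine ⟨L, max F F', fun fuel hf => ?_, hc⟩
  simpa [exec, h fuel (le_trans (le_max_left _ _) hf)] using
    h' fuel (le_trans (le_max_right _ _) hf)

theorem Wp.ite_pos {p p' : Prog} {r : ℕ} {s : State} {φ : State → ℝ} {c : ℝ} (hr : s.reg r ≠ 0)
    (h : Wp w len input p s.tick φ c) : Wp w len input (.ite r p p') s φ c := by
  obtain ⟨L, F, h, hc⟩ := h
  exact ⟨L, F, fun fuel hf => by simpa [exec, hr] using h fuel hf, hc⟩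

theorem Wp.ite_neg {p p' : Prog} {r : ℕ} {s : State} {φ : State → ℝ} {c : ℝ} (hr : s.reg r = 0)
    (h : Wp w len input p' s.tick φ c) : Wp w len input (.ite r p p') s φ c := by
  obtain ⟨L, F, h, hc⟩ := h
  exact ⟨L, F, fun fuel hf => by simpa [exec, hr] using h fuel hf, hc⟩

/-- `whileLoop` counts its rounds down but leaves the fuel of its body undiminished. An induction on
the rounds must therefore treat the two numbers separately; here they are identified again. -/
theorem LoopRuns.runs {r : ℕ} {p : Prog} {s s' : State} (h : LoopRuns w len input r p s s') :
    Runs w len input (.loop r p) s s' := by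
  obtain ⟨F, h⟩ := h
  exact ⟨F, fun fuel hf => h fuel hf fuel hf⟩

theorem LoopWp.wp {r : ℕ} {p : Prog} {s : State} {φ : State → ℝ} {c : ℝ}
    (h : LoopWp w len input r p s φ c) : Wp w len input (.loop r p) s φ c := by
  obtain ⟨L, F, h, hc⟩ := h
  exact ⟨L, F, fun fuel hf => h fuel hf fuel hf, hc⟩

/-- A loop without measurements: `I m` holds when there are `m` rounds left. -/
theorem Runs.loop {r : ℕ} {p : Prog} (I : ℕ → State → Prop) (hr : ∀ m s, I m s → (s.reg r = 0 ↔ m = 0))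
    (hI : ∀ m s, I (m + 1) s → ∃ s', Runs w len input p s.tick s' ∧ I m s') {m : ℕ} {s : State}
    (h : I m s) : ∃ s', Runs w len input (.loop r p) s s'.tick ∧ I 0 s' := by
  suffices ∃ s', LoopRuns w len input r p s s'.tick ∧ I 0 s' by
    obtain ⟨s', h1, h2⟩ := this; exact ⟨s', h1.runs, h2⟩
  induction m generalizing s with
  | zero =>
    refine ⟨s, ⟨1, fun fuel _ k hk => ?_⟩, h⟩
    obtain ⟨k, rfl⟩ := Nat.exists_eq_add_of_le' hk
    simp [whileLoop, (hr 0 s h).2 rfl]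
  | succ m ih =>
    obtain ⟨s1, ⟨F, h1⟩, h2⟩ := hI m s h
    obtain ⟨s', ⟨F', h3⟩, h4⟩ := ih h2
    refine ⟨s', ⟨max F (F' + 1), fun fuel hf k hk => ?_⟩, h4⟩
    obtain ⟨k, rfl⟩ : ∃ k', k = k' + 1 := ⟨k - 1, by omega⟩
    have h0 : s.reg r ≠ 0 := fun h0 => by simpa using (hr _ s h).1 h0
    simp [whileLoop, h0, h1 fuel (by omega), h3 fuel (by omega) k (by omega)]

/-- A loop of at most `m` rounds: `I m` is a lower bound for the value of the remaining rounds. -/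
theorem Wp.loop {r : ℕ} {p : Prog} {φ : State → ℝ} (I : ℕ → State → ℝ)
    (h : ∀ m s, I m s ≤ 0 ∨ (s.reg r = 0 ∧ I m s ≤ φ s.tick) ∨
      ∃ m', m = m' + 1 ∧ s.reg r ≠ 0 ∧ Wp w len input p s.tick (I m') (I m s)) (m : ℕ)
    (s : State) : Wp w len input (.loop r p) s φ (I m s) := by
  apply LoopWp.wp
  induction m generalizing s with
  | zero =>
    -- The three alternatives: a worthless state, which is dropped; the end of the loop; one more
    -- round, which is impossible when none is left.
    rcases h 0 s with h | ⟨h1, h2⟩ | ⟨m', hm, _⟩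
    · exact ⟨[], 0, by simp, by simpa using h⟩
    · refine ⟨[s.tick], 1, fun fuel _ k hk => ?_, by simpa using h2⟩
      obtain ⟨k, rfl⟩ := Nat.exists_eq_add_of_le' hk
      simp [whileLoop, h1]
    · omega
  | succ m ih =>
    rcases h (m + 1) s with h | ⟨h1, h2⟩ | ⟨m', hm, h1, h2⟩
    · exact ⟨[], 0, by simp, by simpa using h⟩
    · refine ⟨[s.tick], 1, fun fuel _ k hk => ?_, by simpa using h2⟩
      obtain ⟨k, rfl⟩ := Nat.exists_eq_add_of_le' hk
      simp [whileLoop, h1]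
    · obtain rfl : m = m' := by omega
      obtain ⟨L, F, h2, hc⟩ := h2
      obtain ⟨K, F', hK, hc'⟩ := exists_sublist_flatMap hc
        (R := fun F s K => ∀ fuel ≥ F, ∀ k ≥ F,
          K.Sublist (whileLoop r (exec w len input fuel p) k s))
        (fun hF h fuel hf k hk => h fuel (hF.trans hf) k (hF.trans hk))
        (fun s' => by obtain ⟨K, F, h1, h2⟩ := ih s'; exact ⟨K, F, h1, h2⟩)
      refine ⟨L.flatMap K, max F (F' + 1), fun fuel hf k hk => ?_, hc'⟩
      obtain ⟨k, rfl⟩ : ∃ k', k = k' + 1 := ⟨k - 1, by omega⟩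
      rw [whileLoop, if_neg h1]
      refine List.Sublist.trans ?_ ((h2 fuel (by omega)).flatMap _)
      exact List.Sublist.flatMap_right _ fun s hs => hK s hs fuel (by omega) k (by omega)

end Logic

/-- The part of the classical state that a program which uses only the registers from `b` on as
work space leaves alone. -/
structure Frame (b : ℕ) (s s' : State) : Prop where
  reg : ∀ r < b, s'.reg r = s.reg r
  mem : s'.mem = s.mem

theorem Frame.trans {b : ℕ} {s s' s'' : State} (h : Frame b s s') (h' : Frame b s' s'') :
    Frame b s s'' := ⟨fun r hr => (h'.reg r hr).trans (h.reg r hr), h'.mem.trans h.mem⟩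

theorem Frame.mono {b b' : ℕ} {s s' : State} (h : Frame b s s') (hb : b' ≤ b) : Frame b' s s' :=
  ⟨fun r hr => h.reg r (by omega), h.mem⟩

end QRam

/-! ## The rotation in Grover's algorithm -/

namespace QRam

/-- The vector is supported on a cube and takes there one value on the marked basis states and
another one on the others. -/
def TwoValued (x₀ : Basis) (l : ℕ) (f : Basis → Bool) (a : ℂ) (α β : ℝ) (ψ : QVec) : Prop :=
  (∀ x, ψ x ≠ 0 → x ∈ cube x₀ l) ∧
    ∀ x ∈ cube x₀ l, ψ x = a * ((if f x then α else β : ℝ) : ℂ)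

/-- The number of marked basis states in a cube. -/
noncomputable def markedCount (x₀ : Basis) (l : ℕ) (f : Basis → Bool) : ℕ :=
  ((cube x₀ l).filter fun x => f x = true).card

theorem sum_cube_ite {M : Type*} [AddCommGroup M] [Module ℝ M] (x₀ : Basis) (l : ℕ)
    (f : Basis → Bool) (a b : M) :
    ∑ x ∈ cube x₀ l, (if f x then a else b) =
      (markedCount x₀ l f : ℝ) • a + ((2 : ℝ) ^ l - markedCount x₀ l f) • b := by
  rw [Finset.sum_ite, Finset.sum_const, Finset.sum_const]
  have h : ((cube x₀ l).filter fun x => ¬ f x = true).card + markedCount x₀ l f = 2 ^ l := by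
    rw [markedCount, ← card_cube x₀ l, add_comm]
    exact Finset.card_filter_add_card_filter_not _
  have h2 : ((2 : ℝ) ^ l - markedCount x₀ l f) =
      (((cube x₀ l).filter fun x => ¬ f x = true).card : ℝ) := by
    rw [sub_eq_iff_eq_add]; exact_mod_cast h.symm
  rw [h2, Nat.cast_smul_eq_nsmul, Nat.cast_smul_eq_nsmul]
  rfl

theorem TwoValued.normSq_filter {x₀ : Basis} {l : ℕ} {f : Basis → Bool} {a : ℂ} {α β : ℝ} {ψ : QVec}
    (h : TwoValued x₀ l f a α β ψ) (b : Bool) :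
    normSq (ψ.filter fun x => f x = b) =
      ‖a‖ ^ 2 * if b then markedCount x₀ l f * α ^ 2 else (2 ^ l - markedCount x₀ l f) * β ^ 2 := by
  have hs : ∀ x, ψ.filter (fun x => f x = b) x ≠ 0 → x ∈ cube x₀ l := by
    intro x hx
    rw [Finsupp.filter_apply] at hx
    exact h.1 x (by split_ifs at hx; exacts [hx, absurd rfl hx])
  rw [normSq_eq_sum hs]
  have : ∀ x ∈ cube x₀ l, ‖ψ.filter (fun x => f x = b) x‖ ^ 2 =
      if f x then (if b then ‖a‖ ^ 2 * α ^ 2 else 0) else (if b then 0 else ‖a‖ ^ 2 * β ^ 2) := by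
    intro x hx
    rw [Finsupp.filter_apply, h.2 x hx]
    cases f x <;> cases b <;> simp [mul_pow]
  rw [Finset.sum_congr rfl this, sum_cube_ite]
  cases b
  · simp; ring
  · simp; ring

theorem hadUp_single_twoValued {x₀ : Basis} {l : ℕ} (hx : ∀ q < l, x₀ q = false)
    (f : Basis → Bool) (a : ℂ) : TwoValued x₀ l f a ((1 / √2) ^ l) ((1 / √2) ^ l)
      (hadUp l (Finsupp.single x₀ a)) := by
  classical
  have h : Finsupp.single x₀ a = a • Finsupp.single x₀ (1 : ℂ) := by simp
  constructor
  · intro x hx'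
    rw [h, hadUp_smul, Finsupp.smul_apply, hadUp_single_apply hx] at hx'
    by_contra hc
    simp [hc] at hx'
  · intro x hx'
    rw [h, hadUp_smul, Finsupp.smul_apply, hadUp_single_apply hx, if_pos hx']
    simp

/-- A phase flip at `x₀` is the identity minus twice the projection to `x₀`. Conjugation by the
Hadamard transform turns this into a projection to the uniform vector, so twice the mean is
subtracted. The result is the negative of the usual inversion about the mean. -/
theorem diffusion {x₀ : Basis} {l : ℕ} (hx : ∀ q < l, x₀ q = false) {z : Basis → Bool}
    (hz : ∀ x ∈ cube x₀ l, z x = true ↔ x = x₀) {χ η : QVec} (hχ : ∀ x, χ x ≠ 0 → x ∈ cube x₀ l)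
    (hη : ∀ x, η x = (if z x then -1 else 1) * hadDown l χ x) :
    (∀ x, hadUp l η x ≠ 0 → x ∈ cube x₀ l) ∧
    ∀ x ∈ cube x₀ l, hadUp l η x = χ x - 2 * ((1 / 2) ^ l * ∑ y ∈ cube x₀ l, χ y) := by
  classical
  have h1 : η = hadDown l χ + (-2 * hadDown l χ x₀) • Finsupp.single x₀ (1 : ℂ) := by
    ext x
    rw [hη, Finsupp.add_apply, Finsupp.smul_apply, Finsupp.single_apply, smul_eq_mul]
    by_cases h : x = x₀
    · subst h
      rw [if_pos ((hz x (self_mem_cube x l)).2 rfl), if_pos rfl]; ring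
    · rw [if_neg (Ne.symm h)]
      -- `z` is known to recognise `x₀` only within the cube; outside of it the amplitude vanishes.
      by_cases h0 : hadDown l χ x = 0
      · simp [h0]
      · rw [if_neg (fun h' => h ((hz x (hadDown_support le_rfl hχ x h0)).1 h'))]; ring
  have h2 : ((1 / √2 : ℝ) : ℂ) ^ l * ((1 / √2 : ℝ) : ℂ) ^ l = (1 / 2) ^ l := by
    rw [← mul_pow, inv_sqrt_two_sq]
  have h3 : ∀ x, hadUp l η x = χ x - 2 * (hadDown l χ x₀) *
      if x ∈ cube x₀ l then ((1 / √2 : ℝ) : ℂ) ^ l else 0 := by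
    intro x
    rw [h1, hadUp_add, hadUp_smul, hadUp_hadDown, Finsupp.add_apply, Finsupp.smul_apply,
      hadUp_single_apply hx, smul_eq_mul]
    ring
  constructor
  · intro x hx'
    by_contra hc
    have : χ x = 0 := by by_contra h; exact hc (hχ x h)
    rw [h3, if_neg hc, this] at hx'
    simp at hx'
  · intro x hx'
    rw [h3, if_pos hx', hadDown_apply hx]
    linear_combination (-2 * ∑ y ∈ cube x₀ l, χ y) * h2

/-- The amplitudes `α` on marked and `β` on unmarked basis states belong to the angle `φ`. -/
def Amplitudes (l : ℕ) (θ φ α β : ℝ) : Prop :=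
  ∃ ε : ℝ, ε ^ 2 = 1 ∧ √2 ^ l * Real.sin θ * α = ε * Real.sin φ ∧
    √2 ^ l * Real.cos θ * β = ε * Real.cos φ

theorem sqrt_two_pow_sq (l : ℕ) : (√2 ^ l) ^ 2 = 2 ^ l := by
  rw [← pow_mul, mul_comm, pow_mul, Real.sq_sqrt (by norm_num)]

theorem amplitudes_init (l : ℕ) (θ : ℝ) : Amplitudes l θ θ ((1 / √2) ^ l) ((1 / √2) ^ l) := by
  have h : √2 ^ l * (1 / √2) ^ l = 1 := by
    rw [← mul_pow, mul_one_div_cancel (by positivity), one_pow]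
  exact ⟨1, by norm_num, by linear_combination Real.sin θ * h,
    by linear_combination Real.cos θ * h⟩

/-- `μ` is the mean after the phase flip. In the normalised coordinates the iteration is a rotation
by 2θ followed by a change of sign, which `ε` absorbs. Stating the coordinates as products avoids
division by sin θ or cos θ, either of which may be zero. -/
theorem Amplitudes.step {l : ℕ} {θ φ α β : ℝ} (h : Amplitudes l θ φ α β) {μ : ℝ}
    (hμ : μ = Real.cos θ ^ 2 * β - Real.sin θ ^ 2 * α) :
    Amplitudes l θ (φ + 2 * θ) (-α - 2 * μ) (β - 2 * μ) := by
  obtain ⟨ε, h0, h1, h2⟩ := h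
  have h3 : √2 ^ l * μ = ε * (Real.cos θ * Real.cos φ - Real.sin θ * Real.sin φ) := by
    rw [hμ]; linear_combination Real.cos θ * h2 - Real.sin θ * h1
  have hs := Real.sin_sq_add_cos_sq θ
  refine ⟨-ε, by rw [neg_sq, h0], ?_, ?_⟩
  · rw [Real.sin_add, Real.sin_two_mul, Real.cos_two_mul]
    linear_combination -h1 - 2 * Real.sin θ * h3 + 2 * ε * Real.sin φ * hs
  · rw [Real.cos_add, Real.sin_two_mul, Real.cos_two_mul]
    linear_combination h2 - 2 * Real.cos θ * h3

theorem TwoValued.normSq_filter_eq {x₀ : Basis} {l : ℕ} {f : Basis → Bool} {a : ℂ} {θ φ α β : ℝ}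
    {ψ : QVec} (h : TwoValued x₀ l f a α β ψ) (hA : Amplitudes l θ φ α β)
    (hθ : (markedCount x₀ l f : ℝ) = 2 ^ l * Real.sin θ ^ 2) (b : Bool) :
    normSq (ψ.filter fun x => f x = b) =
      ‖a‖ ^ 2 * if b then Real.sin φ ^ 2 else 1 - Real.sin φ ^ 2 := by
  obtain ⟨ε, h0, h1, h2⟩ := hA
  have hN := sqrt_two_pow_sq l
  rw [h.normSq_filter, hθ]
  congr 1
  cases b
  · have : 2 ^ l - 2 ^ l * Real.sin θ ^ 2 = 2 ^ l * Real.cos θ ^ 2 := by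
      rw [Real.cos_sq' θ]; ring
    rw [this, ← Real.cos_sq' φ, ← hN]
    simp only [Bool.false_eq_true, if_false]
    linear_combination (√2 ^ l * Real.cos θ * β + ε * Real.cos φ) * h2 + Real.cos φ ^ 2 * h0
  · rw [← hN]
    simp only [if_true]
    linear_combination (√2 ^ l * Real.sin θ * α + ε * Real.sin φ) * h1 + Real.sin φ ^ 2 * h0

theorem TwoValued.grover_step {x₀ : Basis} {l : ℕ} (hx : ∀ q < l, x₀ q = false)
    {f z : Basis → Bool} (hz : ∀ x ∈ cube x₀ l, z x = true ↔ x = x₀) {a : ℂ} {θ φ α β : ℝ}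
    {ψ χ η : QVec} (h : TwoValued x₀ l f a α β ψ) (hA : Amplitudes l θ φ α β)
    (hθ : (markedCount x₀ l f : ℝ) = 2 ^ l * Real.sin θ ^ 2)
    (hχ : ∀ x, χ x = (if f x then -1 else 1) * ψ x)
    (hη : ∀ x, η x = (if z x then -1 else 1) * hadDown l χ x) :
    ∃ α' β', TwoValued x₀ l f a α' β' (hadUp l η) ∧ Amplitudes l θ (φ + 2 * θ) α' β' := by
  refine ⟨_, _, ?_, hA.step rfl⟩
  have hs : ∀ x, χ x ≠ 0 → x ∈ cube x₀ l := fun x hx' => h.1 x fun h0 => by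
    rw [hχ, h0, mul_zero] at hx'; exact hx' rfl
  obtain ⟨h1, h2⟩ := diffusion hx hz hs hη
  refine ⟨h1, fun x hx' => ?_⟩
  have h3 : ∀ y ∈ cube x₀ l, χ y = if f y then a * ((-α : ℝ) : ℂ) else a * (β : ℂ) := by
    intro y hy
    rw [hχ, h.2 y hy]
    cases f y <;> simp
  -- The mean over the cube: a proportion sin²θ of the states carries −α, the others carry β.
  have h4 : (1 / 2 : ℂ) ^ l * ∑ y ∈ cube x₀ l, χ y =
      a * ((Real.cos θ ^ 2 * β - Real.sin θ ^ 2 * α : ℝ) : ℂ) := by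
    rw [Finset.sum_congr rfl h3, sum_cube_ite, hθ, Real.cos_sq', Complex.real_smul,
      Complex.real_smul]
    have : (1 / 2 : ℂ) ^ l * 2 ^ l = 1 := by rw [← mul_pow]; norm_num
    push_cast
    linear_combination (a * (β * (1 - Complex.sin θ ^ 2) - α * Complex.sin θ ^ 2)) * this
  rw [h2 x hx', h3 x hx', h4]
  cases f x
  · simp; ring
  · simp; ring

/-- The angle of a number of marked basis states. -/
theorem exists_angle {N t : ℝ} (hN : 0 < N) (ht : 0 ≤ t) (htN : t ≤ N) :
    ∃ θ, 0 ≤ θ ∧ θ ≤ Real.pi / 2 ∧ t = N * Real.sin θ ^ 2 := by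
  refine ⟨Real.arcsin √(t / N), Real.arcsin_nonneg.2 (Real.sqrt_nonneg _),
    Real.arcsin_le_pi_div_two _, ?_⟩
  rw [Real.sin_arcsin (by linarith [Real.sqrt_nonneg (t / N)]), Real.sq_sqrt (by positivity)]
  · field_simp
  · exact Real.sqrt_le_iff.2 ⟨zero_le_one, by rw [one_pow, div_le_one hN]; exact htN⟩

theorem half_le_sin_sq {x : ℝ} (h1 : Real.pi / 4 ≤ x) (h2 : x ≤ 3 * (Real.pi / 4)) :
    1 / 2 ≤ Real.sin x ^ 2 := by
  have h : Real.cos (2 * x) ≤ 0 := Real.cos_nonpos_of_pi_div_two_le_of_le (by linarith) (by linarith)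
  rw [Real.cos_two_mul, Real.cos_sq'] at h
  linarith

/-- One of the numbers of Grover iterations `0, 1, 3, 7, …` is good. -/
theorem exists_good_iteration {l K : ℕ} {θ : ℝ} (h0 : 0 ≤ θ) (h1 : θ ≤ Real.pi / 2)
    (hs : 1 ≤ 2 ^ l * Real.sin θ ^ 2) (hK : l ≤ 2 * K) :
    ∃ i ≤ K, 1 / 2 ≤ Real.sin ((2 * (2 ^ i - 1 : ℝ) + 1) * θ) ^ 2 := by
  have hpi := Real.pi_pos
  -- The largest iteration number suffices to pass π/4: θ ≥ sin θ ≥ 2^(-l/2) ≥ 2^(-K), and π/4 ≤ 1.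
  have hex : ∃ i : ℕ, Real.pi / 4 ≤ (2 * (2 ^ i - 1 : ℝ) + 1) * θ ∧ i ≤ K := by
    refine ⟨K, ?_, le_rfl⟩
    have hle : Real.sin θ ≤ θ := Real.sin_le h0
    have hsin0 : 0 ≤ Real.sin θ := Real.sin_nonneg_of_nonneg_of_le_pi h0 (by linarith)
    have h2 : 1 ≤ (2 ^ K * θ) ^ 2 := by
      calc (1 : ℝ) ≤ 2 ^ l * Real.sin θ ^ 2 := hs
        _ ≤ 2 ^ (2 * K) * θ ^ 2 := by
            gcongr
            norm_num
        _ = (2 ^ K * θ) ^ 2 := by rw [mul_pow, ← pow_mul, mul_comm K 2]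
    have h3 : 1 ≤ 2 ^ K * θ := (one_le_sq_iff₀ (by positivity)).1 h2
    have h4 : (1 : ℝ) ≤ 2 ^ K := one_le_pow₀ (by norm_num)
    have h5 : 2 ^ K * θ ≤ (2 * (2 ^ K - 1 : ℝ) + 1) * θ :=
      mul_le_mul_of_nonneg_right (by linarith) h0
    linarith [Real.pi_le_four]
  classical
  -- For the first such `i` the angle is not too large either: it is at most three times the
  -- previous one, which was below π/4, and for `i = 0` it is θ ≤ π/2.
  set i := Nat.find hex with hi
  obtain ⟨hi1, hi2⟩ := Nat.find_spec hex
  refine ⟨i, hi2, half_le_sin_sq hi1 ?_⟩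
  rcases Nat.eq_zero_or_pos i with h | h
  · rw [h]; norm_num; linarith
  · obtain ⟨j, hj⟩ := Nat.exists_eq_add_of_le' h
    have hnot := Nat.find_min hex (m := j) (by omega)
    have hlt : (2 * (2 ^ j - 1 : ℝ) + 1) * θ < Real.pi / 4 := by
      by_contra hc
      exact hnot ⟨not_lt.1 hc, by omega⟩
    have h4 : (1 : ℝ) ≤ 2 ^ j := one_le_pow₀ (by norm_num)
    have h5 : (2 * (2 ^ i - 1 : ℝ) + 1) * θ ≤ 3 * ((2 * (2 ^ j - 1 : ℝ) + 1) * θ) := by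
      rw [← mul_assoc]
      refine mul_le_mul_of_nonneg_right ?_ h0
      rw [hj, pow_succ]; linarith
    linarith

end QRam

/-! ## Grover's algorithm as a program

Registers: `1` holds the number one, `2` the length of a block of qubits, `3` the address of an
array `1, 0, 0, …`, `5`, `6`, `7` and `8` the first qubits of the blocks for the query result, the
look-up result, the flag, and the index, `10` the address of an array of marks, `14` the number of
index qubits in use, and `17` the number of iterations.  Register `20` is set to one if a marked index
is found. -/

namespace QRam

namespace Prog

/-- Do nothing. -/
def skip : Prog := .move 24 24

/-- Hadamard gates on the index qubits, upwards. -/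
def hadUp : Prog :=
  .seq (.move 23 8) <| .seq (.move 22 14) <| .loop 22 <|
    .seq (.had 23) <| .seq (.add 23 23 1) (.sub 22 22 1)

/-- Hadamard gates on the index qubits, downwards. -/
def hadDown : Prog :=
  .seq (.move 23 14) <| .seq (.move 22 14) <| .loop 22 <|
    .seq (.sub 23 23 1) <| .seq (.had 23) (.sub 22 22 1)

/-- A phase `-1` if the flag is set. -/
def phase : Prog := .seq (.tee 7) <| .seq (.tee 7) <| .seq (.tee 7) (.tee 7)

/-- Compute the flag. -/
def oracle (a b : ℕ) : Prog := .seq (.query 1 2 8 5) <| .seq (.lookup 10 a 6) (.toffoli b 6 7)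

/-- Uncompute the flag. -/
def oracleInv (a b : ℕ) : Prog := .seq (.toffoli b 6 7) <| .seq (.lookup 10 a 6) (.query 1 2 8 5)

/-- A Grover iteration. -/
def groverIter (a b : ℕ) : Prog :=
  .seq (oracle a b) <| .seq phase <| .seq (oracleInv a b) <| .seq hadDown <|
    .seq (.lookup 3 8 7) <| .seq phase <| .seq (.lookup 3 8 7) <| .seq hadUp (.sub 21 21 1)

/-- All Grover iterations. -/
def rotate (a b : ℕ) : Prog :=
  .seq hadUp <| .seq (.move 21 17) (.loop 21 (groverIter a b))

/-- Reset the index qubits. -/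
def reset : Prog :=
  .seq (.move 23 14) <| .seq (.move 22 14) <| .loop 22 <|
    .seq (.sub 23 23 1) <| .seq (.measure 24 23) <| .seq (.ite 24 (.not 23) skip) (.sub 22 22 1)

/-- A run of Grover's algorithm. -/
def grover (a b : ℕ) : Prog :=
  .seq (rotate a b) <| .seq (oracle a b) <| .seq (.measure 24 7) <| .seq (oracleInv a b) <|
    .seq (.ite 24 (.move 20 1) skip) reset

end Prog

/-- The constants that the programs expect in registers and memory. -/
structure Static (len : ℕ) (s : State) : Prop where
  one : s.reg 1 = 1
  blockLen : s.reg 2 = len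
  zbase : s.reg 3 = 2 ^ len
  t1 : s.reg 5 = 2 * len
  t2 : s.reg 6 = 3 * len
  flag : s.reg 7 = 4 * len
  zero : s.reg 8 = 0
  memz : ∀ i < 2 ^ len, s.mem (2 ^ len + i) = if i = 0 then 1 else 0

theorem Static.frame {len b : ℕ} {s s' : State} (h : Static len s) (hb : 9 ≤ b)
    (hf : Frame b s s') : Static len s' := by
  obtain ⟨h1, h2, h3, h5, h6, h7, h8, hm⟩ := h
  constructor
  · rw [hf.reg _ (by omega), h1]
  · rw [hf.reg _ (by omega), h2]
  · rw [hf.reg _ (by omega), h3]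
  · rw [hf.reg _ (by omega), h5]
  · rw [hf.reg _ (by omega), h6]
  · rw [hf.reg _ (by omega), h7]
  · rw [hf.reg _ (by omega), h8]
  · rw [hf.mem]; exact hm

/-- A diagonal operator conjugated by permutations of the basis is again diagonal, with permuted
factors. -/
theorem conj_apply {g₁ g₂ g₃ : Basis → Basis} (h₁ : Function.Involutive g₁)
    (h₂ : Function.Involutive g₂) (h₃ : Function.Involutive g₃) {ψ χ : QVec} {c : Basis → ℂ}
    (hχ : ∀ x, χ x = c x * permute g₃ (permute g₂ (permute g₁ ψ)) x) (x : Basis) :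
    permute g₁ (permute g₂ (permute g₃ χ)) x = c (g₃ (g₂ (g₁ x))) * ψ x := by
  simp only [permute_apply h₁, permute_apply h₂, permute_apply h₃, hχ, h₁ x, h₂ (g₁ x),
    h₃ (g₂ (g₁ x))]

/-- What `Prog.oracle` does to the basis states. -/
def oracleMap (len : ℕ) (tbl : ℕ → ℕ → ℕ) (s : State) (a b : ℕ) (x : Basis) : Basis :=
  ccxMap (s.reg b) (3 * len) (4 * len)
    (lookupMap len (fun u => s.mem (s.reg 10 + u)) (s.reg a) (3 * len)
      (queryMap len tbl len 0 (2 * len) x))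

/-- The indices on which `Prog.oracle` sets the flag. -/
def marked (len : ℕ) (tbl : ℕ → ℕ → ℕ) (s : State) (a b : ℕ) (x : Basis) : Bool :=
  oracleMap len tbl s a b x (4 * len)

theorem marked_frame {len : ℕ} {tbl : ℕ → ℕ → ℕ} {s s' : State} {a b c : ℕ} (hf : Frame c s s')
    (ha : a < c) (hb : b < c) (hc : 10 < c) : marked len tbl s' a b = marked len tbl s a b := by
  unfold marked oracleMap
  rw [hf.reg _ ha, hf.reg _ hb, hf.reg _ hc, hf.mem]

/-! ### The building blocks of Grover's algorithm -/

section

variable {len : ℕ} {input : ℕ → ℕ → ℕ → ℕ}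

theorem hadUp_runs {s : State} {l : ℕ} (h1 : s.reg 1 = 1) (h8 : s.reg 8 = 0) (h14 : s.reg 14 = l)
    (hl : l < 2 ^ (4 * len)) :
    ∃ s', Runs (4 * len) len input Prog.hadUp s s' ∧ Frame 21 s s' ∧ s'.vec = hadUp l s.vec ∧
      s'.reg 21 = s.reg 21 ∧ s'.time ≤ s.time + (4 * l + 3) := by
  let s1 : State := ⟨Function.update (Function.update s.reg 23 0) 22 l, s.mem, s.vec, s.time + 2⟩
  obtain ⟨s', hr, -, h23, hv, hf, h21, ht⟩ := Runs.loop (w := 4 * len) (len := len) (input := input)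
    (r := 22) (p := .seq (.had 23) <| .seq (.add 23 23 1) (.sub 22 22 1)) (m := l) (s := s1)
    -- A round costs three operations and the loop test. The failing last test is the tick of
    -- `s'.tick` below.
    (fun m t => t.reg 22 = m ∧ t.reg 23 + m = l ∧ t.vec = hadUp (t.reg 23) s.vec ∧ Frame 21 s t ∧
      t.reg 21 = s.reg 21 ∧ t.time + 4 * m ≤ s.time + (4 * l + 2)) (fun _ _ h => by rw [h.1])
    (by
      rintro m t ⟨h22, h23, hv, hf, h21, ht⟩
      refine ⟨⟨Function.update (Function.update t.reg 23 (t.reg 23 + 1)) 22 m, t.mem,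
        hGate (t.reg 23) t.vec, t.time + 4⟩, Runs.of_exec fun _ => ?_, ?_⟩
      · have : t.reg 1 = 1 := by rw [hf.reg 1 (by omega), h1]
        have hmod : (t.reg 23 + 1) % 2 ^ (4 * len) = t.reg 23 + 1 := Nat.mod_eq_of_lt (by omega)
        simp [exec, State.tick, State.gate, State.setReg, this, h22, hmod]
      · refine ⟨by simp, by simp; omega, by simp [hadUp, hv], ⟨fun r hr => ?_, hf.mem⟩,
          by simpa using h21, by simp; omega⟩
        have e1 : r ≠ 22 := by omega
        have e2 : r ≠ 23 := by omega
        simpa [e1, e2] using hf.reg r hr)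
    ⟨by simp [s1], by simp [s1], by simp [s1, hadUp], ⟨fun r hr => by
      have e1 : r ≠ 22 := by omega
      have e2 : r ≠ 23 := by omega
      simp [s1, e1, e2], rfl⟩, by simp [s1], by simp [s1]; omega⟩
  refine ⟨s'.tick, Runs.seq (s' := ⟨Function.update s.reg 23 0, s.mem, s.vec, s.time + 1⟩)
    (Runs.of_exec fun _ => ?_) (Runs.seq (s' := s1) (Runs.of_exec fun _ => ?_) hr),
    ⟨hf.reg, hf.mem⟩, ?_, h21, ?_⟩
  · simp [exec, State.tick, State.setReg, h8]
  · simp [exec, State.tick, State.setReg, h14, s1]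
  · have : s'.reg 23 = l := by omega
    rw [this] at hv; exact hv
  · simp [State.tick]; omega

theorem hadDown_runs {s : State} {l : ℕ} (h1 : s.reg 1 = 1) (h14 : s.reg 14 = l) :
    ∃ s', Runs (4 * len) len input Prog.hadDown s s' ∧ Frame 21 s s' ∧
      s'.vec = hadDown l s.vec ∧ s'.reg 21 = s.reg 21 ∧ s'.time ≤ s.time + (4 * l + 3) := by
  let s1 : State := ⟨Function.update (Function.update s.reg 23 l) 22 l, s.mem, s.vec, s.time + 2⟩
  obtain ⟨s', hr, -, -, hv, hf, h21, ht⟩ := Runs.loop (w := 4 * len) (len := len) (input := input)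
    (r := 22) (p := .seq (.sub 23 23 1) <| .seq (.had 23) (.sub 22 22 1)) (m := l) (s := s1)
    (fun m t => t.reg 22 = m ∧ t.reg 23 = m ∧ hadDown m t.vec = hadDown l s.vec ∧ Frame 21 s t ∧
      t.reg 21 = s.reg 21 ∧ t.time + 4 * m ≤ s.time + (4 * l + 2)) (fun _ _ h => by rw [h.1])
    (by
      rintro m t ⟨h22, h23, hv, hf, h21, ht⟩
      refine ⟨⟨Function.update (Function.update t.reg 23 m) 22 m, t.mem,
        hGate m t.vec, t.time + 4⟩, Runs.of_exec fun _ => ?_, ?_⟩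
      · have : t.reg 1 = 1 := by rw [hf.reg 1 (by omega), h1]
        simp [exec, State.tick, State.gate, State.setReg, this, h22, h23]
      · refine ⟨by simp, by simp, hv, ⟨fun r hr => ?_, hf.mem⟩,
          by simpa using h21, by simp; omega⟩
        have e1 : r ≠ 22 := by omega
        have e2 : r ≠ 23 := by omega
        simpa [e1, e2] using hf.reg r hr)
    ⟨by simp [s1], by simp [s1], by simp [s1], ⟨fun r hr => by
      have e1 : r ≠ 22 := by omega
      have e2 : r ≠ 23 := by omega
      simp [s1, e1, e2], rfl⟩, by simp [s1], by simp [s1]; omega⟩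
  refine ⟨s'.tick, Runs.seq (s' := ⟨Function.update s.reg 23 l, s.mem, s.vec, s.time + 1⟩)
    (Runs.of_exec fun _ => ?_) (Runs.seq (s' := s1) (Runs.of_exec fun _ => ?_) hr),
    ⟨hf.reg, hf.mem⟩, hv, h21, ?_⟩
  · simp [exec, State.tick, State.setReg, h14]
  · simp [exec, State.tick, State.setReg, h14, s1]
  · simp [State.tick]; omega

theorem phase_runs (s : State) : ∃ s', Runs (4 * len) len input Prog.phase s s' ∧
    s'.reg = s.reg ∧ s'.mem = s.mem ∧ s'.time = s.time + 4 ∧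
    ∀ x, s'.vec x = (if x (s.reg 7) then -1 else 1) * s.vec x :=
  ⟨⟨s.reg, s.mem, tGate (s.reg 7) (tGate (s.reg 7) (tGate (s.reg 7) (tGate (s.reg 7) s.vec))),
      s.time + 4⟩, Runs.of_exec fun _ => by simp [exec, Prog.phase, State.tick, State.gate],
    rfl, rfl, rfl, tGate_four _ _⟩

theorem oracle_runs {s : State} (h : Static len s) (a b : ℕ) :
    ∃ s', Runs (4 * len) len input (Prog.oracle a b) s s' ∧
      s'.reg = s.reg ∧ s'.mem = s.mem ∧ s'.time = s.time + 3 ∧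
      s'.vec = permute (ccxMap (s.reg b) (3 * len) (4 * len))
      (permute (lookupMap len (fun u => s.mem (s.reg 10 + u)) (s.reg a) (3 * len))
        (permute (queryMap len (input 1) len 0 (2 * len)) s.vec)) :=
  ⟨⟨s.reg, s.mem, permute (ccxMap (s.reg b) (3 * len) (4 * len))
      (permute (lookupMap len (fun u => s.mem (s.reg 10 + u)) (s.reg a) (3 * len))
        (permute (queryMap len (input 1) len 0 (2 * len)) s.vec)), s.time + 3⟩, Runs.of_exec fun _ => by
    simp only [exec, Prog.oracle, State.tick, State.gate, ccxGate_eq, lookupGate_eq, queryGate_eq,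
      h.blockLen, h.zero, h.t1, h.t2, h.flag, List.flatMap_cons, List.flatMap_nil, List.append_nil],
    rfl, rfl, rfl, rfl⟩

theorem oracleInv_runs {s : State} (h : Static len s) (a b : ℕ) :
    ∃ s', Runs (4 * len) len input (Prog.oracleInv a b) s s' ∧
      s'.reg = s.reg ∧ s'.mem = s.mem ∧ s'.time = s.time + 3 ∧
      s'.vec = permute (queryMap len (input 1) len 0 (2 * len))
      (permute (lookupMap len (fun u => s.mem (s.reg 10 + u)) (s.reg a) (3 * len))
        (permute (ccxMap (s.reg b) (3 * len) (4 * len)) s.vec)) :=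
  ⟨⟨s.reg, s.mem, permute (queryMap len (input 1) len 0 (2 * len))
      (permute (lookupMap len (fun u => s.mem (s.reg 10 + u)) (s.reg a) (3 * len))
        (permute (ccxMap (s.reg b) (3 * len) (4 * len)) s.vec)), s.time + 3⟩, Runs.of_exec fun _ => by
    simp only [exec, Prog.oracleInv, State.tick, State.gate, ccxGate_eq, lookupGate_eq, queryGate_eq,
      h.blockLen, h.zero, h.t1, h.t2, h.flag, List.flatMap_cons, List.flatMap_nil, List.append_nil],
    rfl, rfl, rfl, rfl⟩

/-- Between `Prog.oracle` and `Prog.oracleInv`, a factor that depends on the flag turns into a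
factor that depends on the mark. -/
theorem oracle_conj (tbl : ℕ → ℕ → ℕ) (s : State) (a b : ℕ) {ψ χ : QVec} {c : Bool → ℂ}
    (hχ : ∀ x, χ x = c (x (4 * len)) * permute (ccxMap (s.reg b) (3 * len) (4 * len))
      (permute (lookupMap len (fun u => s.mem (s.reg 10 + u)) (s.reg a) (3 * len))
        (permute (queryMap len tbl len 0 (2 * len)) ψ)) x) (x : Basis) :
    permute (queryMap len tbl len 0 (2 * len))
      (permute (lookupMap len (fun u => s.mem (s.reg 10 + u)) (s.reg a) (3 * len))
        (permute (ccxMap (s.reg b) (3 * len) (4 * len)) χ)) x =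
      c (marked len tbl s a b x) * ψ x :=
  conj_apply (queryMap_involutive _ _ _ _ _) (lookupMap_involutive _ _ _ _)
    (ccxMap_involutive _ _ _) (c := fun x => c (x (4 * len))) hχ x

/-- The continuation `p` is a parameter because sequences nest to the right, so that these three
blocks do not form a subprogram of their own. -/
theorem phaseOracle_runs {s : State} (h : Static len s) (a b : ℕ) {p : Prog} {s'' : State → Prop}
    (hp : ∀ s', s'.reg = s.reg → s'.mem = s.mem → s'.time = s.time + 10 →
      (∀ x, s'.vec x = (if marked len (input 1) s a b x then -1 else 1) * s.vec x) →
      ∃ t, Runs (4 * len) len input p s' t ∧ s'' t) :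
    ∃ t, Runs (4 * len) len input (.seq (Prog.oracle a b) <| .seq Prog.phase <|
      .seq (Prog.oracleInv a b) p) s t ∧ s'' t := by
  obtain ⟨s1, r1, hr1, hm1, ht1, hv1⟩ := oracle_runs (input := input) h a b
  obtain ⟨s2, r2, hr2, hm2, ht2, hv2⟩ := phase_runs (len := len) (input := input) s1
  have hf : Frame 21 s s2 := ⟨fun r _ => by rw [hr2, hr1], by rw [hm2, hm1]⟩
  obtain ⟨s3, r3, hr3, hm3, ht3, hv3⟩ := oracleInv_runs (input := input)
    (h.frame (by norm_num) hf) a b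
  obtain ⟨t, rt, ht⟩ := hp s3 (by rw [hr3, hr2, hr1]) (by rw [hm3, hm2, hm1]) (by omega) (by
    intro x
    rw [hv3, hr2, hr1, hm2, hm1]
    exact oracle_conj (input 1) s a b (c := fun y => if y then -1 else 1)
      (fun x => by rw [hv2, hv1, hr1, h.flag]) x)
  exact ⟨t, r1.seq (r2.seq (r3.seq rt)), ht⟩

theorem phaseZero_runs {s : State} (h : Static len s) {p : Prog} {s'' : State → Prop}
    (hp : ∀ s', s'.reg = s.reg → s'.mem = s.mem → s'.time = s.time + 6 →
      (∀ x, s'.vec x =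
        (if lookupMap len (fun v => s.mem (2 ^ len + v)) 0 (4 * len) x (4 * len) then -1 else 1) *
          s.vec x) → ∃ t, Runs (4 * len) len input p s' t ∧ s'' t) :
    ∃ t, Runs (4 * len) len input (.seq (.lookup 3 8 7) <| .seq Prog.phase <|
      .seq (.lookup 3 8 7) p) s t ∧ s'' t := by
  have hl : ∀ s : State, Static len s → ∃ s', Runs (4 * len) len input (.lookup 3 8 7) s s' ∧
      s'.reg = s.reg ∧ s'.mem = s.mem ∧ s'.time = s.time + 1 ∧
      s'.vec = permute (lookupMap len (fun v => s.mem (2 ^ len + v)) 0 (4 * len)) s.vec :=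
    fun s h => ⟨⟨s.reg, s.mem,
      permute (lookupMap len (fun v => s.mem (2 ^ len + v)) 0 (4 * len)) s.vec, s.time + 1⟩, Runs.of_exec fun _ => by
      simp only [exec, State.tick, State.gate, lookupGate_eq, h.zbase, h.zero, h.flag],
      rfl, rfl, rfl, rfl⟩
  obtain ⟨s1, r1, hr1, hm1, ht1, hv1⟩ := hl s h
  obtain ⟨s2, r2, hr2, hm2, ht2, hv2⟩ := phase_runs (len := len) (input := input) s1
  have hf : Frame 21 s s2 := ⟨fun r _ => by rw [hr2, hr1], by rw [hm2, hm1]⟩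
  obtain ⟨s3, r3, hr3, hm3, ht3, hv3⟩ := hl s2 (h.frame (by norm_num) hf)
  obtain ⟨t, rt, ht⟩ := hp s3 (by rw [hr3, hr2, hr1]) (by rw [hm3, hm2, hm1]) (by omega) (by
    intro x
    rw [hv3, hm2, hm1, permute_apply (lookupMap_involutive _ _ _ _), hv2, hv1, hr1, h.flag,
      permute_apply (lookupMap_involutive _ _ _ _), lookupMap_involutive _ _ _ _ x])
  exact ⟨t, r1.seq (r2.seq (r3.seq rt)), ht⟩

/-- Looking up the index in the array 1, 0, 0, … raises the flag exactly for index zero. This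
replaces a NOT gate with many controls by a single operation. -/
theorem zero_test {s : State} (hs : Static len s) (hlen : 0 < len) {l : ℕ} (hl : l ≤ len)
    {x₀ : Basis} (hx₀ : ∀ q, q < len ∨ 2 * len ≤ q → x₀ q = false) {x : Basis}
    (hx : x ∈ cube x₀ l) :
    lookupMap len (fun v => s.mem (2 ^ len + v)) 0 (4 * len) x (4 * len) = true ↔ x = x₀ := by
  have hd : BlocksDisjoint len 0 (4 * len) := Or.inl (by omega)
  have hc := mem_cube.1 hx
  have h4 : x (4 * len) = false := by rw [hc _ (by omega), hx₀ _ (by omega)]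
  have hin := fun v => xorBlock_inside (t := 4 * len) (v := v) hlen x
  simp only [add_zero] at hin
  rw [lookupMap, if_pos hd, hin, h4, hs.memz _ (blockVal_lt _ _ _)]
  have key : blockVal len 0 x = 0 ↔ x = x₀ := by
    rw [blockVal_eq_zero_iff]
    constructor
    · intro h
      funext q
      by_cases hq : q < len
      · rw [hx₀ q (Or.inl hq)]; simpa using h q hq
      · exact hc q (by omega)
    · rintro rfl j hj
      rw [zero_add]; exact hx₀ j (Or.inl hj)
  rw [← key]
  by_cases h : blockVal len 0 x = 0 <;> simp [h]

theorem groverIter_runs {s : State} (hs : Static len s) (hlen : 0 < len) {l a b : ℕ} (hl : l ≤ len)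
    (h14 : s.reg 14 = l) {x₀ : Basis} (hx₀ : ∀ q, q < len ∨ 2 * len ≤ q → x₀ q = false)
    {A : ℂ} {θ φ α β : ℝ} (h : TwoValued x₀ l (marked len (input 1) s a b) A α β s.vec)
    (hA : Amplitudes l θ φ α β)
    (hθ : (markedCount x₀ l (marked len (input 1) s a b) : ℝ) = 2 ^ l * Real.sin θ ^ 2) :
    ∃ s', Runs (4 * len) len input (Prog.groverIter a b) s s' ∧ Frame 21 s s' ∧
      (∃ α' β', TwoValued x₀ l (marked len (input 1) s a b) A α' β' s'.vec ∧
        Amplitudes l θ (φ + 2 * θ) α' β') ∧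
      s'.reg 21 = s.reg 21 - 1 ∧ s'.time ≤ s.time + (8 * l + 23) := by
  have hw : l < 2 ^ (4 * len) := lt_of_lt_of_le (by omega) (Nat.lt_two_pow_self (n := 4 * len)).le
  refine phaseOracle_runs hs a b fun s3 hr3 hm3 ht3 hχ => ?_
  have hf3 : Frame 21 s s3 := ⟨fun r _ => by rw [hr3], hm3⟩
  have hs3 := hs.frame (by norm_num) hf3
  obtain ⟨s4, r4, hf4, hv4, h21, ht4⟩ := hadDown_runs (len := len) (input := input) (s := s3)
    hs3.one (l := l) (by rw [hr3]; exact h14)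
  have hs4 := hs3.frame (by norm_num) hf4
  suffices ∃ s', Runs (4 * len) len input (.seq (.lookup 3 8 7) <| .seq Prog.phase <|
      .seq (.lookup 3 8 7) <| .seq Prog.hadUp (.sub 21 21 1)) s4 s' ∧ Frame 21 s4 s' ∧
      (∃ α' β', TwoValued x₀ l (marked len (input 1) s a b) A α' β' s'.vec ∧
        Amplitudes l θ (φ + 2 * θ) α' β') ∧
      s'.reg 21 = s.reg 21 - 1 ∧ s'.time ≤ s.time + (8 * l + 23) by
    obtain ⟨s', r, hf, h⟩ := this
    exact ⟨s', r4.seq r, (hf3.trans hf4).trans hf, h⟩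
  refine phaseZero_runs hs4 fun s5 hr5 hm5 ht5 hη => ?_
  have hf5 : Frame 21 s4 s5 := ⟨fun r _ => by rw [hr5], hm5⟩
  have hs5 := hs4.frame (by norm_num) hf5
  obtain ⟨s6, r6, hf6, hv6, h21', ht6⟩ := hadUp_runs (len := len) (input := input) (s := s5)
    hs5.one hs5.zero (l := l)
    (by rw [hf5.reg 14 (by norm_num), hf4.reg 14 (by norm_num), hr3]; exact h14) hw
  have hs6 := hs5.frame (by norm_num) hf6
  refine ⟨⟨Function.update s6.reg 21 (s6.reg 21 - 1), s6.mem, s6.vec, s6.time + 1⟩,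
    Runs.seq r6 (Runs.of_exec fun _ => ?_), ?_, ?_, ?_, ?_⟩
  · simp [exec, State.tick, State.setReg, hs6.one]
  · have := hf5.trans hf6
    exact ⟨fun r hr => by simpa [show r ≠ 21 by omega] using this.reg r hr, this.mem⟩
  · have := h.grover_step (fun q hq => hx₀ q (Or.inl (by omega)))
      (fun x hx => zero_test hs4 hlen hl hx₀ hx) hA hθ hχ (by rw [← hv4]; exact hη)
    rwa [← hv6] at this
  · simp only [Function.update_self, h21', hr5, h21, hr3]
  · show s6.time + 1 ≤ _
    omega

theorem rotate_runs {s : State} (hs : Static len s) (hlen : 0 < len) {l a b : ℕ} (hl : l ≤ len)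
    (ha : a < 20) (hb : b < 20)
    (h14 : s.reg 14 = l) {x₀ : Basis} (hx₀ : ∀ q, q < len ∨ 2 * len ≤ q → x₀ q = false)
    {A : ℂ} {θ : ℝ} (h : s.vec = Finsupp.single x₀ A)
    (hθ : (markedCount x₀ l (marked len (input 1) s a b) : ℝ) = 2 ^ l * Real.sin θ ^ 2) :
    ∃ s', Runs (4 * len) len input (Prog.rotate a b) s s' ∧ Frame 21 s s' ∧
      (∃ α' β', TwoValued x₀ l (marked len (input 1) s a b) A α' β' s'.vec ∧
        Amplitudes l θ ((2 * s.reg 17 + 1) * θ) α' β') ∧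
      s'.time ≤ s.time + (s.reg 17 * (8 * l + 24) + (4 * l + 5)) := by
  have hw : l < 2 ^ (4 * len) := lt_of_lt_of_le (by omega) (Nat.lt_two_pow_self (n := 4 * len)).le
  obtain ⟨s1, r1, hf1, hv1, h21, ht1⟩ := hadUp_runs (len := len) (input := input) hs.one hs.zero
    h14 hw
  obtain ⟨s2, h2⟩ : ∃ s2 : State,
    s2 = ⟨Function.update s1.reg 21 (s1.reg 17), s1.mem, s1.vec, s1.time + 1⟩ := ⟨_, rfl⟩
  have hf2 : Frame 21 s1 s2 := by
    rw [h2]; exact ⟨fun r hr => by simp [show r ≠ 21 by omega], rfl⟩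
  have e17 : s1.reg 17 = s.reg 17 := hf1.reg 17 (by norm_num)
  obtain ⟨s', hr, -, hf, ⟨J, hJ, α, β, hv, hA⟩, ht⟩ := Runs.loop (w := 4 * len) (len := len)
    (input := input) (r := 21) (p := Prog.groverIter a b) (m := s.reg 17) (s := s2)
    (fun m t => t.reg 21 = m ∧ Frame 21 s t ∧ (∃ J : ℕ, J + m = s.reg 17 ∧ ∃ α β,
      TwoValued x₀ l (marked len (input 1) s a b) A α β t.vec ∧
        Amplitudes l θ ((2 * J + 1) * θ) α β) ∧
      t.time + m * (8 * l + 24) ≤ s.time + (s.reg 17 * (8 * l + 24) + (4 * l + 4)))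
    (fun _ _ h => by rw [h.1])
    (by
      rintro m t ⟨h21, hf, ⟨J, hJ, α, β, hv, hA⟩, ht⟩
      have hft : Frame 21 s t.tick := ⟨hf.reg, hf.mem⟩
      have hm := marked_frame (len := len) (tbl := input 1) hft (a := a) (b := b) (by omega) (by omega) (by omega)
      obtain ⟨t', rt, hft', ⟨α', β', hv', hA'⟩, h21', ht'⟩ := groverIter_runs (input := input)
        (s := t.tick) (hs.frame (by norm_num) hft) hlen hl
        (by rw [hft.reg 14 (by norm_num), h14]) hx₀ (A := A) (α := α) (β := β) (by rw [hm]; exact hv) hA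
        (by rw [hm]; exact hθ)
      rw [hm] at hv'
      refine ⟨t', rt, ?_, hft.trans hft', ⟨J + 1, by omega, α', β', hv', ?_⟩, ?_⟩
      · rw [h21']; show t.reg 21 - 1 = m; omega
      · convert hA' using 1; push_cast; ring
      · have : t.tick.time = t.time + 1 := rfl
        rw [add_mul] at ht
        omega)
    ⟨by simp [h2, e17], hf1.trans hf2, ⟨0, by simp, _, _, by
      rw [h2]; simp only; rw [hv1, h]
      exact hadUp_single_twoValued (fun q hq => hx₀ q (Or.inl (by omega))) _ _, by
      simpa using amplitudes_init l θ⟩, by simp only [h2]; omega⟩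
  obtain rfl : J = s.reg 17 := by omega
  refine ⟨s'.tick, Runs.seq r1 <| Runs.seq (s' := s2) (Runs.of_exec fun _ => ?_) hr,
    ⟨hf.reg, hf.mem⟩, ⟨α, β, hv, hA⟩, ?_⟩
  · simp [exec, h2, State.tick, State.setReg]
  · simp only [State.tick]; omega

end

end QRam

/-! ## The probability of success of a run of Grover's algorithm -/

namespace QRam

open Classical in
/-- The probability of a branch, weighted by a value, if the branch satisfies `P`. -/
noncomputable def mass (P : State → Prop) (v : State → ℝ) (s : State) : ℝ :=
  if P s then normSq s.vec * v s else 0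

theorem mass_of {P : State → Prop} {v : State → ℝ} {s : State} (h : P s) :
    mass P v s = normSq s.vec * v s := if_pos h

theorem mass_of_not {P : State → Prop} {v : State → ℝ} {s : State} (h : ¬ P s) :
    mass P v s = 0 := if_neg h

/-- Compare two weights, the left one times a constant. -/
theorem mul_mass_le_mass {P P' : State → Prop} {v v' : State → ℝ} {a : ℝ} {s : State}
    (h : P s → P' s ∧ a * v s ≤ v' s) (h' : P' s → 0 ≤ v' s) : a * mass P v s ≤ mass P' v' s := by
  by_cases hP : P s
  · rw [mass_of hP, mass_of (h hP).1, mul_left_comm]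
    exact mul_le_mul_of_nonneg_left (h hP).2 (normSq_nonneg _)
  · rw [mass_of_not hP, mul_zero]
    by_cases hP' : P' s
    · rw [mass_of hP']; exact mul_nonneg (normSq_nonneg _) (h' hP')
    · rw [mass_of_not hP']

theorem mass_le_mass {P P' : State → Prop} {v v' : State → ℝ} {s : State}
    (h : P s → P' s ∧ v s ≤ v' s) (h' : P' s → 0 ≤ v' s) : mass P v s ≤ mass P' v' s := by
  have := mul_mass_le_mass (a := 1) (P := P) (v := v) (s := s)
    (fun hP => ⟨(h hP).1, by rw [one_mul]; exact (h hP).2⟩) h'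
  rwa [one_mul] at this

theorem normSq_single (x : Basis) (a : ℂ) : normSq (Finsupp.single x a) = ‖a‖ ^ 2 := by
  simp [normSq]

section

variable {len : ℕ} {input : ℕ → ℕ → ℕ → ℕ}

theorem Wp.measure_seq {w : ℕ} {d q : ℕ} {p : Prog} {s : State} {φ : State → ℝ} {c₀ c₁ : ℝ}
    (h₀ : Wp w len input p ((s.tick.project (s.reg q) false).setReg d 0) φ c₀)
    (h₁ : Wp w len input p ((s.tick.project (s.reg q) true).setReg d 1) φ c₁) :
    Wp w len input (.seq (.measure d q) p) s φ (c₀ + c₁) := by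
  obtain ⟨L₀, F₀, h₀, hc₀⟩ := h₀
  obtain ⟨L₁, F₁, h₁, hc₁⟩ := h₁
  refine ⟨L₀ ++ L₁, max F₀ F₁, fun fuel hf => ?_, ?_⟩
  · simpa [exec] using (h₀ fuel (le_trans (le_max_left _ _) hf)).append
      (h₁ fuel (le_trans (le_max_right _ _) hf))
  · rw [List.map_append, List.sum_append]; exact add_le_add hc₀ hc₁

/-- The outcomes do not matter: in either branch the measured qubit is known, and if necessary a NOT
returns it to zero. With `m` qubits to go the support lies in a cube of dimension `m`, in the end in
a single point, and no weight is lost. -/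
theorem reset_wp {s : State} {l : ℕ} (h1 : s.reg 1 = 1) (h14 : s.reg 14 = l) {x₀ : Basis}
    (hx₀ : ∀ q < l, x₀ q = false) (hs : ∀ x, s.vec x ≠ 0 → x ∈ cube x₀ l) :
    Wp (4 * len) len input Prog.reset s (mass (fun s' => Frame 21 s s' ∧
      (∃ a, s'.vec = Finsupp.single x₀ a) ∧ s'.time ≤ s.time + (6 * l + 3)) fun _ => 1)
      (normSq s.vec) := by
  let s1 : State := ⟨Function.update (Function.update s.reg 23 l) 22 l, s.mem, s.vec, s.time + 2⟩
  let I : ℕ → State → Prop := fun m t => t.reg 22 = m ∧ t.reg 23 = m ∧ Frame 21 s t ∧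
    (∀ x, t.vec x ≠ 0 → x ∈ cube x₀ m) ∧ t.time + 6 * m ≤ s.time + (6 * l + 2) ∧ m ≤ l
  have hr : Runs (4 * len) len input (.move 23 14) s
      ⟨Function.update s.reg 23 l, s.mem, s.vec, s.time + 1⟩ :=
    Runs.of_exec fun _ => by simp [exec, State.tick, State.setReg, h14]
  have hr' : Runs (4 * len) len input (.move 22 14)
      ⟨Function.update s.reg 23 l, s.mem, s.vec, s.time + 1⟩ s1 :=
    Runs.of_exec fun _ => by simp [exec, State.tick, State.setReg, h14, s1]
  refine hr.seq_wp (hr'.seq_wp ?_)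
  have hI : I l s1 := by
    refine ⟨by simp [s1], by simp [s1], ⟨fun r hr => ?_, rfl⟩, hs, by simp only [s1]; omega, le_rfl⟩
    simp [s1, show r ≠ 22 by omega, show r ≠ 23 by omega]
  have := Wp.loop (w := 4 * len) (len := len) (input := input) (r := 22)
    (p := .seq (.sub 23 23 1) <| .seq (.measure 24 23) <| .seq (.ite 24 (.not 23) Prog.skip)
      (.sub 22 22 1)) (φ := mass (fun s' => Frame 21 s s' ∧
      (∃ a, s'.vec = Finsupp.single x₀ a) ∧ s'.time ≤ s.time + (6 * l + 3)) fun _ => 1)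
    (fun m => mass (I m) fun _ => 1) ?_ l s1
  · rwa [mass_of hI, mul_one] at this
  intro m t
  by_cases ht : I m t
  swap
  · left; rw [mass_of_not ht]
  right
  have hinv := ht
  obtain ⟨h22, h23, hf, hsup, htime, hml⟩ := ht
  rcases m with _ | m
  · left
    refine ⟨h22, ?_⟩
    rw [mass_of hinv, mass_of]
    · rfl
    refine ⟨⟨hf.reg, hf.mem⟩, ⟨t.vec x₀, ?_⟩, ?_⟩
    · classical
      ext x
      rw [Finsupp.single_apply]
      split_ifs with hx
      · rw [hx]; rfl
      · by_contra h
        have := hsup x h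
        rw [cube, Finset.mem_singleton] at this
        exact hx this.symm
    · simp only [State.tick]; omega
  · right
    refine ⟨m, rfl, by omega, ?_⟩
    have h1t : t.reg 1 = 1 := by rw [hf.reg 1 (by norm_num), h1]
    have hr : Runs (4 * len) len input (.sub 23 23 1) t.tick
        ⟨Function.update t.reg 23 m, t.mem, t.vec, t.time + 2⟩ :=
      Runs.of_exec fun _ => by simp [exec, State.tick, State.setReg, h23, h1t]
    refine hr.seq_wp ?_
    have hnorm := normSq_filter_add (fun x : Basis => x m = false) (fun x => x m = true)
      (fun x => by simp) t.vec
    rw [mass_of hinv, mul_one, ← hnorm]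
    have hfr : ∀ (vec : QVec) (b time : ℕ), Frame 21 s ⟨Function.update (Function.update
        (Function.update t.reg 23 m) 24 b) 22 m, t.mem, vec, time⟩ := by
      intro vec b time
      refine ⟨fun r hr => ?_, hf.mem⟩
      have := hf.reg r hr
      simpa [show r ≠ 22 by omega, show r ≠ 23 by omega, show r ≠ 24 by omega] using this
    refine Wp.measure_seq ?_ ?_
    · let t' : State := ⟨Function.update (Function.update (Function.update t.reg 23 m) 24 0) 22 m,
        t.mem, t.vec.filter fun x => x m = false, t.time + 6⟩
      have hr : Runs (4 * len) len input (.seq (.ite 24 (.not 23) Prog.skip) (.sub 22 22 1))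
          (((State.mk (Function.update t.reg 23 m) t.mem t.vec (t.time + 2)).tick.project
            ((State.mk (Function.update t.reg 23 m) t.mem t.vec (t.time + 2)).reg 23)
              false).setReg 24 0) t' :=
        Runs.of_exec fun _ => by
          simp [exec, State.tick, State.setReg, State.project, Prog.skip, h22, h1t, t']
      refine hr.wp ?_
      rw [mass_of, mul_one]
      refine ⟨by simp [t'], by simp [t'], hfr _ _ _, fun x hx => ?_, by simp only [t']; omega,
        by omega⟩
      simp only [t', Finsupp.filter_apply] at hx
      split_ifs at hx with hxm
      · have := mem_cube.1 (hsup x hx)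
        refine mem_cube.2 fun q hq => ?_
        rcases hq.eq_or_lt with rfl | hq
        · rw [hxm, hx₀ _ (by omega)]
        · exact this q hq
      · exact absurd rfl hx
    · let t' : State := ⟨Function.update (Function.update (Function.update t.reg 23 m) 24 1) 22 m,
        t.mem, permute (flipQubit m) (t.vec.filter fun x => x m = true), t.time + 6⟩
      have hr : Runs (4 * len) len input (.seq (.ite 24 (.not 23) Prog.skip) (.sub 22 22 1))
          (((State.mk (Function.update t.reg 23 m) t.mem t.vec (t.time + 2)).tick.project
            ((State.mk (Function.update t.reg 23 m) t.mem t.vec (t.time + 2)).reg 23)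
              true).setReg 24 1) t' :=
        Runs.of_exec fun _ => by
          simp [exec, State.tick, State.setReg, State.gate, State.project, xGate, h22, h1t, t']
      refine hr.wp ?_
      rw [mass_of, mul_one]
      · exact (normSq_permute (flipQubit_involutive m).injective _).ge
      refine ⟨by simp [t'], by simp [t'], hfr _ _ _, fun x hx => ?_, by simp only [t']; omega,
        by omega⟩
      simp only [t', permute_apply (flipQubit_involutive m), Finsupp.filter_apply] at hx
      split_ifs at hx with hxm
      · have := mem_cube.1 (hsup _ hx)
        refine mem_cube.2 fun q hq => ?_
        rcases hq.eq_or_lt with rfl | hq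
        · rw [flipQubit_self] at hxm
          rw [hx₀ _ (by omega)]; simpa using hxm
        · rw [← this q hq, flipQubit_of_ne (by omega)]
      · exact absurd rfl hx

/-- A state between two runs of Grover's algorithm; `v` is its value. -/
def flagValue (v₀ v₁ : ℝ) (s : State) : ℝ := if s.reg 20 = 1 then v₁ else v₀

theorem flagValue_nonneg {v₀ v₁ : ℝ} (h₀ : 0 ≤ v₀) (h₁ : 0 ≤ v₁) (s : State) :
    0 ≤ flagValue v₀ v₁ s := by unfold flagValue; split_ifs <;> assumption

/-- The state `s'` is reached from `s` by runs of Grover's algorithm that take time `T`. -/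
structure GroverPost (x₀ : Basis) (b : ℕ) (s : State) (T : ℕ) (s' : State) : Prop where
  frame : Frame b s s'
  vec : ∃ a, s'.vec = Finsupp.single x₀ a
  flag : s'.reg 20 = 0 ∨ s'.reg 20 = 1
  time : s'.time ≤ s.time + T

/-- Projecting on the flag is multiplication by a factor 0 or 1 that depends on the flag. By
`oracle_conj`, uncomputing the oracle turns this into a projection on the marked or unmarked
indices, and the work qubits are clean again. -/
theorem grover_finish {t : State} (hs : Static len t) {l a b : ℕ} (hl : l ≤ len)
    (h14 : t.reg 14 = l) {x₀ : Basis} (hx₀ : ∀ q, q < len ∨ 2 * len ≤ q → x₀ q = false)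
    (hflag : t.reg 20 = 0 ∨ t.reg 20 = 1) {c : Bool} (h24 : t.reg 24 = if c then 1 else 0)
    {ψ : QVec} (hψ : ∀ x, ψ x ≠ 0 → x ∈ cube x₀ l)
    (hv : t.vec = (permute (ccxMap (t.reg b) (3 * len) (4 * len))
      (permute (lookupMap len (fun u => t.mem (t.reg 10 + u)) (t.reg a) (3 * len))
        (permute (queryMap len (input 1) len 0 (2 * len)) ψ))).filter fun x => x (4 * len) = c)
    {v₀ v₁ : ℝ} (h₀ : 0 ≤ v₀) (h₁ : 0 ≤ v₁) :
    Wp (4 * len) len input (.seq (Prog.oracleInv a b) <|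
      .seq (.ite 24 (.move 20 1) Prog.skip) Prog.reset) t
      (mass (GroverPost x₀ 20 t (6 * l + 8)) (flagValue v₀ v₁))
      (normSq (ψ.filter fun x => marked len (input 1) t a b x = c) *
        if c then v₁ else flagValue v₀ v₁ t) := by
  obtain ⟨s1, r1, hr1, hm1, ht1, hv1⟩ := oracleInv_runs (input := input) hs a b
  refine r1.seq_wp ?_
  have hv : s1.vec = ψ.filter fun x => marked len (input 1) t a b x = c := by
    ext x
    rw [hv1, Finsupp.filter_apply, oracle_conj (input 1) t a b
      (c := fun y => if y = c then 1 else 0) (ψ := ψ)]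
    · split_ifs <;> simp
    · intro x; rw [hv, Finsupp.filter_apply]; split_ifs <;> simp
  have hsup : ∀ x, s1.vec x ≠ 0 → x ∈ cube x₀ l := by
    intro x hx
    rw [hv, Finsupp.filter_apply] at hx
    exact hψ x (by split_ifs at hx; exacts [hx, absurd rfl hx])
  have h20 : (if c then 1 else t.reg 20) = 0 ∨ (if c then 1 else t.reg 20) = 1 := by
    cases c <;> simp [hflag]
  obtain ⟨s2, r2, hf2, hv2, h202, ht2⟩ : ∃ s2, Runs (4 * len) len input
      (.ite 24 (.move 20 1) Prog.skip) s1 s2 ∧ Frame 20 s1 s2 ∧ s2.vec = s1.vec ∧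
      s2.reg 20 = (if c then 1 else t.reg 20) ∧ s2.time = s1.time + 2 := by
    cases c
    · refine ⟨_, Runs.ite_neg (by rw [hr1, h24]; rfl) (Runs.of_exec fun _ => rfl),
        ⟨fun r hr => ?_, rfl⟩, rfl, ?_, rfl⟩
      · simp [State.tick, State.setReg]
      · simp [State.tick, State.setReg, hr1]
    · refine ⟨_, Runs.ite_pos (by rw [hr1, h24]; simp) (Runs.of_exec fun _ => rfl),
        ⟨fun r hr => ?_, rfl⟩, rfl, ?_, rfl⟩
      · simp [State.tick, State.setReg, show r ≠ 20 by omega]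
      · simp [State.tick, State.setReg, hr1, hs.one]
  refine r2.seq_wp ?_
  have hf : Frame 20 t s2 := Frame.trans ⟨fun r _ => by rw [hr1], hm1⟩ hf2
  have hval : 0 ≤ (if c then v₁ else flagValue v₀ v₁ t) := by
    split_ifs; exacts [h₁, flagValue_nonneg h₀ h₁ _]
  refine ((reset_wp (len := len) (input := input) (s := s2) (l := l)
    (by rw [hf.reg 1 (by norm_num), hs.one]) (by rw [hf.reg 14 (by norm_num), h14])
    (fun q hq => hx₀ q (Or.inl (by omega))) (by rw [hv2]; exact hsup)).const_mul hval).mono ?_ ?_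
  · rw [hv2, hv, mul_comm]
  · intro s'
    refine mul_mass_le_mass (fun h => ?_) (fun _ => flagValue_nonneg h₀ h₁ _)
    obtain ⟨hf', hv', ht'⟩ := h
    have e20 := hf'.reg 20 (by norm_num)
    refine ⟨⟨hf.trans (hf'.mono (by norm_num)), hv', by rw [e20, h202]; exact h20, by omega⟩, ?_⟩
    rw [mul_one]
    unfold flagValue
    rw [e20, h202]
    cases c <;> simp

/-- Register `20` is never lowered here, so its value stays `v₁` once it is one. Otherwise the
measurement gives one with probability sin²((2j+1)θ), where j is the number of iterations in
register `17`. -/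
theorem grover_wp {s : State} (hs : Static len s) (hlen : 0 < len) {l a b : ℕ} (hl : l ≤ len)
    (ha : a < 20) (hb : b < 20) (h14 : s.reg 14 = l) {x₀ : Basis}
    (hx₀ : ∀ q, q < len ∨ 2 * len ≤ q → x₀ q = false)
    (hflag : s.reg 20 = 0 ∨ s.reg 20 = 1) {A : ℂ} {θ : ℝ} (h : s.vec = Finsupp.single x₀ A)
    (hθ : (markedCount x₀ l (marked len (input 1) s a b) : ℝ) = 2 ^ l * Real.sin θ ^ 2)
    {v₀ v₁ : ℝ} (h₀ : 0 ≤ v₀) (h₁ : 0 ≤ v₁) :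
    Wp (4 * len) len input (Prog.grover a b) s
      (mass (GroverPost x₀ 20 s ((s.reg 17 + 1) * (10 * l + 24))) (flagValue v₀ v₁))
      (normSq s.vec * flagValue (Real.sin ((2 * s.reg 17 + 1) * θ) ^ 2 * v₁ +
        (1 - Real.sin ((2 * s.reg 17 + 1) * θ) ^ 2) * v₀) v₁ s) := by
  obtain ⟨s1, r1, hf1, ⟨α, β, hv1, hA⟩, ht1⟩ := rotate_runs (input := input) hs hlen hl ha hb h14
    hx₀ h hθ
  refine r1.seq_wp ?_
  have hs1 := hs.frame (by norm_num) hf1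
  obtain ⟨s2, r2, hr2, hm2, ht2, hv2⟩ := oracle_runs (input := input) hs1 a b
  refine r2.seq_wp ?_
  have hf2 : Frame 21 s s2 := hf1.trans ⟨fun r _ => by rw [hr2], hm2⟩
  have key : ∀ c : Bool, Wp (4 * len) len input (.seq (Prog.oracleInv a b) <|
      .seq (.ite 24 (.move 20 1) Prog.skip) Prog.reset)
      ((s2.tick.project (s2.reg 7) c).setReg 24 (if c then 1 else 0))
      (mass (GroverPost x₀ 20 s ((s.reg 17 + 1) * (10 * l + 24))) (flagValue v₀ v₁))
      (normSq s.vec * (if c then Real.sin ((2 * s.reg 17 + 1) * θ) ^ 2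
        else 1 - Real.sin ((2 * s.reg 17 + 1) * θ) ^ 2) * if c then v₁ else flagValue v₀ v₁ s) := by
    intro c
    set t := (s2.tick.project (s2.reg 7) c).setReg 24 (if c then 1 else 0) with ht
    have hft : Frame 21 s t := by
      refine hf2.trans ⟨fun r hr => ?_, rfl⟩
      simp [ht, State.tick, State.setReg, State.project, show r ≠ 24 by omega]
    have hst := hs.frame (by norm_num) hft
    have hm := marked_frame (tbl := input 1) (len := len) hft (a := a) (b := b) (by omega)
      (by omega) (by omega)
    have e1 : ∀ r < 21, s1.reg r = t.reg r := fun r hr => by rw [hf1.reg r hr, hft.reg r hr]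
    have em : s1.mem = t.mem := by rw [hf1.mem, hft.mem]
    refine (grover_finish (input := input) (a := a) (b := b) hst hl
      (by rw [hft.reg 14 (by norm_num), h14]) hx₀
      (by rw [hft.reg 20 (by norm_num)]; exact hflag) (c := c) (by simp [ht, State.setReg])
      hv1.1 (by
        rw [← e1 a (by omega), ← e1 b (by omega), ← e1 10 (by norm_num), ← em, ← hv2,
          ← (hs.frame (by norm_num) hf2).flag]
        simp [ht, State.setReg, State.project, State.tick]) h₀ h₁).mono ?_ ?_
    · rw [hm, hv1.normSq_filter_eq hA hθ, h, normSq_single]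
      have : flagValue v₀ v₁ t = flagValue v₀ v₁ s := by
        unfold flagValue; rw [hft.reg 20 (by norm_num)]
      rw [this]
    · intro s'
      refine mass_le_mass (fun hp => ⟨?_, le_rfl⟩) (fun _ => flagValue_nonneg h₀ h₁ _)
      refine ⟨(hft.mono (by norm_num)).trans hp.frame, hp.vec, hp.flag, ?_⟩
      have e := hp.time
      have e' : t.time = s2.time + 1 := rfl
      have e'' : s.reg 17 * (8 * l + 24) ≤ s.reg 17 * (10 * l + 24) :=
        Nat.mul_le_mul_left _ (by omega)
      rw [add_mul]
      omega
  refine (Wp.measure_seq (by simpa using key false) (by simpa using key true)).mono ?_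
    (fun _ => le_rfl)
  unfold flagValue
  split_ifs <;> exact le_of_eq (by ring)

end

end QRam

/-! ## Searching for a marked index -/

namespace QRam

namespace Prog

/-- Put the length of register `19` in binary into register `14`. -/
def size : Prog := .seq (.const 14 0) <| .loop 19 <| .seq (.half 19 19) (.add 14 14 1)

/-- Grover's algorithm with `0, 1, 3, 7, …` iterations. -/
def searchRound (a b : ℕ) : Prog :=
  .seq (.add 16 14 18) <| .seq (.const 17 0) <| .loop 16 <|
    .seq (grover a b) <| .seq (.add 17 17 17) <| .seq (.add 17 17 1) (.sub 16 16 18)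

/-- Several search rounds. -/
def searchRounds (a b : ℕ) : Prog :=
  .seq (.add 15 2 2) <| .seq (.add 15 15 2) <| .loop 15 <| .seq (searchRound a b) (.sub 15 15 1)

/-- The search for an index below register `19`, as set by the program `d`, that belongs to a
marked neighbour of the vertex in register `12`. -/
def search (d : Prog) (a b : ℕ) : Prog :=
  .seq d <| .seq size <| .seq (.const 20 0) <| .seq (.const 18 2) <| .seq (.store 4 12) <|
    .seq (.lookup 4 8 2) <| .seq (searchRounds a b) (.lookup 4 8 2)

end Prog

section

variable {len : ℕ} {input : ℕ → ℕ → ℕ → ℕ}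

theorem size_runs {w : ℕ} {s : State} (h1 : s.reg 1 = 1) (hw : (s.reg 19).size < 2 ^ w) :
    ∃ s', Runs w len input Prog.size s s' ∧ (∀ r, r ≠ 14 → r ≠ 19 → s'.reg r = s.reg r) ∧
      s'.mem = s.mem ∧ s'.vec = s.vec ∧ s'.reg 14 = (s.reg 19).size ∧
      s'.time ≤ s.time + (3 * (s.reg 19).size + 2) := by
  set D := s.reg 19 with hD
  let s1 : State := ⟨Function.update s.reg 14 0, s.mem, s.vec, s.time + 1⟩
  obtain ⟨s', hr, h19, h14, hf, hm, hv, ht⟩ := Runs.loop (w := w) (len := len) (input := input)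
    (r := 19) (p := .seq (.half 19 19) (.add 14 14 1)) (m := D.size) (s := s1)
    (fun m t => t.reg 19 = D / 2 ^ t.reg 14 ∧ t.reg 14 + m = D.size ∧
      (∀ r, r ≠ 14 → r ≠ 19 → t.reg r = s.reg r) ∧ t.mem = s.mem ∧ t.vec = s.vec ∧
      t.time + 3 * m ≤ s.time + (3 * D.size + 1))
    (by
      rintro m t ⟨h19, h14, -⟩
      rw [h19, Nat.div_eq_zero_iff]
      have := Nat.size_le (m := D) (n := t.reg 14)
      have h2 : (2 : ℕ) ^ t.reg 14 ≠ 0 := by positivity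
      constructor
      · rintro (h | h)
        · exact absurd h h2
        · have := this.2 h; omega
      · intro h; right; exact this.1 (by omega))
    (by
      rintro m t ⟨h19, h14, hf, hm, hv, ht⟩
      refine ⟨⟨Function.update (Function.update t.reg 19 (t.reg 19 / 2)) 14 (t.reg 14 + 1), t.mem,
        t.vec, t.time + 3⟩, Runs.of_exec fun _ => ?_, ?_, ?_, ?_, hm, hv, ?_⟩
      · have hmod : (t.reg 14 + 1) % 2 ^ w = t.reg 14 + 1 := Nat.mod_eq_of_lt (by omega)
        simp [exec, State.tick, State.setReg, hf 1, h1, hmod]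
      · simp [h19, pow_succ, Nat.div_div_eq_div_mul]
      · simp; omega
      · intro r h h'; simp [h, h', hf r h h']
      · simp only; omega)
    ⟨by simp [s1, hD], by simp [s1], fun r h h' => by simp [s1, h], rfl, rfl, by simp only [s1]; omega⟩
  refine ⟨s'.tick, Runs.seq (s' := s1) (Runs.of_exec fun _ => ?_) hr, hf, hm, hv, by
    simpa [State.tick] using h14, ?_⟩
  · simp [exec, State.tick, State.setReg, s1]
  · simp only [State.tick]; omega

/-- `u i` is the value before run number `i` as long as nothing has been found; `hu` says that no
run loses value. Run `i` makes 2^i − 1 iterations. Register `16` falls from l + 2 in steps of two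
with truncated subtraction, which gives K + 1 runs for either parity of `l`. -/
theorem searchRound_wp {s : State} (hs : Static len s) (hlen : 0 < len) {l a b : ℕ} (hl : l ≤ len)
    (ha : a < 14) (hb : b < 14) (h14 : s.reg 14 = l) (h18 : s.reg 18 = 2) {x₀ : Basis}
    (hx₀ : ∀ q, q < len ∨ 2 * len ≤ q → x₀ q = false)
    (hflag : s.reg 20 = 0 ∨ s.reg 20 = 1) {A : ℂ} {θ : ℝ} (h : s.vec = Finsupp.single x₀ A)
    (hθ : (markedCount x₀ l (marked len (input 1) s a b) : ℝ) = 2 ^ l * Real.sin θ ^ 2)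
    {K : ℕ} (hK : K = (l + 1) / 2) {u : ℕ → ℝ} {v₁ : ℝ} (h₀ : ∀ i, 0 ≤ u i) (h₁ : 0 ≤ v₁)
    (hu : ∀ i ≤ K, u i ≤ Real.sin ((2 * (2 ^ i - 1 : ℝ) + 1) * θ) ^ 2 * v₁ +
        (1 - Real.sin ((2 * (2 ^ i - 1 : ℝ) + 1) * θ) ^ 2) * u (i + 1)) :
    Wp (4 * len) len input (Prog.searchRound a b) s
      (mass (fun s' => GroverPost x₀ 16 s (2 ^ (K + 1) * (10 * l + 28)) s' ∧
        s'.reg 18 = s.reg 18) (flagValue (u (K + 1)) v₁))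
      (normSq s.vec * flagValue (u 0) v₁ s) := by
  have hw : 4 * len < 2 ^ (4 * len) := Nat.lt_two_pow_self
  let s1 : State := ⟨Function.update (Function.update s.reg 16 (l + 2)) 17 0, s.mem, s.vec,
    s.time + 2⟩
  -- The runs before number `i` take at most 1 + 2 + … + 2^(i−1) = 2^i − 1 units of `10 * l + 28`;
  -- hence the additional unit on the left of the time bound.
  let I : ℕ → State → Prop := fun m t => ∃ i, i + m = K + 1 ∧ t.reg 16 = l + 2 - 2 * i ∧
    t.reg 17 + 1 = 2 ^ i ∧ Frame 16 s t ∧ t.reg 18 = 2 ∧ (∃ A, t.vec = Finsupp.single x₀ A) ∧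
    (t.reg 20 = 0 ∨ t.reg 20 = 1) ∧
    t.time + (10 * l + 28) ≤ s.time + (2 + 2 ^ i * (10 * l + 28))
  have hr : Runs (4 * len) len input (.add 16 14 18) s
      ⟨Function.update s.reg 16 (l + 2), s.mem, s.vec, s.time + 1⟩ :=
    Runs.of_exec fun _ => by
      have : (l + 2) % 2 ^ (4 * len) = l + 2 := Nat.mod_eq_of_lt (by omega)
      simp [exec, State.tick, State.setReg, h14, h18, this]
  have hr' : Runs (4 * len) len input (.const 17 0)
      ⟨Function.update s.reg 16 (l + 2), s.mem, s.vec, s.time + 1⟩ s1 :=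
    Runs.of_exec fun _ => by simp [exec, State.tick, State.setReg, s1]
  refine hr.seq_wp (hr'.seq_wp ?_)
  have hI : I (K + 1) s1 := by
    refine ⟨0, by omega, by simp [s1], by simp [s1], ⟨fun r hr => ?_, rfl⟩, by simp [s1, h18],
      ⟨A, h⟩, by simpa [s1] using hflag, by simp only [s1]; omega⟩
    simp [s1, show r ≠ 16 by omega, show r ≠ 17 by omega]
  have := Wp.loop (w := 4 * len) (len := len) (input := input) (r := 16)
    (p := .seq (Prog.grover a b) <| .seq (.add 17 17 17) <| .seq (.add 17 17 1) (.sub 16 16 18))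
    (φ := mass (fun s' => GroverPost x₀ 16 s (2 ^ (K + 1) * (10 * l + 28)) s' ∧
        s'.reg 18 = s.reg 18) (flagValue (u (K + 1)) v₁))
    (fun m => mass (I m) (flagValue (u (K + 1 - m)) v₁)) ?_ (K + 1) s1
  · rw [mass_of hI, Nat.sub_self] at this
    have e : flagValue (u 0) v₁ s1 = flagValue (u 0) v₁ s := by simp [flagValue, s1]
    rwa [e] at this
  intro m t
  by_cases ht : I m t
  swap
  · left; rw [mass_of_not ht]
  right
  have hinv := ht
  obtain ⟨i, him, h16, h17, hf, h18t, ⟨A', hv⟩, h20, htime⟩ := ht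
  rcases m with _ | m
  · left
    obtain rfl : i = K + 1 := by omega
    refine ⟨by omega, ?_⟩
    rw [mass_of hinv, mass_of]
    · rfl
    refine ⟨⟨⟨hf.reg, hf.mem⟩, ⟨A', hv⟩, h20, ?_⟩, by rw [h18]; exact h18t⟩
    simp only [State.tick]; omega
  · right
    refine ⟨m, rfl, by omega, ?_⟩
    have hft : Frame 16 s t.tick := ⟨hf.reg, hf.mem⟩
    have hm := marked_frame (tbl := input 1) (len := len) hft (a := a) (b := b) (by omega)
      (by omega) (by omega)
    have hpow : 2 ^ (i + 1) < 2 ^ (4 * len) := Nat.pow_lt_pow_right (by norm_num) (by omega)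
    have e17 : (t.tick.reg 17 : ℝ) = 2 ^ i - 1 := by
      rw [eq_sub_iff_add_eq]; exact_mod_cast h17
    rw [mass_of hinv]
    refine Wp.seq (ψ := mass (GroverPost x₀ 20 t.tick ((t.tick.reg 17 + 1) * (10 * l + 24)))
      (flagValue (u (i + 1)) v₁)) ((grover_wp (input := input) (a := a) (b := b)
      (hs.frame (by norm_num) hft) hlen hl (by omega) (by omega)
      (by rw [hft.reg 14 (by norm_num), h14]) hx₀ h20 (A := A') hv (by rw [hm]; exact hθ)
      (h₀ _) h₁).mono ?_ (fun _ => le_rfl)) fun t' => ?_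
    · refine mul_le_mul_of_nonneg_left ?_ (normSq_nonneg _)
      have e : K + 1 - (m + 1) = i := by omega
      rw [e, e17]
      have e' : ∀ v v', flagValue v v' t.tick = flagValue v v' t := fun _ _ => rfl
      rw [e']
      unfold flagValue
      split_ifs
      · exact le_rfl
      · exact hu i (by omega)
    · by_cases hp : GroverPost x₀ 20 t.tick ((t.tick.reg 17 + 1) * (10 * l + 24)) t'
      swap
      · rw [mass_of_not hp]; exact Wp.of_nonpos le_rfl
      have r17 : t'.reg 17 = t.reg 17 := hp.frame.reg 17 (by norm_num)
      have r16 : t'.reg 16 = t.reg 16 := hp.frame.reg 16 (by norm_num)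
      have r18 : t'.reg 18 = t.reg 18 := hp.frame.reg 18 (by norm_num)
      have r1 : t'.reg 1 = 1 := by
        rw [hp.frame.reg 1 (by norm_num), hft.reg 1 (by norm_num), hs.one]
      have hpow' : 2 ^ (i + 1) = 2 * 2 ^ i := by rw [pow_succ]; ring
      let t2 : State := ⟨Function.update (Function.update t'.reg 17 (t.reg 17 + t.reg 17 + 1)) 16
        (t.reg 16 - 2), t'.mem, t'.vec, t'.time + 3⟩
      have hr : Runs (4 * len) len input (.seq (.add 17 17 17) <| .seq (.add 17 17 1)
          (.sub 16 16 18)) t' t2 := Runs.of_exec fun _ => by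
        have e1 : (t.reg 17 + t.reg 17) % 2 ^ (4 * len) = t.reg 17 + t.reg 17 :=
          Nat.mod_eq_of_lt (by omega)
        have e2 : (t.reg 17 + t.reg 17 + 1) % 2 ^ (4 * len) = t.reg 17 + t.reg 17 + 1 :=
          Nat.mod_eq_of_lt (by omega)
        simp [exec, State.tick, State.setReg, t2, r17, r16, r18, r1, h18t, e1, e2]
      refine hr.wp ?_
      have e20 : t2.reg 20 = t'.reg 20 := by simp [t2]
      rw [mass_of hp, mass_of]
      · have e : K + 1 - m = i + 1 := by omega
        rw [e]
        unfold flagValue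
        rw [e20]
      refine ⟨i + 1, by omega, ?_, ?_, ?_, ?_, hp.vec, by rw [e20]; exact hp.flag, ?_⟩
      · simp [t2]; omega
      · simp [t2]; omega
      · refine (hft.trans (hp.frame.mono (by norm_num))).trans ⟨fun r hr => ?_, rfl⟩
        simp [t2, show r ≠ 16 by omega, show r ≠ 17 by omega]
      · simp [t2, r18, h18t]
      · have e1 := hp.time
        have e2 : t.tick.time = t.time + 1 := rfl
        have e3 : t.tick.reg 17 = t.reg 17 := rfl
        have e4 : t2.time = t'.time + 3 := rfl
        rw [e3, h17] at e1
        rw [hpow', two_mul, add_mul]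
        have e5 : 2 ^ i * (10 * l + 28) = 2 ^ i * (10 * l + 24) + 4 * 2 ^ i := by ring
        have e6 : 1 ≤ 2 ^ i := Nat.one_le_two_pow
        omega

/-- `v m` is the value with `m` rounds to go and no hit so far. The sequence `u` passes from `v (m +
1)` to `v m` within a round, because a single one of its runs is responsible for the gain. -/
theorem searchRounds_wp {s : State} (hs : Static len s) (hlen : 0 < len) {l a b : ℕ} (hl : l ≤ len)
    (ha : a < 14) (hb : b < 14) (h14 : s.reg 14 = l) (h18 : s.reg 18 = 2) {x₀ : Basis}
    (hx₀ : ∀ q, q < len ∨ 2 * len ≤ q → x₀ q = false)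
    (hflag : s.reg 20 = 0 ∨ s.reg 20 = 1) {A : ℂ} {θ : ℝ} (h : s.vec = Finsupp.single x₀ A)
    (hθ : (markedCount x₀ l (marked len (input 1) s a b) : ℝ) = 2 ^ l * Real.sin θ ^ 2)
    {K : ℕ} (hK : K = (l + 1) / 2) {v : ℕ → ℝ} {v₁ : ℝ} (h₁ : 0 ≤ v₁)
    (hv : ∀ m, ∃ u : ℕ → ℝ, (∀ i, 0 ≤ u i) ∧ u 0 = v (m + 1) ∧ u (K + 1) = v m ∧
      ∀ i ≤ K, u i ≤ Real.sin ((2 * (2 ^ i - 1 : ℝ) + 1) * θ) ^ 2 * v₁ +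
        (1 - Real.sin ((2 * (2 ^ i - 1 : ℝ) + 1) * θ) ^ 2) * u (i + 1)) :
    Wp (4 * len) len input (Prog.searchRounds a b) s
      (mass (GroverPost x₀ 15 s (3 * len * (2 ^ (K + 1) * (10 * l + 28) + 2) + 3))
        (flagValue (v 0) v₁))
      (normSq s.vec * flagValue (v (3 * len)) v₁ s) := by
  have hw : 4 * len < 2 ^ (4 * len) := Nat.lt_two_pow_self
  set R := 2 ^ (K + 1) * (10 * l + 28) with hR
  let s1 : State := ⟨Function.update s.reg 15 (3 * len), s.mem, s.vec, s.time + 2⟩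
  let I : ℕ → State → Prop := fun m t => t.reg 15 = m ∧ t.reg 18 = 2 ∧
    (GroverPost x₀ 15 s (3 * len * (R + 2) + 2) t) ∧
    t.time + m * (R + 2) ≤ s.time + (3 * len * (R + 2) + 2)
  have hr : Runs (4 * len) len input (.add 15 2 2) s
      ⟨Function.update s.reg 15 (2 * len), s.mem, s.vec, s.time + 1⟩ :=
    Runs.of_exec fun _ => by
      have : (len + len) % 2 ^ (4 * len) = 2 * len := by
        rw [Nat.mod_eq_of_lt (by omega)]; omega
      simp [exec, State.tick, State.setReg, hs.blockLen, this]
  have hr' : Runs (4 * len) len input (.add 15 15 2)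
      ⟨Function.update s.reg 15 (2 * len), s.mem, s.vec, s.time + 1⟩ s1 :=
    Runs.of_exec fun _ => by
      have : (2 * len + len) % 2 ^ (4 * len) = 3 * len := by
        rw [Nat.mod_eq_of_lt (by omega)]; omega
      simp [exec, State.tick, State.setReg, hs.blockLen, this, s1]
  refine hr.seq_wp (hr'.seq_wp ?_)
  have hI : I (3 * len) s1 := by
    refine ⟨by simp [s1], by simp [s1, h18], ⟨⟨fun r hr => ?_, rfl⟩, ⟨A, h⟩,
      by simpa [s1] using hflag, by simp only [s1]; omega⟩, by simp only [s1]; omega⟩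
    simp [s1, show r ≠ 15 by omega]
  have := Wp.loop (w := 4 * len) (len := len) (input := input) (r := 15)
    (p := .seq (Prog.searchRound a b) (.sub 15 15 1))
    (φ := mass (GroverPost x₀ 15 s (3 * len * (R + 2) + 3)) (flagValue (v 0) v₁))
    (fun m => mass (I m) (flagValue (v m) v₁)) ?_ (3 * len) s1
  · rw [mass_of hI] at this
    have e : flagValue (v (3 * len)) v₁ s1 = flagValue (v (3 * len)) v₁ s := by
      simp [flagValue, s1]
    rwa [e] at this
  intro m t
  by_cases ht : I m t
  swap
  · left; rw [mass_of_not ht]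
  right
  have hinv := ht
  obtain ⟨h15, h18t, hp, htime⟩ := ht
  rcases m with _ | m
  · left
    refine ⟨h15, ?_⟩
    rw [mass_of hinv, mass_of]
    · rfl
    refine ⟨⟨hp.frame.reg, hp.frame.mem⟩, hp.vec, hp.flag, ?_⟩
    simp only [State.tick]; omega
  · right
    refine ⟨m, rfl, by omega, ?_⟩
    have hft : Frame 15 s t.tick := ⟨hp.frame.reg, hp.frame.mem⟩
    have hm := marked_frame (tbl := input 1) (len := len) hft (a := a) (b := b) (by omega)
      (by omega) (by omega)
    obtain ⟨A', hA'⟩ := hp.vec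
    obtain ⟨u, hu0, hu1, hu2, hu3⟩ := hv m
    rw [mass_of hinv]
    have hround := searchRound_wp (input := input) (a := a) (b := b)
      (hs.frame (by norm_num) hft) hlen hl ha hb (by rw [hft.reg 14 (by norm_num), h14]) h18t hx₀
      hp.flag (A := A') hA' (by rw [hm]; exact hθ) hK hu0 h₁ hu3
    rw [hu1, hu2] at hround
    refine Wp.seq hround fun t' => ?_
    by_cases hp' : GroverPost x₀ 16 t.tick R t' ∧ t'.reg 18 = t.tick.reg 18
    swap
    · rw [mass_of_not hp']; exact Wp.of_nonpos le_rfl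
    rw [mass_of hp']
    obtain ⟨hp', h18'⟩ := hp'
    let t2 : State := ⟨Function.update t'.reg 15 m, t'.mem, t'.vec, t'.time + 1⟩
    have r1 : t'.reg 1 = 1 := by
      rw [hp'.frame.reg 1 (by norm_num), hft.reg 1 (by norm_num), hs.one]
    have r15 : t'.reg 15 = m + 1 := by
      rw [hp'.frame.reg 15 (by norm_num)]; exact h15
    have hr : Runs (4 * len) len input (.sub 15 15 1) t' t2 := Runs.of_exec fun _ => by
      simp [exec, State.tick, State.setReg, t2, r15, r1]
    refine hr.wp ?_
    have e20 : t2.reg 20 = t'.reg 20 := by simp [t2]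
    have e1 := hp'.time
    have e2 : t.tick.time = t.time + 1 := rfl
    have e4 : t2.time = t'.time + 1 := rfl
    rw [add_mul] at htime
    rw [mass_of]
    · unfold flagValue
      rw [e20]
    refine ⟨by simp [t2], by simpa [t2] using h18'.trans h18t, ⟨?_, hp'.vec,
      by rw [e20]; exact hp'.flag, by omega⟩, by omega⟩
    refine (hft.trans (hp'.frame.mono (by norm_num))).trans ⟨fun r hr => ?_, rfl⟩
    simp [t2, show r ≠ 15 by omega]

theorem half_pow_le_one (m : ℕ) : (1 / 2 : ℝ) ^ m ≤ 1 := pow_le_one₀ (by norm_num) (by norm_num)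

/-- The search rounds decide with high probability if there is a marked index. -/
theorem searchRounds_decides {s : State} (hs : Static len s) (hlen : 0 < len) {l a b : ℕ}
    (hl : l ≤ len) (ha : a < 14) (hb : b < 14) (h14 : s.reg 14 = l) (h18 : s.reg 18 = 2)
    {x₀ : Basis} (hx₀ : ∀ q, q < len ∨ 2 * len ≤ q → x₀ q = false)
    (hflag : s.reg 20 = 0) {A : ℂ} (h : s.vec = Finsupp.single x₀ A)
    {K : ℕ} (hK : K = (l + 1) / 2) :
    Wp (4 * len) len input (Prog.searchRounds a b) s
      (mass (fun s' => GroverPost x₀ 15 s (3 * len * (2 ^ (K + 1) * (10 * l + 28) + 2) + 3) s' ∧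
        ((s'.reg 20 = 1 ∧ ∃ x ∈ cube x₀ l, marked len (input 1) s a b x = true) ∨
          (s'.reg 20 = 0 ∧ ¬ ∃ x ∈ cube x₀ l, marked len (input 1) s a b x = true)))
        fun _ => 1)
      (normSq s.vec * (1 - (1 / 2) ^ (3 * len))) := by
  by_cases hex : ∃ x ∈ cube x₀ l, marked len (input 1) s a b x = true
  · have hcard : 1 ≤ markedCount x₀ l (marked len (input 1) s a b) := by
      obtain ⟨x, hx, hx'⟩ := hex
      exact Finset.card_pos.2 ⟨x, Finset.mem_filter.2 ⟨hx, hx'⟩⟩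
    have hcard' : markedCount x₀ l (marked len (input 1) s a b) ≤ 2 ^ l := by
      rw [← card_cube x₀ l]; exact Finset.card_filter_le _ _
    obtain ⟨θ, hθ0, hθ1, hθ⟩ := exists_angle (N := 2 ^ l)
      (t := markedCount x₀ l (marked len (input 1) s a b)) (by positivity) (by positivity)
      (by exact_mod_cast hcard')
    obtain ⟨i₀, hi₀, hgood⟩ := exists_good_iteration (l := l) (K := K) hθ0 hθ1
      (by rw [← hθ]; exact_mod_cast hcard) (by omega)
    -- With `m` rounds to go the search still succeeds with probability at least 1 − 2^(−m). Within
    -- a round this number changes only at run `i₀`, whose chance of at least 1/2 halves the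
    -- probability of failure.
    refine (searchRounds_wp (input := input) hs hlen hl ha hb h14 h18 hx₀ (Or.inl hflag) h hθ hK
      (v := fun m => 1 - (1 / 2) ^ m) (v₁ := 1) zero_le_one fun m => ?_).mono ?_ fun s' => ?_
    · have hm0 : 0 ≤ (1 / 2 : ℝ) ^ m := by positivity
      have hm1 := half_pow_le_one m
      refine ⟨fun i => if i ≤ i₀ then 1 - (1 / 2) ^ (m + 1) else 1 - (1 / 2) ^ m, fun i => ?_, ?_,
        ?_, fun i hi => ?_⟩
      · have := half_pow_le_one (m + 1)
        simp only
        split_ifs <;> linarith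
      · simp
      · simp [show ¬ (K + 1 ≤ i₀) by omega]
      · have hp0 := sq_nonneg (Real.sin ((2 * (2 ^ i - 1 : ℝ) + 1) * θ))
        have hp1 := Real.sin_sq_le_one ((2 * (2 ^ i - 1 : ℝ) + 1) * θ)
        simp only
        rcases lt_trichotomy i i₀ with hlt | rfl | hgt
        · rw [if_pos hlt.le, if_pos (by omega)]
          have : 0 ≤ (1 / 2 : ℝ) ^ (m + 1) := by positivity
          nlinarith
        · rw [if_pos le_rfl, if_neg (by omega), pow_succ]
          nlinarith
        · rw [if_neg (by omega), if_neg (by omega)]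
          nlinarith
    · simp [flagValue, hflag]
    · by_cases h20 : s'.reg 20 = 1
      · exact mass_le_mass (fun hp => ⟨⟨hp, Or.inl ⟨h20, hex⟩⟩, by simp [flagValue, h20]⟩)
          fun _ => zero_le_one
      · have : mass (GroverPost x₀ 15 s (3 * len * (2 ^ (K + 1) * (10 * l + 28) + 2) + 3))
            (flagValue ((fun m => 1 - (1 / 2) ^ m) 0) 1) s' = 0 := by
          unfold mass; split_ifs <;> simp [flagValue, h20]
        rw [this]
        unfold mass
        split_ifs
        · rw [mul_one]; exact normSq_nonneg _
        · exact le_rfl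
  · have hcard : markedCount x₀ l (marked len (input 1) s a b) = 0 := by
      rw [markedCount, Finset.card_eq_zero, Finset.filter_eq_empty_iff]
      exact fun x hx hx' => hex ⟨x, hx, hx'⟩
    -- For θ = 0 the measured flag is never one. Giving a raised register `20` the value zero shows
    -- that the whole weight stays with the correct answer.
    refine (searchRounds_wp (input := input) hs hlen hl ha hb h14 h18 hx₀ (Or.inl hflag) h (θ := 0)
      (by simp [hcard]) hK (v := fun _ => 1) (v₁ := 0) le_rfl fun m => ?_).mono ?_ fun s' => ?_
    · exact ⟨fun _ => 1, fun _ => zero_le_one, rfl, rfl, fun i _ => by simp⟩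
    · have : 0 ≤ (1 / 2 : ℝ) ^ (3 * len) := by positivity
      refine mul_le_mul_of_nonneg_left ?_ (normSq_nonneg _)
      simp only [flagValue, hflag]
      norm_num
    · by_cases h20 : s'.reg 20 = 0
      · exact mass_le_mass (fun hp => ⟨⟨hp, Or.inr ⟨h20, hex⟩⟩, by simp [flagValue, h20]⟩)
          fun _ => zero_le_one
      · by_cases hp : GroverPost x₀ 15 s (3 * len * (2 ^ (K + 1) * (10 * l + 28) + 2) + 3) s'
        · have : s'.reg 20 = 1 := hp.flag.resolve_left h20
          rw [mass_of hp, mass_of_not (fun h => h.2.elim (fun h => hex h.2) fun h => h20 h.1)]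
          simp [flagValue, this]
        · rw [mass_of_not hp, mass_of_not (fun h => hp h.1)]

end

end QRam

/-! ## The search for a marked neighbour in both input models -/

namespace QRam

/-- The state `s'` is reached from `s` by a search. -/
structure SearchPost (len : ℕ) (s : State) (T : ℕ) (found : Prop) (s' : State) : Prop where
  reg : ∀ r < 14, s'.reg r = s.reg r
  mem : ∀ c ≠ 2 * 2 ^ len, s'.mem c = s.mem c
  vec : ∃ A, s'.vec = Finsupp.single (fun _ => false) A
  flag : (s'.reg 20 = 1 ∧ found) ∨ (s'.reg 20 = 0 ∧ ¬ found)
  time : s'.time ≤ s.time + T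

/-- A bound for the running time of a search with `l` index qubits. -/
def searchTime (len l : ℕ) : ℕ :=
  3 * len * (2 ^ ((l + 1) / 2 + 1) * (10 * l + 28) + 2) + (3 * l + 11)

section

variable {len : ℕ} {input : ℕ → ℕ → ℕ → ℕ}

theorem permute_single (g : Basis → Basis) (x : Basis) (A : ℂ) :
    permute g (Finsupp.single x A) = Finsupp.single (g x) A := by
  rw [permute_eq_mapDomain, Finsupp.mapDomain_single]

/-- The oracle reads the whole index block, but only its `l` low qubits are put into superposition;
the others remain zero, so exactly the indices below 2^l take part. -/
theorem exists_mem_cube_iff {l : ℕ} (hl : l ≤ len) {x₀ : Basis}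
    (hx₀ : ∀ q, q < len ∨ 2 * len ≤ q → x₀ q = false) {f : Basis → Bool} {Sol : ℕ → Prop}
    (hf : ∀ x ∈ cube x₀ len, f x = true ↔ Sol (blockVal len 0 x)) :
    (∃ x ∈ cube x₀ l, f x = true) ↔ ∃ p < 2 ^ l, Sol p := by
  constructor
  · rintro ⟨x, hx, hfx⟩
    have hx' : x ∈ cube x₀ len := mem_cube.2 fun q hq => mem_cube.1 hx q (hl.trans hq)
    refine ⟨_, ?_, (hf x hx').1 hfx⟩
    have : blockVal len 0 x = blockVal l 0 x := by
      have hlt := blockVal_lt l 0 x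
      refine blockVal_eq_of_bits (hlt.trans_le (Nat.pow_le_pow_right (by norm_num) hl))
        fun j hj => ?_
      rw [(testBit_blockVal l 0 x).2]
      by_cases hjl : j < l
      · simp [hjl]
      · rw [mem_cube.1 hx _ (by omega), hx₀ _ (by omega)]; simp [hjl]
    rw [this]; exact blockVal_lt _ _ _
  · rintro ⟨p, hp, hsol⟩
    have hc : ∀ c, l ≤ c → xorBlock l 0 p x₀ ∈ cube x₀ c := fun c hc =>
      mem_cube.2 fun q hq => xorBlock_outside (by omega) x₀
    refine ⟨_, hc l le_rfl, (hf _ (hc len hl)).2 ?_⟩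
    rwa [blockVal_eq_of_bits (v := p) (hp.trans_le (Nat.pow_le_pow_right (by norm_num) hl))
      fun j hj => ?_]
    by_cases hjl : j < l
    · rw [xorBlock_inside hjl, hx₀ _ (by omega), Bool.false_xor]
    · rw [xorBlock_outside (by omega), hx₀ _ (by omega),
        Nat.testBit_lt_two_pow (hp.trans_le (Nat.pow_le_pow_right (by norm_num) (by omega)))]

/-- The vertex gets into its block of qubits by way of memory: it is stored in a scratch cell, and
this cell is looked up with index zero. The same look-up at the end erases it, and all qubits are
zero again. -/
theorem search_wp {s : State} (hs : Static len s) (hlen : 0 < len) {a b D v : ℕ}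
    (ha : a < 14) (hb : b < 14) {d : Prog}
    (hd : Runs (4 * len) len input d s ⟨Function.update s.reg 19 D, s.mem, s.vec, s.time + 1⟩)
    (hD : D.size ≤ len) (h12 : s.reg 12 = v) (h4 : s.reg 4 = 2 * 2 ^ len)
    (hvec : ∃ A, s.vec = Finsupp.single (fun _ => false) A) {Sol : ℕ → Prop}
    (hm : ∀ t : State, (∀ r < 14, t.reg r = s.reg r) → (∀ c ≠ 2 * 2 ^ len, t.mem c = s.mem c) →
      ∀ x ∈ cube (xorBlock len len v fun _ => false) len,
        marked len (input 1) t a b x = true ↔ Sol (blockVal len 0 x)) :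
    Wp (4 * len) len input (Prog.search d a b) s
      (mass (SearchPost len s (searchTime len D.size) (∃ p < 2 ^ D.size, Sol p)) fun _ => 1)
      (normSq s.vec * (1 - (1 / 2) ^ (3 * len))) := by
  obtain ⟨A, hA⟩ := hvec
  have hw : 4 * len < 2 ^ (4 * len) := Nat.lt_two_pow_self
  have hw2 : 2 < 2 ^ (4 * len) := by omega
  refine hd.seq_wp ?_
  obtain ⟨s1, r1, hr1, hm1, hv1, h14, ht1⟩ := size_runs (w := 4 * len) (len := len) (input := input)
    (s := ⟨Function.update s.reg 19 D, s.mem, s.vec, s.time + 1⟩) (by simpa using hs.one)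
    (by simp; omega)
  refine r1.seq_wp ?_
  simp only [Function.update_self] at h14 ht1
  have hreg1 : ∀ r < 14, s1.reg r = s.reg r := fun r hr => by
    rw [hr1 r (by omega) (by omega)]; simp [show r ≠ 19 by omega]
  let x₀ : Basis := xorBlock len len v fun _ => false
  have hx₀ : ∀ q, q < len ∨ 2 * len ≤ q → x₀ q = false := fun q hq =>
    xorBlock_outside (by omega) _
  let s2 : State := ⟨Function.update (Function.update s1.reg 20 0) 18 2,
    Function.update s.mem (2 * 2 ^ len) v, Finsupp.single x₀ A, s1.time + 4⟩
  have hpow : 0 < 2 ^ len := by positivity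
  have key : ∀ x : Basis, (∀ q < len, x q = false) →
      lookupMap len (fun u => Function.update s.mem (2 * 2 ^ len) v (2 * 2 ^ len + u)) 0 len x =
        xorBlock len len v x := by
    intro x hx
    have hd : BlocksDisjoint len 0 len := Or.inl (by omega)
    have hb : blockVal len 0 x = 0 := blockVal_eq_zero_iff.2 (by simpa using hx)
    rw [lookupMap, if_pos hd, hb]; simp
  have hc1 : Runs (4 * len) len input (.const 20 0) s1
      ⟨Function.update s1.reg 20 0, s1.mem, s1.vec, s1.time + 1⟩ :=
    Runs.of_exec fun _ => by simp [exec, State.tick, State.setReg]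
  have hc2 : Runs (4 * len) len input (.const 18 2)
      ⟨Function.update s1.reg 20 0, s1.mem, s1.vec, s1.time + 1⟩
      ⟨Function.update (Function.update s1.reg 20 0) 18 2, s1.mem, s1.vec, s1.time + 2⟩ :=
    Runs.of_exec fun _ => by simp [exec, State.tick, State.setReg, Nat.mod_eq_of_lt hw2]
  have hc3 : Runs (4 * len) len input (.store 4 12)
      ⟨Function.update (Function.update s1.reg 20 0) 18 2, s1.mem, s1.vec, s1.time + 2⟩
      ⟨Function.update (Function.update s1.reg 20 0) 18 2, Function.update s.mem (2 * 2 ^ len) v,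
        s1.vec, s1.time + 3⟩ :=
    Runs.of_exec fun _ => by
      simp [exec, State.tick, State.setMem, hreg1 4, hreg1 12, h4, h12, hm1]
  have hc4 : Runs (4 * len) len input (.lookup 4 8 2)
      ⟨Function.update (Function.update s1.reg 20 0) 18 2, Function.update s.mem (2 * 2 ^ len) v,
        s1.vec, s1.time + 3⟩ s2 :=
    Runs.of_exec fun _ => by
      simp only [exec, State.tick, State.gate, lookupGate_eq]
      have e : ∀ r < 14, Function.update (Function.update s1.reg 20 0) 18 2 r = s.reg r :=
        fun r hr => by simp [show r ≠ 18 by omega, show r ≠ 20 by omega, hreg1 r hr]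
      rw [e 4 (by norm_num), e 8 (by norm_num), e 2 (by norm_num), h4, hs.zero, hs.blockLen, hv1,
        hA, permute_single, key _ fun _ _ => rfl]
  refine hc1.seq_wp <| hc2.seq_wp <| hc3.seq_wp <| hc4.seq_wp ?_
  have hreg2 : ∀ r < 14, s2.reg r = s.reg r := fun r hr => by
    simp [s2, show r ≠ 18 by omega, show r ≠ 20 by omega, hreg1 r hr]
  have hmem2 : ∀ c ≠ 2 * 2 ^ len, s2.mem c = s.mem c := fun c hc => by simp [s2, hc]
  have hs2 : Static len s2 := by
    refine ⟨?_, ?_, ?_, ?_, ?_, ?_, ?_, fun i hi => ?_⟩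
    · rw [hreg2 _ (by norm_num), hs.one]
    · rw [hreg2 _ (by norm_num), hs.blockLen]
    · rw [hreg2 _ (by norm_num), hs.zbase]
    · rw [hreg2 _ (by norm_num), hs.t1]
    · rw [hreg2 _ (by norm_num), hs.t2]
    · rw [hreg2 _ (by norm_num), hs.flag]
    · rw [hreg2 _ (by norm_num), hs.zero]
    · rw [hmem2 _ (by omega), hs.memz i hi]
  have hex := exists_mem_cube_iff (len := len) hD hx₀ (hm s2 hreg2 hmem2)
  refine Wp.seq ((searchRounds_decides (input := input) hs2 hlen hD ha hb (by simpa [s2] using h14)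
    (by simp [s2]) hx₀ (by simp [s2]) (A := A) rfl rfl).mono ?_ (fun _ => le_rfl)) fun t => ?_
  · refine le_of_eq ?_
    rw [hA, normSq_single, normSq_single]
  by_cases hp : GroverPost x₀ 15 s2 (3 * len * (2 ^ ((D.size + 1) / 2 + 1) * (10 * D.size + 28) + 2)
      + 3) t ∧ ((t.reg 20 = 1 ∧ ∃ x ∈ cube x₀ D.size, marked len (input 1) s2 a b x = true) ∨
        (t.reg 20 = 0 ∧ ¬ ∃ x ∈ cube x₀ D.size, marked len (input 1) s2 a b x = true))
  swap
  · rw [mass_of_not hp]; exact Wp.of_nonpos le_rfl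
  rw [mass_of hp]
  obtain ⟨hp, hflag⟩ := hp
  obtain ⟨A', hA'⟩ := hp.vec
  have hregt : ∀ r < 14, t.reg r = s.reg r := fun r hr => by
    rw [hp.frame.reg r (by omega), hreg2 r hr]
  have hr : Runs (4 * len) len input (.lookup 4 8 2) t
      ⟨t.reg, t.mem, Finsupp.single (fun _ => false) A', t.time + 1⟩ :=
    Runs.of_exec fun _ => by
      simp only [exec, State.tick, State.gate, lookupGate_eq]
      rw [hregt 4 (by norm_num), hregt 8 (by norm_num), hregt 2 (by norm_num), h4, hs.zero,
        hs.blockLen, hA', permute_single, hp.frame.mem, key _ fun q hq => hx₀ q (Or.inl hq),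
        xorBlock_xorBlock]
  refine hr.wp ?_
  rw [mass_of]
  · rw [hA', normSq_single]
    simp only [normSq_single]
    exact le_rfl
  refine ⟨hregt, fun c hc => ?_, ⟨A', rfl⟩, ?_, ?_⟩
  · show t.mem c = _
    rw [hp.frame.mem, hmem2 c hc]
  · show (t.reg 20 = 1 ∧ _) ∨ (t.reg 20 = 0 ∧ _)
    rw [← hex]; exact hflag
  · have e1 := hp.time
    have e2 : s2.time = s1.time + 4 := rfl
    show t.time + 1 ≤ _
    unfold searchTime
    omega

/-- In the cube in which the search takes place the qubits above the index block are known. -/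
theorem cube_facts {v : ℕ} (hv : v < 2 ^ len) {x : Basis}
    (hx : x ∈ cube (xorBlock len len v fun _ => false) len) :
    blockVal len len x = v ∧ ∀ q, 2 * len ≤ q → x q = false := by
  have h := mem_cube.1 hx
  refine ⟨blockVal_eq_of_bits hv fun j hj => ?_, fun q hq => ?_⟩
  · rw [h _ (by omega), xorBlock_inside hj, Bool.false_xor]
  · rw [h _ (by omega), xorBlock_outside (by omega)]

theorem queryMap_cube {v : ℕ} (hv : v < 2 ^ len) {x : Basis}
    (hx : x ∈ cube (xorBlock len len v fun _ => false) len) (tbl : ℕ → ℕ → ℕ) :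
    queryMap len tbl len 0 (2 * len) x = xorBlock len (2 * len) (tbl v (blockVal len 0 x)) x := by
  have h1 : BlocksDisjoint len len (2 * len) := Or.inl (by omega)
  have h2 : BlocksDisjoint len 0 (2 * len) := Or.inl (by omega)
  rw [queryMap, if_pos ⟨h1, h2⟩, (cube_facts hv hx).1]

/-! ### Marked indices in the matrix and in the list model -/

theorem xorBlock_first (hlen : 0 < len) {t v : ℕ} {x : Basis} (h : x t = false) :
    xorBlock len t v x t = v.testBit 0 := by
  have := xorBlock_inside (t := t) (v := v) hlen x
  rwa [add_zero, h, Bool.false_xor] at this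

/-- Query and look-up both take their argument from the index block; the matrix entry and the mark
are the two controls of the Toffoli gate. -/
theorem marked_matrix {t : State} (hlen : 0 < len) (h8 : t.reg 8 = 0) (h5 : t.reg 5 = 2 * len)
    {v : ℕ} (hv : v < 2 ^ len) (tbl : ℕ → ℕ → ℕ) {x : Basis}
    (hx : x ∈ cube (xorBlock len len v fun _ => false) len) :
    marked len tbl t 8 5 x = true ↔ (tbl v (blockVal len 0 x)).testBit 0 = true ∧
      (t.mem (t.reg 10 + blockVal len 0 x)).testBit 0 = true := by
  obtain ⟨-, hz⟩ := cube_facts hv hx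
  have h1 : BlocksDisjoint len 0 (2 * len) := Or.inl (by omega)
  have h2 : BlocksDisjoint len 0 (3 * len) := Or.inl (by omega)
  rw [marked, oracleMap, h8, h5, queryMap_cube hv hx, lookupMap, if_pos h2,
    blockVal_xorBlock_of_disjoint h1]
  set y := xorBlock len (2 * len) (tbl v (blockVal len 0 x)) x with hy
  set z := xorBlock len (3 * len) (t.mem (t.reg 10 + blockVal len 0 x)) y with hzz
  have y3 : y (3 * len) = false := by rw [hy, xorBlock_outside (by omega), hz _ (by omega)]
  have z2 : z (2 * len) = (tbl v (blockVal len 0 x)).testBit 0 := by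
    rw [hzz, xorBlock_outside (by omega), hy, xorBlock_first hlen (hz _ le_rfl)]
  have z3 : z (3 * len) = (t.mem (t.reg 10 + blockVal len 0 x)).testBit 0 :=
    xorBlock_first hlen y3
  have z4 : z (4 * len) = false := by
    rw [hzz, xorBlock_outside (by omega), hy, xorBlock_outside (by omega), hz _ (by omega)]
  rw [← z2, ← z3, ccxMap]
  have hne : 2 * len ≠ 4 * len ∧ 3 * len ≠ 4 * len := by omega
  by_cases h : z (2 * len) = true ∧ z (3 * len) = true
  · rw [if_pos ⟨hne, h⟩, flipQubit_self, z4]; simp [h]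
  · rw [if_neg (fun h' => h h'.2), z4]; simpa using h

/-- The look-up is indexed by the neighbour that the query has written, so this number must fit into
a block (`htbl`). Both controls of the Toffoli gate are the mark, and it acts as a CNOT. -/
theorem marked_list {t : State} (hlen : 0 < len) (h5 : t.reg 5 = 2 * len) (h6 : t.reg 6 = 3 * len)
    {v : ℕ} (hv : v < 2 ^ len) {tbl : ℕ → ℕ → ℕ} (htbl : ∀ i j, tbl i j < 2 ^ len) {x : Basis}
    (hx : x ∈ cube (xorBlock len len v fun _ => false) len) :
    marked len tbl t 5 6 x = true ↔
      (t.mem (t.reg 10 + tbl v (blockVal len 0 x))).testBit 0 = true := by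
  obtain ⟨-, hz⟩ := cube_facts hv hx
  have h2 : BlocksDisjoint len (2 * len) (3 * len) := Or.inl (by omega)
  rw [marked, oracleMap, h5, h6, queryMap_cube hv hx, lookupMap, if_pos h2,
    blockVal_xorBlock_self (fun j _ => hz _ (by omega)) (htbl _ _)]
  set y := xorBlock len (2 * len) (tbl v (blockVal len 0 x)) x with hy
  set z := xorBlock len (3 * len) (t.mem (t.reg 10 + tbl v (blockVal len 0 x))) y with hzz
  have y3 : y (3 * len) = false := by rw [hy, xorBlock_outside (by omega), hz _ (by omega)]
  have z3 : z (3 * len) = (t.mem (t.reg 10 + tbl v (blockVal len 0 x))).testBit 0 :=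
    xorBlock_first hlen y3
  have z4 : z (4 * len) = false := by
    rw [hzz, xorBlock_outside (by omega), hy, xorBlock_outside (by omega), hz _ (by omega)]
  rw [← z3, ccxMap]
  have hne : 3 * len ≠ 4 * len ∧ 3 * len ≠ 4 * len := by omega
  by_cases h : z (3 * len) = true
  · rw [if_pos ⟨hne, h, h⟩, flipQubit_self, z4]; simp [h]
  · rw [if_neg (fun h' => h h'.2.1), z4]; simpa using h

end

/-- The states in which a search may start: the vertex in register `12` is to be examined, and the
cells from the one in register `10` on hold the marks of the vertices. -/
structure Ready (n len : ℕ) (s : State) : Prop where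
  static : Static len s
  order : s.reg 0 = n
  scratch : s.reg 4 = 2 * 2 ^ len
  vertex : s.reg 12 < n
  base : 3 * 2 ^ len ≤ s.reg 10
  vec : ∃ A, s.vec = Finsupp.single (fun _ => false) A
  marks : ∀ u < 2 ^ len, s.mem (s.reg 10 + u) = 0 ∨ (s.mem (s.reg 10 + u) = 1 ∧ u < n)

/-- A program that finds out, with an error probability of at most `8⁻ˡᵉⁿ`, if the vertex in register
`12` has a marked neighbour. -/
def IsSearch (n : ℕ) (input : ℕ → ℕ → ℕ → ℕ) (p : Prog) (nbr : ℕ → ℕ → Prop) (τ : ℕ → ℕ) : Prop :=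
  ∀ s, Ready n n.size s → Wp (4 * n.size) n.size input p s
    (mass (SearchPost n.size s (τ (s.reg 12))
      (∃ u < n, nbr (s.reg 12) u ∧ s.mem (s.reg 10 + u) = 1)) fun _ => 1)
    (normSq s.vec * (1 - (1 / 2) ^ (3 * n.size)))

/-- Adjacency of vertices that are given by their numbers. -/
def NatAdj {n : ℕ} (G : SimpleGraph (Fin n)) (v u : ℕ) : Prop :=
  ∃ (hv : v < n) (hu : u < n), G.Adj ⟨v, hv⟩ ⟨u, hu⟩

theorem Ready.size_pos {n : ℕ} {s : State} (h : Ready n n.size s) : 0 < n.size :=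
  Nat.size_pos.2 (by have := h.vertex; omega)

/-- The index block also represents numbers from n on, but these carry no mark. -/
theorem isSearch_matrix {n : ℕ} (G : SimpleGraph (Fin n)) :
    IsSearch n (matrixInput G) (Prog.search (.move 19 0) 8 5) (NatAdj G)
      fun _ => searchTime n.size n.size := by
  intro s hs
  have hn := Nat.lt_size_self n
  have hv := hs.vertex
  refine (search_wp (Sol := fun p => (matrixInput G 1 (s.reg 12) p).testBit 0 = true ∧
    (s.mem (s.reg 10 + p)).testBit 0 = true) hs.static hs.size_pos (by norm_num) (by norm_num)
    (D := n) (Runs.of_exec fun _ => by simp [exec, State.tick, State.setReg, hs.order]) le_rfl rfl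
    hs.scratch hs.vec ?_).mono le_rfl fun s' => ?_
  · intro t hr hm x hx
    have hb := hs.base
    rw [marked_matrix hs.size_pos (by rw [hr 8 (by norm_num), hs.static.zero])
      (by rw [hr 5 (by norm_num), hs.static.t1]) (hv.trans hn) _ hx, hr 10 (by norm_num), hm]
    have : 0 < 2 ^ n.size := by positivity
    omega
  · have hiff : (∃ p < 2 ^ n.size, (matrixInput G 1 (s.reg 12) p).testBit 0 = true ∧
        (s.mem (s.reg 10 + p)).testBit 0 = true) ↔
        ∃ u < n, NatAdj G (s.reg 12) u ∧ s.mem (s.reg 10 + u) = 1 := by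
      constructor
      · rintro ⟨p, hp, h1, h2⟩
        rcases hs.marks p hp with h | ⟨h, hpn⟩
        · rw [h] at h2; simp at h2
        · refine ⟨p, hpn, ?_, h⟩
          unfold matrixInput at h1
          split_ifs at h1 with h3
          · exact h3
          · simp at h1
      · rintro ⟨u, hu, h1, h2⟩
        refine ⟨u, hu.trans hn, ?_, by rw [h2]; rfl⟩
        have : matrixInput G 1 (s.reg 12) u = 1 := if_pos h1
        rw [this]; rfl
    rw [hiff]

theorem vertexDegree_lt {n : ℕ} (G : SimpleGraph (Fin n)) (v : Fin n) : vertexDegree G v < n := by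
  have h : (G.neighborSet v).ncard < (Set.univ : Set (Fin n)).ncard :=
    Set.ncard_lt_ncard (Set.ssubset_univ_iff.2 fun h => by
      have : v ∈ G.neighborSet v := h ▸ Set.mem_univ v
      exact G.loopless.irrefl v this) (Set.toFinite _)
  unfold vertexDegree
  simpa [Set.ncard_univ] using h

/-- The degree of a vertex that is given by its number. -/
noncomputable def natDegree {n : ℕ} (G : SimpleGraph (Fin n)) (v : ℕ) : ℕ :=
  if hv : v < n then vertexDegree G ⟨v, hv⟩ else 0

theorem listInput_lt {n : ℕ} (G : SimpleGraph (Fin n)) (L : AdjacencyLists G) (i j : ℕ) :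
    listInput G L 1 i j < 2 ^ n.size := by
  have hn := Nat.lt_size_self n
  unfold listInput
  split_ifs
  all_goals first
    | omega
    | exact (Fin.is_lt _).trans hn
    | exact (vertexDegree_lt _ _).trans hn

/-- The search ranges over a power of two above the degree. Past the end of the list it meets the
end mark n, whose cell carries no mark. -/
theorem isSearch_list {n : ℕ} (G : SimpleGraph (Fin n)) (L : AdjacencyLists G) :
    IsSearch n (listInput G L) (Prog.search (.read 0 19 12 12) 5 6) (NatAdj G)
      fun v => searchTime n.size (natDegree G v).size := by
  intro s hs
  have hn := Nat.lt_size_self n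
  have hv := hs.vertex
  have hdeg : natDegree G (s.reg 12) = vertexDegree G ⟨s.reg 12, hv⟩ := dif_pos hv
  have hlt := vertexDegree_lt G ⟨s.reg 12, hv⟩
  have hpow : 2 ^ n.size ≤ 2 ^ (4 * n.size) := Nat.pow_le_pow_right (by norm_num) (by omega)
  refine (search_wp (Sol := fun p =>
    (s.mem (s.reg 10 + listInput G L 1 (s.reg 12) p)).testBit 0 = true) hs.static hs.size_pos
    (by norm_num) (by norm_num) (D := natDegree G (s.reg 12)) (Runs.of_exec fun _ => ?_)
    (Nat.size_le.2 (by omega)) rfl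
    hs.scratch hs.vec ?_).mono le_rfl fun s' => ?_
  · have e : listInput G L 0 (s.reg 12) (s.reg 12) = natDegree G (s.reg 12) := by
      rw [hdeg, listInput, dif_pos hv, if_pos rfl]
    have e2 : natDegree G (s.reg 12) % 2 ^ (4 * n.size) = natDegree G (s.reg 12) :=
      Nat.mod_eq_of_lt (by omega)
    simp [exec, State.tick, State.setReg, e, e2]
  · intro t hr hm x hx
    have hb := hs.base
    rw [marked_list hs.size_pos (by rw [hr 5 (by norm_num), hs.static.t1])
      (by rw [hr 6 (by norm_num), hs.static.t2]) (hv.trans hn) (listInput_lt G L) hx,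
      hr 10 (by norm_num), hm]
    have : 0 < 2 ^ n.size := by positivity
    omega
  · have hiff : (∃ p < 2 ^ (natDegree G (s.reg 12)).size,
        (s.mem (s.reg 10 + listInput G L 1 (s.reg 12) p)).testBit 0 = true) ↔
        ∃ u < n, NatAdj G (s.reg 12) u ∧ s.mem (s.reg 10 + u) = 1 := by
      constructor
      · rintro ⟨p, hp, h2⟩
        rcases hs.marks _ (listInput_lt G L (s.reg 12) p) with h | ⟨h, hpn⟩
        · rw [h] at h2; simp at h2
        · refine ⟨_, hpn, ?_, h⟩
          by_cases hp' : p < vertexDegree G ⟨s.reg 12, hv⟩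
          · have e : listInput G L 1 (s.reg 12) p = ((L ⟨s.reg 12, hv⟩ ⟨p, hp'⟩ : Fin n) : ℕ) := by
              rw [listInput, dif_pos hv, if_neg one_ne_zero, dif_pos hp']
            rw [e]
            exact ⟨hv, Fin.is_lt _, (L ⟨s.reg 12, hv⟩ ⟨p, hp'⟩).2⟩
          · have e : listInput G L 1 (s.reg 12) p = n := by
              rw [listInput, dif_pos hv, if_neg one_ne_zero, dif_neg hp']
            omega
      · rintro ⟨u, hu, ⟨h1, h2, h3⟩, h4⟩
        obtain ⟨⟨p, hp⟩, hpu⟩ := (L ⟨s.reg 12, hv⟩).surjective ⟨⟨u, hu⟩, h3⟩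
        refine ⟨p, ?_, ?_⟩
        · rw [← hdeg] at hp
          exact hp.trans (Nat.lt_size_self _)
        · have e : listInput G L 1 (s.reg 12) p = u := by
            rw [listInput, dif_pos hv, if_neg one_ne_zero, dif_pos hp, hpu]
          rw [e, h4]; rfl
    rw [hiff]

end QRam

/-! ## Colouring by extraction -/

namespace QRam

/-- The colouring `c` (with colour `0` for vertices without colour) is what extraction has made when
the classes below `k` are complete and class `k` is maximal among the vertices below `v`. -/
structure PartialColouring {n : ℕ} (G : SimpleGraph (Fin n)) (c : ℕ → ℕ) (k v : ℕ) : Prop where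
  le : ∀ u < n, c u ≤ k
  proper : ∀ u w, NatAdj G u w → c u ≠ 0 → c u ≠ c w
  nonempty : ∀ i, 1 ≤ i → i < k → ∃ u < n, c u = i
  maximal : ∀ i, 1 ≤ i → i < k → ∀ u < n, (c u = 0 ∨ i < c u) → ∃ w, NatAdj G u w ∧ c w = i
  current : 1 ≤ k → ∀ u < n, u < v → c u = 0 → ∃ w, NatAdj G u w ∧ c w = k

/-! ### The combinatorics of greedy extraction -/

section

variable {n : ℕ} {G : SimpleGraph (Fin n)} {c c' : ℕ → ℕ} {k v : ℕ}

theorem NatAdj.symm {u w : ℕ} (h : NatAdj G u w) : NatAdj G w u := by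
  obtain ⟨hu, hw, h⟩ := h
  exact ⟨hw, hu, h.symm⟩

theorem NatAdj.ne {u w : ℕ} (h : NatAdj G u w) : u ≠ w := by
  obtain ⟨hu, hw, h⟩ := h
  exact fun e => h.ne (Fin.ext e)

theorem PartialColouring.congr (h : PartialColouring G c k v) (hc : ∀ u < n, c' u = c u) :
    PartialColouring G c' k v := by
  have e : ∀ {u w}, NatAdj G u w → c' u = c u ∧ c' w = c w := fun h =>
    ⟨hc _ h.1, hc _ h.2.1⟩
  refine ⟨fun u hu => (hc u hu).trans_le (h.le u hu), fun u w hw h0 => ?_, fun i h1 h2 => ?_,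
    fun i h1 h2 u hu h3 => ?_, fun hk u hu h1 h2 => ?_⟩
  · rw [(e hw).1, (e hw).2]; exact h.proper u w hw ((e hw).1 ▸ h0)
  · obtain ⟨u, hu, h3⟩ := h.nonempty i h1 h2
    exact ⟨u, hu, (hc u hu).trans h3⟩
  · rw [hc u hu] at h3
    obtain ⟨w, h4, h5⟩ := h.maximal i h1 h2 u hu h3
    exact ⟨w, h4, (e h4).2.trans h5⟩
  · rw [hc u hu] at h2
    obtain ⟨w, h4, h5⟩ := h.current hk u hu h1 h2
    exact ⟨w, h4, (e h4).2.trans h5⟩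

/-- Once all vertices have been treated, `current` speaks of every uncoloured vertex, which is what
`maximal` demands of the class now completed. -/
theorem PartialColouring.next_class (h : PartialColouring G c k n)
    (hk : k = 0 ∨ ∃ u < n, c u = k) : PartialColouring G c (k + 1) 0 := by
  refine ⟨fun u hu => (h.le u hu).trans (by omega), h.proper, fun i h1 h2 => ?_,
    fun i h1 h2 u hu h3 => ?_, fun _ u _ hu => by omega⟩
  · rcases (Nat.lt_succ_iff.1 h2).eq_or_lt with rfl | h2
    · exact hk.resolve_left (by omega)
    · exact h.nonempty i h1 h2
  · rcases (Nat.lt_succ_iff.1 h2).eq_or_lt with rfl | h2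
    · have := h.le u hu
      exact h.current h1 u hu hu (by omega)
    · exact h.maximal i h1 h2 u hu h3

theorem PartialColouring.next_vertex (h : PartialColouring G c k v)
    (hv : c v ≠ 0 ∨ ∃ w, NatAdj G v w ∧ c w = k) : PartialColouring G c k (v + 1) := by
  refine ⟨h.le, h.proper, h.nonempty, h.maximal, fun hk u hu h1 h2 => ?_⟩
  rcases (Nat.lt_succ_iff.1 h1).eq_or_lt with rfl | h1
  · exact hv.resolve_left (by omega)
  · exact h.current hk u hu h1 h2

/-- The vertex had no colour, so no existing witness in any class is changed. -/
theorem PartialColouring.colour_vertex (h : PartialColouring G c k v) (hk : 1 ≤ k) (h0 : c v = 0)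
    (hv : ¬ ∃ w, NatAdj G v w ∧ c w = k) :
    PartialColouring G (Function.update c v k) k (v + 1) := by
  have e : ∀ u, c u ≠ 0 → Function.update c v k u = c u := fun u hu =>
    Function.update_of_ne (by rintro rfl; exact hu h0) _ _
  refine ⟨fun u hu => ?_, fun u w hw hu => ?_, fun i h1 h2 => ?_, fun i h1 h2 u hu h3 => ?_,
    fun _ u hu h1 h2 => ?_⟩
  · by_cases huv : u = v
    · rw [huv, Function.update_self]
    · rw [Function.update_of_ne huv]; exact h.le u hu
  · by_cases huv : u = v
    · subst huv
      rw [Function.update_self, Function.update_of_ne hw.ne.symm]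
      exact fun h => hv ⟨w, hw, h.symm⟩
    · rw [Function.update_of_ne huv] at hu ⊢
      by_cases hwv : w = v
      · subst hwv
        rw [Function.update_self]
        exact fun h => hv ⟨u, hw.symm, h⟩
      · rw [Function.update_of_ne hwv]; exact h.proper u w hw hu
  · obtain ⟨u, hu, hi⟩ := h.nonempty i h1 h2
    exact ⟨u, hu, by rw [e u (by omega), hi]⟩
  · have h3' : c u = 0 ∨ i < c u := by
      by_cases huv : u = v
      · left; rw [huv, h0]
      · rwa [Function.update_of_ne huv] at h3
    obtain ⟨w, hw, hi⟩ := h.maximal i h1 h2 u hu h3'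
    exact ⟨w, hw, by rw [e w (by omega), hi]⟩
  · have huv : u ≠ v := by rintro rfl; rw [Function.update_self] at h2; omega
    rw [Function.update_of_ne huv] at h2
    obtain ⟨w, hw, hi⟩ := h.current hk u hu (by omega) h2
    exact ⟨w, hw, by rw [e w (by omega), hi]⟩

theorem PartialColouring.isColouringByExtraction (h : PartialColouring G c k n)
    (hk : k = 0 ∨ ∃ u < n, c u = k) (h0 : ∀ u < n, c u ≠ 0) :
    IsColouringByExtraction G k fun v : Fin n => c v := by
  have hproper : ∀ u v : Fin n, G.Adj u v → c u ≠ c v := fun u v huv =>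
    h.proper u v ⟨u.2, v.2, huv⟩ (h0 u u.2)
  refine ⟨hproper, ?_, fun i hi => ⟨⟨fun v hv => ?_, fun u hu w hw _ huw => ?_⟩, ?_⟩⟩
  · ext i
    constructor
    · rintro ⟨u, rfl⟩
      exact ⟨Nat.one_le_iff_ne_zero.2 (h0 u u.2), h.le u u.2⟩
    · rintro ⟨h1, h2⟩
      have : ∃ u < n, c u = i := by
        rcases h2.eq_or_lt with rfl | h2
        · exact hk.resolve_left (by omega)
        · exact h.nonempty i h1 h2
      obtain ⟨u, hu, hi⟩ := this
      exact ⟨⟨u, hu⟩, hi⟩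
  · exact (show c v = i from hv).ge
  · exact hproper u w huw ((show c u = i from hu).trans (show c w = i from hw).symm)
  -- A strictly larger set would contain a vertex of a later colour, and this has a neighbour in
  -- class `i`.
  · rintro S ⟨hS1, hS2⟩ hS3 u hu
    have hiu : i ≤ c u := hS1 hu
    by_contra hne
    have hlt : i < c u := lt_of_le_of_ne hiu fun h => hne h.symm
    obtain ⟨w, ⟨h1, h2, h3⟩, h4⟩ := h.maximal i hi.1 (hlt.trans_le (h.le u u.2)) u u.2 (Or.inr hlt)
    exact hS2 hu (hS3 (show c (⟨w, h2⟩ : Fin n) = i from h4)) h3.ne h3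

end

namespace Prog

/-- Treat the vertex in register `12` in the round of the colour in register `9`. -/
def colourVertex (search : Prog) : Prog :=
  .seq (.load 24 12) <| .seq (.ite 24 skip <| .seq search <| .ite 20 skip <|
    .seq (.store 12 9) <| .seq (.add 24 10 12) <| .seq (.store 24 1) (.sub 11 11 1)) <|
    .seq (.add 12 12 1) (.sub 13 13 1)

/-- Extract the next colour class. -/
def colourClass (search : Prog) : Prog :=
  .seq (.add 9 9 1) <| .seq (.add 10 10 3) <| .seq (.const 12 0) <| .seq (.move 13 0) <|
    .loop 13 (colourVertex search)

/-- Set the constants. -/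
def setup : Prog :=
  .seq (.const 1 1) <| .seq (.move 19 0) <| .seq size <| .seq (.move 2 14) <| .seq (.const 3 1) <|
  .seq (.loop 14 <| .seq (.add 3 3 3) (.sub 14 14 1)) <| .seq (.add 4 3 3) <| .seq (.store 3 1) <|
  .seq (.move 10 4) <| .seq (.add 5 2 2) <| .seq (.add 6 5 2) <| .seq (.add 7 6 2) (.move 11 0)

/-- Colour a graph by extraction. -/
def colour (search : Prog) : Prog :=
  .seq setup <| .seq (.loop 11 (colourClass search)) (.move 0 9)

end Prog

/-- The number of vertices without a colour. -/
def uncoloured (n : ℕ) (c : ℕ → ℕ) : ℕ := ((Finset.range n).filter fun u => c u = 0).card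

theorem uncoloured_congr {n : ℕ} {c c' : ℕ → ℕ} (h : ∀ u < n, c' u = c u) :
    uncoloured n c' = uncoloured n c := by
  unfold uncoloured
  congr 1
  exact Finset.filter_congr fun u hu => by rw [h u (Finset.mem_range.1 hu)]

theorem uncoloured_update {n : ℕ} {c : ℕ → ℕ} {v k : ℕ} (hv : v < n) (h0 : c v = 0) (hk : k ≠ 0) :
    uncoloured n (Function.update c v k) = uncoloured n c - 1 := by
  unfold uncoloured
  rw [← Finset.card_erase_of_mem (Finset.mem_filter.2 ⟨Finset.mem_range.2 hv, h0⟩)]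
  congr 1
  ext u
  simp only [Finset.mem_filter, Finset.mem_erase, Finset.mem_range]
  by_cases h : u = v
  · subst h; simp [hk]
  · simp [h]

theorem uncoloured_pos {n : ℕ} {c : ℕ → ℕ} {v : ℕ} (hv : v < n) (h0 : c v = 0) :
    0 < uncoloured n c :=
  Finset.card_pos.2 ⟨v, Finset.mem_filter.2 ⟨Finset.mem_range.2 hv, h0⟩⟩

/-- What all parts of the colouring program rely on. -/
structure Common (n k : ℕ) (s : State) : Prop where
  static : Static n.size s
  order : s.reg 0 = n
  scratch : s.reg 4 = 2 * 2 ^ n.size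
  colour : s.reg 9 = k
  base : s.reg 10 = (k + 2) * 2 ^ n.size
  vec : ∃ A, s.vec = Finsupp.single (fun _ => false) A
  count : s.reg 11 = uncoloured n s.mem

/-- The invariant of the loop over the vertices, in the round of colour `k`, before vertex `v`; at
the beginning of the round there were `U` vertices left. -/
structure VertexInv {n : ℕ} (G : SimpleGraph (Fin n)) (τ : ℕ → ℕ) (k U T v : ℕ) (s : State) :
    Prop where
  common : Common n k s
  pos : 1 ≤ k
  le : k + U ≤ n + 1
  vertex : s.reg 12 = v
  rest : v + s.reg 13 = n
  colouring : PartialColouring G s.mem k v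
  marks : ∀ u < n, s.mem ((k + 2) * 2 ^ n.size + u) = if s.mem u = k then 1 else 0
  clear : ∀ a, (k + 2) * 2 ^ n.size + n ≤ a → s.mem a = 0
  progress : (s.reg 11 < U ∧ ∃ u < n, s.mem u = k) ∨ (s.reg 11 = U ∧ ∀ u < n, s.mem u ≠ k)
  time : s.time ≤ T + ∑ u ∈ Finset.range v, (τ u + 10)

/-- A bound for the time of a round. -/
def roundTime (n : ℕ) (τ : ℕ → ℕ) : ℕ := 6 + ∑ u ∈ Finset.range n, (τ u + 10)

/-- The invariant of the loop over the colours. -/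
structure ClassInv {n : ℕ} (G : SimpleGraph (Fin n)) (τ : ℕ → ℕ) (T k : ℕ) (s : State) :
    Prop where
  common : Common n k s
  le : k + s.reg 11 ≤ n
  colouring : PartialColouring G s.mem k n
  nonempty : k = 0 ∨ ∃ u < n, s.mem u = k
  clear : ∀ a, (k + 3) * 2 ^ n.size ≤ a → s.mem a = 0
  time : s.time ≤ T + k * roundTime n τ

/-! ### Correctness of the colouring program -/

section

variable {n : ℕ} {G : SimpleGraph (Fin n)} {τ : ℕ → ℕ} {input : ℕ → ℕ → ℕ → ℕ} {p : Prog}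

/-- With X = 2^size the addresses are below (X+1)X + X ≤ X⁴. This is why words of four times the
length of n suffice. -/
theorem address_lt (hn : 0 < n) {k : ℕ} (hk : k ≤ n) : (k + 2) * 2 ^ n.size + n < 2 ^ (4 * n.size) := by
  have h := Nat.lt_size_self n
  have h2 : 2 ≤ 2 ^ n.size := by
    calc 2 = 2 ^ 1 := rfl
      _ ≤ 2 ^ n.size := Nat.pow_le_pow_right (by norm_num) (Nat.size_pos.2 hn)
  rw [mul_comm 4, pow_mul]
  generalize 2 ^ n.size = X at h h2 ⊢
  calc (k + 2) * X + n < (X + 1) * X + X := by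
        have : (k + 2) * X ≤ (X + 1) * X := Nat.mul_le_mul_right _ (by omega)
        omega
    _ ≤ 2 * 2 * (X * X) := by nlinarith
    _ ≤ X * X * (X * X) := Nat.mul_le_mul_right _ (Nat.mul_le_mul h2 h2)
    _ = X ^ 4 := by ring

/-- The only memory cell that a search may change lies above the colours and above the array that
`Static` requires. -/
theorem Common.of_search {k T : ℕ} {s s' : State} {f : Prop} (h : Common n k s)
    (hp : SearchPost n.size s T f s') : Common n k s' := by
  have hn := Nat.lt_size_self n
  have hs := h.static
  refine ⟨⟨?_, ?_, ?_, ?_, ?_, ?_, ?_, fun i hi => ?_⟩, ?_, ?_, ?_, ?_, hp.vec, ?_⟩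
  · rw [hp.reg _ (by norm_num), hs.one]
  · rw [hp.reg _ (by norm_num), hs.blockLen]
  · rw [hp.reg _ (by norm_num), hs.zbase]
  · rw [hp.reg _ (by norm_num), hs.t1]
  · rw [hp.reg _ (by norm_num), hs.t2]
  · rw [hp.reg _ (by norm_num), hs.flag]
  · rw [hp.reg _ (by norm_num), hs.zero]
  · rw [hp.mem _ (by omega), hs.memz i hi]
  · rw [hp.reg _ (by norm_num), h.order]
  · rw [hp.reg _ (by norm_num), h.scratch]
  · rw [hp.reg _ (by norm_num), h.colour]
  · rw [hp.reg _ (by norm_num), h.base]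
  · rw [hp.reg _ (by norm_num), h.count]
    exact (uncoloured_congr fun u hu => hp.mem u (by omega)).symm

theorem Common.of_eq {k : ℕ} {s s' : State} (h : Common n k s) (hr : ∀ r < 12, s'.reg r = s.reg r)
    (hm : s'.mem = s.mem) (hv : s'.vec = s.vec) : Common n k s' := by
  refine ⟨h.static.frame (b := 12) (by norm_num) ⟨hr, hm⟩, ?_, ?_, ?_, ?_, by rw [hv]; exact h.vec, ?_⟩
  · rw [hr _ (by norm_num), h.order]
  · rw [hr _ (by norm_num), h.scratch]
  · rw [hr _ (by norm_num), h.colour]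
  · rw [hr _ (by norm_num), h.base]
  · rw [hr _ (by norm_num), h.count, hm]

theorem VertexInv.ready {k U T v : ℕ} {s : State} (h : VertexInv G τ k U T v s) (hv : v < n) :
    Ready n n.size s := by
  refine ⟨h.common.static, h.common.order, h.common.scratch, by rw [h.vertex]; exact hv, ?_,
    h.common.vec, fun u _ => ?_⟩
  · rw [h.common.base]
    exact Nat.mul_le_mul_right _ (by have := h.pos; omega)
  · rw [h.common.base]
    by_cases hun : u < n
    · rw [h.marks u hun]
      split_ifs
      · right; exact ⟨rfl, hun⟩
      · left; rfl
    · left; exact h.clear _ (by omega)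

/-- The end of the treatment of a vertex. -/
theorem VertexInv.advance {k U T v t : ℕ} {s : State} (hn : 0 < n) (h : VertexInv G τ k U T v s)
    (hv : v < n) {s₁ : State} (hr : ∀ r < 14, s₁.reg r = s.reg r) (hm : ∀ c ≠ 2 * 2 ^ n.size, s₁.mem c = s.mem c)
    (hc : Common n k s₁) (ht : s₁.time ≤ s.time + t) (htτ : t + 2 ≤ τ v + 10)
    (hcol : s.mem v ≠ 0 ∨ ∃ w, NatAdj G v w ∧ s.mem w = k) :
    ∃ s₂, Runs (4 * n.size) n.size input (.seq (.add 12 12 1) (.sub 13 13 1)) s₁ s₂ ∧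
      s₂.vec = s₁.vec ∧ VertexInv G τ k U T (v + 1) s₂ := by
  have hw := address_lt hn (le_refl n)
  have hN : 0 < 2 ^ n.size := by positivity
  have hsz := Nat.lt_size_self n
  have hk := h.pos
  have hbase : 3 * 2 ^ n.size ≤ (k + 2) * 2 ^ n.size := Nat.mul_le_mul_right _ (by omega)
  have hmod : (v + 1) % 2 ^ (4 * n.size) = v + 1 := Nat.mod_eq_of_lt (by omega)
  have h12 := h.vertex
  have h13 := h.rest
  refine ⟨⟨Function.update (Function.update s₁.reg 12 (v + 1)) 13 (s.reg 13 - 1), s₁.mem, s₁.vec,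
    s₁.time + 2⟩, Runs.of_exec fun _ => ?_, rfl, ?_⟩
  · simp [exec, State.tick, State.setReg, hr 12, hr 13, h12, hc.static.one, hmod]
  · have hmn : ∀ u < n, s₁.mem u = s.mem u := fun u hu => hm u (by omega)
    refine ⟨hc.of_eq (fun r hr => ?_) rfl rfl, hk, h.le, by simp, by simp; omega,
      (h.colouring.next_vertex hcol).congr hmn, fun u hu => ?_, fun a ha => ?_, ?_, ?_⟩
    · simp [show r ≠ 12 by omega, show r ≠ 13 by omega]
    · show s₁.mem _ = if s₁.mem u = k then 1 else 0
      rw [hmn u hu, hm _ (by omega), h.marks u hu]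
    · show s₁.mem a = 0
      rw [hm _ (by omega), h.clear a ha]
    · have e : s₁.reg 11 = s.reg 11 := hr 11 (by norm_num)
      rcases h.progress with ⟨h, u, hu, h'⟩ | ⟨h, h'⟩
      · left; exact ⟨by simp [e, h], u, hu, (hmn u hu).trans h'⟩
      · right; exact ⟨by simp [e, h], fun u hu => by show s₁.mem u ≠ k; rw [hmn u hu]; exact h' u hu⟩
    · rw [Finset.sum_range_succ]
      have := h.time
      show s₁.time + 2 ≤ _
      omega

/-- The vertex gets the current colour. -/
theorem VertexInv.colour {k U T v t : ℕ} {s : State} (hn : 0 < n) (h : VertexInv G τ k U T v s)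
    (hv : v < n) {s₁ : State} (hr : ∀ r < 14, s₁.reg r = s.reg r) (hm : ∀ c ≠ 2 * 2 ^ n.size, s₁.mem c = s.mem c)
    (hc : Common n k s₁) (ht : s₁.time ≤ s.time + t) (htτ : t + 6 ≤ τ v + 10)
    (h0 : s.mem v = 0) (hcol : ¬ ∃ w, NatAdj G v w ∧ s.mem w = k) :
    ∃ s₂, Runs (4 * n.size) n.size input (.seq (.store 12 9) <| .seq (.add 24 10 12) <|
      .seq (.store 24 1) (.sub 11 11 1)) s₁ s₂ ∧ s₂.vec = s₁.vec ∧
      ∃ s₃, Runs (4 * n.size) n.size input (.seq (.add 12 12 1) (.sub 13 13 1)) s₂ s₃ ∧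
      s₃.vec = s₁.vec ∧ VertexInv G τ k U T (v + 1) s₃ := by
  have hw := address_lt hn (le_refl n)
  have hN : 0 < 2 ^ n.size := by positivity
  have hsz := Nat.lt_size_self n
  have hk := h.pos
  have hbase : 3 * 2 ^ n.size ≤ (k + 2) * 2 ^ n.size := Nat.mul_le_mul_right _ (by omega)
  have hmod : (v + 1) % 2 ^ (4 * n.size) = v + 1 := Nat.mod_eq_of_lt (by omega)
  have h12 : s₁.reg 12 = v := (hr 12 (by norm_num)).trans h.vertex
  have h11 : s₁.reg 11 = s.reg 11 := hr 11 (by norm_num)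
  have h13 := h.rest
  have hmn : ∀ u < n, s₁.mem u = s.mem u := fun u hu => hm u (by omega)
  have hU := uncoloured_pos hv h0
  rw [← h.common.count] at hU
  -- The uncoloured vertex `v` makes `U` positive, so `k` is at most n and the address of the new
  -- mark fits into a word.
  have hkn : k ≤ n := by
    have := h.le
    rcases h.progress with ⟨h, -⟩ | ⟨h, -⟩ <;> omega
  have hw' := address_lt hn hkn
  have hmod2 : ((k + 2) * 2 ^ n.size + v) % 2 ^ (4 * n.size) = (k + 2) * 2 ^ n.size + v :=
    Nat.mod_eq_of_lt (by omega)
  let mem' := Function.update (Function.update s₁.mem v k) ((k + 2) * 2 ^ n.size + v) 1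
  let s₂ : State := ⟨Function.update (Function.update s₁.reg 24 ((k + 2) * 2 ^ n.size + v)) 11
    (s.reg 11 - 1), mem', s₁.vec, s₁.time + 4⟩
  let s₃ : State := ⟨Function.update (Function.update s₂.reg 12 (v + 1)) 13 (s.reg 13 - 1), mem',
    s₁.vec, s₁.time + 6⟩
  have hreg : ∀ r < 14, r ≠ 11 → r ≠ 12 → r ≠ 13 → s₃.reg r = s₁.reg r := fun r h h1 h2 h3 => by
    simp [s₃, s₂, h1, h2, h3, show r ≠ 24 by omega]
  have hmem : ∀ u < n, mem' u = Function.update s.mem v k u := fun u hu => by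
    have : u ≠ (k + 2) * 2 ^ n.size + v := by omega
    simp only [mem', Function.update_of_ne this]
    by_cases huv : u = v
    · simp [huv]
    · simp [huv, hmn u hu]
  have hs := hc.static
  refine ⟨s₂, Runs.of_exec fun _ => ?_, rfl, s₃, Runs.of_exec fun _ => ?_, rfl, ?_⟩
  · simp [exec, State.tick, State.setReg, State.setMem, h12, h11, hs.one, hc.base, hc.colour, hmod2,
      s₂, mem']
  · simp [exec, State.tick, State.setReg, h12, hr 13, hs.one, hmod, s₂, s₃]
  · refine ⟨⟨⟨?_, ?_, ?_, ?_, ?_, ?_, ?_, fun i hi => ?_⟩, ?_, ?_, ?_, ?_, hc.vec, ?_⟩, hk, h.le,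
      by simp [s₃], by simp [s₃]; omega, (h.colouring.colour_vertex hk h0 hcol).congr hmem,
      fun u hu => ?_, fun a ha => ?_, ?_, ?_⟩
    · rw [hreg _ (by norm_num) (by norm_num) (by norm_num) (by norm_num), hs.one]
    · rw [hreg _ (by norm_num) (by norm_num) (by norm_num) (by norm_num), hs.blockLen]
    · rw [hreg _ (by norm_num) (by norm_num) (by norm_num) (by norm_num), hs.zbase]
    · rw [hreg _ (by norm_num) (by norm_num) (by norm_num) (by norm_num), hs.t1]
    · rw [hreg _ (by norm_num) (by norm_num) (by norm_num) (by norm_num), hs.t2]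
    · rw [hreg _ (by norm_num) (by norm_num) (by norm_num) (by norm_num), hs.flag]
    · rw [hreg _ (by norm_num) (by norm_num) (by norm_num) (by norm_num), hs.zero]
    · rw [← hs.memz i hi]
      show mem' _ = _
      simp only [mem']
      rw [Function.update_of_ne (by omega), Function.update_of_ne (by omega)]
    · rw [hreg _ (by norm_num) (by norm_num) (by norm_num) (by norm_num), hc.order]
    · rw [hreg _ (by norm_num) (by norm_num) (by norm_num) (by norm_num), hc.scratch]
    · rw [hreg _ (by norm_num) (by norm_num) (by norm_num) (by norm_num), hc.colour]
    · rw [hreg _ (by norm_num) (by norm_num) (by norm_num) (by norm_num), hc.base]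
    · show s₃.reg 11 = uncoloured n mem'
      rw [uncoloured_congr hmem, uncoloured_update hv h0 (by omega), ← h.common.count]
      simp [s₃, s₂]
    · show mem' _ = if mem' u = k then 1 else 0
      rw [hmem u hu]
      by_cases huv : u = v
      · simp [huv, mem']
      · rw [Function.update_of_ne huv, ← h.marks u hu]
        simp only [mem']
        rw [Function.update_of_ne (by omega), Function.update_of_ne (by omega), hm _ (by omega)]
    · show mem' a = 0
      simp only [mem']
      rw [Function.update_of_ne (by omega), Function.update_of_ne (by omega), hm _ (by omega),
        h.clear a ha]
    · left
      have : s₃.reg 11 = s.reg 11 - 1 := by simp [s₃, s₂]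
      refine ⟨?_, v, hv, by show mem' v = k; rw [hmem v hv, Function.update_self]⟩
      rw [this]
      rcases h.progress with ⟨h, -⟩ | ⟨h, -⟩ <;> omega
    · rw [Finset.sum_range_succ]
      have := h.time
      show s₁.time + 6 ≤ _
      omega

/-- The probability that a search does not fail. -/
noncomputable def reliability (n : ℕ) : ℝ := 1 - (1 / 2) ^ (3 * n.size)

theorem reliability_nonneg (n : ℕ) : 0 ≤ reliability n := sub_nonneg.2 (half_pow_le_one _)

theorem reliability_le_one (n : ℕ) : reliability n ≤ 1 := sub_le_self _ (by positivity)

/-- The marks are the indicator function of the current class, so a search that does not err decides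
correctly if the vertex may join. A vertex that has a colour is skipped and costs no reliability. -/
theorem colourVertex_wp (hp : IsSearch n input p (NatAdj G) τ) {k U T v : ℕ} {s : State}
    (hn : 0 < n) (h : VertexInv G τ k U T v s) (hv : v < n) {a : ℝ} (ha : 0 ≤ a) :
    Wp (4 * n.size) n.size input (Prog.colourVertex p) s.tick
      (mass (VertexInv G τ k U T (v + 1)) fun _ => a) (normSq s.vec * (reliability n * a)) := by
  have hsz := Nat.lt_size_self n
  have hN : 0 < 2 ^ n.size := by positivity
  let s1 : State := ⟨Function.update s.reg 24 (s.mem v), s.mem, s.vec, s.time + 2⟩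
  have hr : Runs (4 * n.size) n.size input (.load 24 12) s.tick s1 := Runs.of_exec fun _ => by
    simp [exec, State.tick, State.setReg, h.vertex, s1]
  refine hr.seq_wp ?_
  have hreg1 : ∀ r < 14, s1.reg r = s.reg r := fun r hr => by simp [s1, show r ≠ 24 by omega]
  by_cases h0 : s.mem v = 0
  swap
  · let s2 : State := ⟨s1.reg, s.mem, s.vec, s.time + 4⟩
    have hr2 : Runs (4 * n.size) n.size input (.ite 24 Prog.skip <| .seq p <| .ite 20 Prog.skip <|
      .seq (.store 12 9) <| .seq (.add 24 10 12) <| .seq (.store 24 1) (.sub 11 11 1)) s1 s2 := by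
      refine Runs.ite_pos (by simpa [s1] using h0) (Runs.of_exec fun _ => ?_)
      simp [exec, Prog.skip, State.tick, State.setReg, s1, s2]
    obtain ⟨s3, r3, hv3, h3⟩ := h.advance (input := input) hn hv (s₁ := s2) (t := 4) hreg1
      (fun _ _ => rfl) (h.common.of_eq (fun r hr => hreg1 r (by omega)) rfl rfl) le_rfl (by omega)
      (Or.inl h0)
    refine hr2.seq_wp (r3.wp ?_)
    rw [mass_of h3, hv3]
    exact mul_le_mul_of_nonneg_left (mul_le_of_le_one_left ha (reliability_le_one n))
      (normSq_nonneg _)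
  have hinv : VertexInv G τ k U T v ⟨s1.reg, s.mem, s.vec, s.time⟩ :=
    ⟨h.common.of_eq (fun r hr => hreg1 r (by omega)) rfl rfl, h.pos, h.le,
      (hreg1 12 (by norm_num)).trans h.vertex,
      by simpa [hreg1 13] using h.rest, h.colouring, h.marks, h.clear,
      by simpa [hreg1 11] using h.progress, h.time⟩
  have hready : Ready n n.size s1.tick := by
    have := hinv.ready hv
    exact ⟨⟨this.1.1, this.1.2, this.1.3, this.1.4, this.1.5, this.1.6, this.1.7, this.1.8⟩, this.2,
      this.3, this.4, this.5, this.6, this.7⟩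
  have hsearch := (hp s1.tick hready).const_mul ha
  have e12 : s1.tick.reg 12 = v := hinv.vertex
  have e10 : s1.tick.reg 10 = (k + 2) * 2 ^ n.size := hinv.common.base
  rw [e12, e10] at hsearch
  set found := ∃ u < n, NatAdj G v u ∧ s1.tick.mem ((k + 2) * 2 ^ n.size + u) = 1 with hfound
  have hiff : found ↔ ∃ w, NatAdj G v w ∧ s.mem w = k := by
    constructor
    · rintro ⟨u, hu, h1, h2⟩
      refine ⟨u, h1, ?_⟩
      by_contra hne
      have := h.marks u hu
      rw [if_neg hne] at this
      exact zero_ne_one (this.symm.trans h2)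
    · rintro ⟨u, h1, h2⟩
      exact ⟨u, h1.2.1, h1, (h.marks u h1.2.1).trans (if_pos h2)⟩
  -- `Q` says that advancing the two counters will restore the invariant. Both answers of the search
  -- lead to it.
  let Q : State → Prop := fun s' => ∃ s₃, Runs (4 * n.size) n.size input
    (.seq (.add 12 12 1) (.sub 13 13 1)) s' s₃ ∧ s₃.vec = s'.vec ∧ VertexInv G τ k U T (v + 1) s₃
  refine Wp.seq (ψ := mass Q fun _ => a) ?_ fun s' => ?_
  swap
  · by_cases hQ : Q s'
    · obtain ⟨s₃, r₃, hv₃, h₃⟩ := id hQ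
      refine r₃.wp ?_
      rw [mass_of hQ, mass_of h₃, hv₃]
    · rw [mass_of_not hQ]; exact Wp.of_nonpos le_rfl
  refine Wp.ite_neg (by simpa [s1] using h0) (Wp.seq (hsearch.mono ?_ fun _ => le_rfl) fun s' => ?_)
  · refine le_of_eq ?_
    show normSq s.vec * (reliability n * a) = a * (normSq s.vec * reliability n)
    ring
  by_cases hpost : SearchPost n.size s1.tick (τ v) found s'
  swap
  · rw [mass_of_not hpost, mul_zero]; exact Wp.of_nonpos le_rfl
  rw [mass_of hpost, mul_one, mul_comm a]
  have hregs : ∀ r < 14, s'.reg r = s.reg r := fun r hr =>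
    (hpost.reg r hr).trans (hreg1 r hr)
  have htime : s'.time ≤ s.time + 3 + τ v := hpost.time
  have hcommon : Common n k s' := Common.of_search (s := s1.tick)
    (hinv.common.of_eq (fun _ _ => rfl) rfl rfl) hpost
  rcases hpost.flag with ⟨h20, hf⟩ | ⟨h20, hf⟩
  · let s2 : State := ⟨Function.update s'.reg 24 (s'.reg 24), s'.mem, s'.vec, s'.time + 2⟩
    have hr2 : ∀ r < 14, s2.reg r = s'.reg r := fun r hr => by simp [s2]
    have hr : Runs (4 * n.size) n.size input Prog.skip s'.tick s2 := Runs.of_exec fun _ => by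
      simp [exec, Prog.skip, State.tick, State.setReg, s2]
    have hQ : Q s2 := h.advance (input := input) hn hv (s₁ := s2) (t := τ v + 5)
      (fun r hr => (hr2 r hr).trans (hregs r hr)) hpost.mem
      (hcommon.of_eq (fun r hr => hr2 r (by omega)) rfl rfl) (by show s'.time + 2 ≤ _; omega)
      (by omega) (Or.inr (hiff.1 hf))
    refine Wp.ite_pos (by omega) (hr.wp ?_)
    rw [mass_of hQ]
  · obtain ⟨s2, r2, hv2, hQ⟩ := h.colour (input := input) hn hv (s₁ := s'.tick) (t := τ v + 4) hregs
      hpost.mem (hcommon.of_eq (fun _ _ => rfl) rfl rfl) (by show s'.time + 1 ≤ _; omega)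
      (by omega) h0 (fun h => hf (hiff.2 h))
    refine Wp.ite_neg h20 (r2.wp ?_)
    have hQ' : Q s2 := by
      obtain ⟨s3, h1, h2, h3⟩ := hQ
      exact ⟨s3, h1, h2.trans hv2.symm, h3⟩
    rw [mass_of hQ', hv2]
    exact le_rfl

/-- Raising the base by 2^size provides marks that have never been written to and are all zero, so a
round starts without any clearing. -/
theorem colourClass_wp (hp : IsSearch n input p (NatAdj G) τ) {k T : ℕ} {s : State} (hn : 0 < n)
    (h : ClassInv G τ T k s) (h11 : s.reg 11 ≠ 0) {a : ℝ} (ha : 0 ≤ a) :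
    Wp (4 * n.size) n.size input (Prog.colourClass p) s.tick
      (mass (fun s' => ClassInv G τ T (k + 1) s' ∧ s'.reg 11 < s.reg 11) fun _ => a)
      (normSq s.vec * (reliability n ^ n * a)) := by
  have hsz := Nat.lt_size_self n
  have hN : 0 < 2 ^ n.size := by positivity
  have hc := h.common
  have hkn : k + 1 ≤ n := by have := h.le; omega
  have hw : (k + 3) * 2 ^ n.size + n < _ := address_lt hn hkn
  have hbase : (k + 2) * 2 ^ n.size + 2 ^ n.size = (k + 3) * 2 ^ n.size := by ring
  have hbase' : n ≤ (k + 3) * 2 ^ n.size := by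
    calc n ≤ 1 * 2 ^ n.size := by omega
      _ ≤ _ := Nat.mul_le_mul_right _ (by omega)
  have hmod : ((k + 2) * 2 ^ n.size + 2 ^ n.size) % 2 ^ (4 * n.size) = (k + 3) * 2 ^ n.size := by
    rw [hbase]; exact Nat.mod_eq_of_lt (by omega)
  have hmod' : (k + 1) % 2 ^ (4 * n.size) = k + 1 := Nat.mod_eq_of_lt (by omega)
  let r1 := Function.update s.reg 9 (k + 1)
  let r2 := Function.update r1 10 ((k + 3) * 2 ^ n.size)
  let r3 := Function.update r2 12 0
  let r4 := Function.update r3 13 n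
  have e1 : Runs (4 * n.size) n.size input (.add 9 9 1) s.tick ⟨r1, s.mem, s.vec, s.time + 2⟩ :=
    Runs.of_exec fun _ => by
      simp [exec, State.tick, State.setReg, hc.colour, hc.static.one, hmod', r1]
  have e2 : Runs (4 * n.size) n.size input (.add 10 10 3) ⟨r1, s.mem, s.vec, s.time + 2⟩
      ⟨r2, s.mem, s.vec, s.time + 3⟩ :=
    Runs.of_exec fun _ => by
      simp [exec, State.tick, State.setReg, hc.base, hc.static.zbase, hmod, r1, r2]
  have e3 : Runs (4 * n.size) n.size input (.const 12 0) ⟨r2, s.mem, s.vec, s.time + 3⟩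
      ⟨r3, s.mem, s.vec, s.time + 4⟩ :=
    Runs.of_exec fun _ => by simp [exec, State.tick, State.setReg, r3]
  have e4 : Runs (4 * n.size) n.size input (.move 13 0) ⟨r3, s.mem, s.vec, s.time + 4⟩
      ⟨r4, s.mem, s.vec, s.time + 5⟩ :=
    Runs.of_exec fun _ => by
      simp [exec, State.tick, State.setReg, r1, r2, r3, r4, hc.order]
  refine e1.seq_wp <| e2.seq_wp <| e3.seq_wp <| e4.seq_wp ?_
  have hreg : ∀ r < 12, r ≠ 9 → r ≠ 10 → r4 r = s.reg r := fun r h h1 h2 => by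
    simp [r1, r2, r3, r4, h1, h2, show r ≠ 12 by omega, show r ≠ 13 by omega]
  have hI : VertexInv G τ (k + 1) (s.reg 11) (s.time + 5) 0
      ⟨r4, s.mem, s.vec, s.time + 5⟩ := by
    have hs := hc.static
    refine ⟨⟨⟨?_, ?_, ?_, ?_, ?_, ?_, ?_, hs.memz⟩, ?_, ?_, by simp [r1, r2, r3, r4],
      by simp [r2, r3, r4], hc.vec, ?_⟩, by omega, by have := h.le; omega, by simp [r3, r4],
      by simp [r4], h.colouring.next_class h.nonempty, fun u hu => ?_, fun a ha => ?_, ?_, by simp⟩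
    · exact (hreg _ (by norm_num) (by norm_num) (by norm_num)).trans hs.one
    · exact (hreg _ (by norm_num) (by norm_num) (by norm_num)).trans hs.blockLen
    · exact (hreg _ (by norm_num) (by norm_num) (by norm_num)).trans hs.zbase
    · exact (hreg _ (by norm_num) (by norm_num) (by norm_num)).trans hs.t1
    · exact (hreg _ (by norm_num) (by norm_num) (by norm_num)).trans hs.t2
    · exact (hreg _ (by norm_num) (by norm_num) (by norm_num)).trans hs.flag
    · exact (hreg _ (by norm_num) (by norm_num) (by norm_num)).trans hs.zero
    · exact (hreg _ (by norm_num) (by norm_num) (by norm_num)).trans hc.order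
    · exact (hreg _ (by norm_num) (by norm_num) (by norm_num)).trans hc.scratch
    · exact (hreg _ (by norm_num) (by norm_num) (by norm_num)).trans hc.count
    · have := h.colouring.le u hu
      rw [if_neg (by show s.mem u ≠ k + 1; omega)]
      exact h.clear _ (by show (k + 3) * _ ≤ (k + 1 + 2) * _ + u; exact Nat.le_add_right _ _)
    · exact h.clear a (le_trans (Nat.le_add_right _ n) ha)
    · right
      refine ⟨hreg 11 (by norm_num) (by norm_num) (by norm_num), fun u hu => ?_⟩
      have := h.colouring.le u hu
      show s.mem u ≠ k + 1
      omega
  let I : ℕ → State → Prop := fun m t => ∃ v, v + m = n ∧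
    VertexInv G τ (k + 1) (s.reg 11) (s.time + 5) v t
  have hI' : I n ⟨r4, s.mem, s.vec, s.time + 5⟩ := ⟨0, by simp, hI⟩
  have := Wp.loop (w := 4 * n.size) (len := n.size) (input := input) (r := 13)
    (p := Prog.colourVertex p) (φ := mass (fun s' => ClassInv G τ T (k + 1) s' ∧
      s'.reg 11 < s.reg 11) fun _ => a)
    (fun m => mass (I m) fun _ => reliability n ^ m * a) ?_ n ⟨r4, s.mem, s.vec, s.time + 5⟩
  · rwa [mass_of hI'] at this
  intro m t
  by_cases ht : I m t
  swap
  · left; rw [mass_of_not ht]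
  right
  have ht' := ht
  obtain ⟨v, hvm, hv⟩ := ht
  have hrest := hv.rest
  rw [mass_of ht']
  rcases m with _ | m
  · left
    refine ⟨by omega, ?_⟩
    obtain rfl : v = n := by omega
    -- Some vertex has joined the class: otherwise an uncoloured vertex would need a neighbour in an
    -- empty class, so no uncoloured vertex could exist, contrary to `h11`.
    have hprog : t.reg 11 < s.reg 11 ∧ ∃ u < v, t.mem u = k + 1 := by
      rcases hv.progress with h | ⟨hU, hno⟩
      · exact h
      · have hno : ∀ u < v, t.mem u ≠ 0 := fun u hu h0 => by
          obtain ⟨w, hw, hwk⟩ := hv.colouring.current hv.pos u hu hu h0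
          exact hno w hw.2.1 hwk
        have hz : t.reg 11 = 0 := by
          rw [hv.common.count, uncoloured, Finset.card_eq_zero, Finset.filter_eq_empty_iff]
          exact fun u hu => hno u (Finset.mem_range.1 hu)
        omega
    rw [mass_of, pow_zero, one_mul]
    · rfl
    refine ⟨⟨hv.common.of_eq (fun _ _ => rfl) rfl rfl, ?_, hv.colouring, Or.inr hprog.2,
      fun a ha => ?_, ?_⟩, hprog.1⟩
    · have := h.le
      have := hprog.1
      show k + 1 + t.reg 11 ≤ _
      omega
    · refine hv.clear a (le_trans ?_ ha)
      have : (k + 1 + 3) * 2 ^ v.size = (k + 1 + 2) * 2 ^ v.size + 2 ^ v.size := by ring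
      omega
    · have h1 := hv.time
      have h2 := h.time
      have : t.tick.time = t.time + 1 := rfl
      have e : (k + 1) * roundTime v τ = k * roundTime v τ + roundTime v τ := by ring
      have e' : roundTime v τ = 6 + ∑ u ∈ Finset.range v, (τ u + 10) := rfl
      omega
  · right
    refine ⟨m, rfl, by omega, ?_⟩
    refine (colourVertex_wp hp hn hv (by omega)
      (mul_nonneg (pow_nonneg (reliability_nonneg n) m) ha)).mono (le_of_eq ?_) fun s' => ?_
    · rw [pow_succ]; ring
    · exact mass_le_mass (fun h => ⟨⟨v + 1, by omega, h⟩, le_rfl⟩)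
        fun _ => mul_nonneg (pow_nonneg (reliability_nonneg n) m) ha

end

end QRam

/-! ## The whole algorithm -/

namespace QRam

section

variable {n : ℕ} {G : SimpleGraph (Fin n)} {τ : ℕ → ℕ} {input : ℕ → ℕ → ℕ → ℕ} {p : Prog}

set_option maxHeartbeats 800000 in
theorem setup_runs (hn : 0 < n) : ∃ s, Runs (4 * n.size) n.size input Prog.setup (initState n) s ∧
    ClassInv G τ (6 * n.size + 16) 0 s ∧ normSq s.vec = 1 := by
  have hw := address_lt hn (Nat.zero_le n)
  have hsz := Nat.lt_size_self n
  have hspos : 0 < n.size := Nat.size_pos.2 hn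
  have hww : 4 * n.size < 2 ^ (4 * n.size) := Nat.lt_two_pow_self
  have hN : 0 < 2 ^ n.size := by positivity
  set l := n.size with hl
  set r0 : ℕ → ℕ := Function.update (fun _ => 0) 0 n with hr0
  set ψ : QVec := Finsupp.single (fun _ => false) 1 with hψ
  let r1 := Function.update r0 1 1
  let r2 := Function.update r1 19 n
  have e1 : Runs (4 * l) l input (.const 1 1) (initState n) ⟨r1, fun _ => 0, ψ, 1⟩ :=
    Runs.of_exec fun _ => by
      have : 1 % 2 ^ (4 * l) = 1 := Nat.mod_eq_of_lt (by omega)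
      simp [exec, initState, State.tick, State.setReg, this, r1, r0, ψ]
  have e2 : Runs (4 * l) l input (.move 19 0) ⟨r1, fun _ => 0, ψ, 1⟩ ⟨r2, fun _ => 0, ψ, 2⟩ :=
    Runs.of_exec fun _ => by simp [exec, State.tick, State.setReg, r2, r1, r0]
  obtain ⟨s3, e3, hr3, hm3, hv3, h14, ht3⟩ := size_runs (w := 4 * l) (len := l) (input := input)
    (s := ⟨r2, fun _ => 0, ψ, 2⟩) (by simp [r2, r1]) (by simp [r2]; omega)
  have h19 : (r2 19).size = l := by simp [r2, hl]
  simp only [h19] at h14 ht3 hr3 hm3 hv3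
  let r4 := Function.update s3.reg 2 l
  let r5 := Function.update r4 3 1
  have e4 : Runs (4 * l) l input (.move 2 14) s3 ⟨r4, fun _ => 0, ψ, s3.time + 1⟩ :=
    Runs.of_exec fun _ => by simp [exec, State.tick, State.setReg, h14, r4, hm3, hv3]
  have e5 : Runs (4 * l) l input (.const 3 1) ⟨r4, fun _ => 0, ψ, s3.time + 1⟩
      ⟨r5, fun _ => 0, ψ, s3.time + 2⟩ :=
    Runs.of_exec fun _ => by
      have : 1 % 2 ^ (4 * l) = 1 := Nat.mod_eq_of_lt (by omega)
      simp [exec, State.tick, State.setReg, this, r5]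
  have hr5 : ∀ r, r ≠ 2 → r ≠ 3 → r ≠ 14 → r ≠ 19 → r5 r = r1 r := fun r h2 h3 h14 h19 => by
    simp [r5, r4, h2, h3, hr3 r h14 h19, r2, h19]
  -- The power 2^size is produced by doubling, once for every binary digit of n.
  obtain ⟨s6, e6, -, ⟨i, hi, h63⟩, hr6, hm6, hv6, ht6⟩ := Runs.loop (w := 4 * l) (len := l)
    (input := input) (r := 14) (p := .seq (.add 3 3 3) (.sub 14 14 1)) (m := l)
    (s := ⟨r5, fun _ => 0, ψ, s3.time + 2⟩)
    (fun m t => t.reg 14 = m ∧ (∃ i, i + m = l ∧ t.reg 3 = 2 ^ i) ∧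
      (∀ r, r ≠ 3 → r ≠ 14 → t.reg r = r5 r) ∧ t.mem = (fun _ => 0) ∧ t.vec = ψ ∧
      t.time + 3 * m ≤ 6 * l + 6)
    (fun _ _ h => by rw [h.1])
    (by
      rintro m t ⟨h14, ⟨i, hi, h3⟩, hr, hm, hv, ht⟩
      have h1 : t.reg 1 = 1 := by
        rw [hr 1 (by norm_num) (by norm_num), hr5 1 (by norm_num) (by norm_num) (by norm_num)
          (by norm_num)]; simp [r1]
      refine ⟨⟨Function.update (Function.update t.reg 3 (2 ^ (i + 1))) 14 m, t.mem, t.vec,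
        t.time + 3⟩, Runs.of_exec fun _ => ?_, by simp, ⟨i + 1, by omega, by simp⟩,
        fun r h h' => by simp [h, h', hr r h h'], hm, hv, by simp only; omega⟩
      have : (2 ^ i + 2 ^ i) % 2 ^ (4 * l) = 2 ^ (i + 1) := by
        rw [← two_mul, ← pow_succ']
        exact Nat.mod_eq_of_lt (Nat.pow_lt_pow_right (by norm_num) (by omega))
      simp [exec, State.tick, State.setReg, h14, h3, h1, this])
    ⟨by simp [r5, r4, h14], ⟨0, by simp, by simp [r5]⟩, fun _ _ _ => rfl, rfl, rfl, by
      simp only; omega⟩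
  obtain rfl : i = l := by omega
  have h6 : ∀ r, r ≠ 2 → r ≠ 3 → r ≠ 14 → r ≠ 19 → s6.reg r = r1 r := fun r h2 h3 h14 h19 => by
    rw [hr6 r h3 h14, hr5 r h2 h3 h14 h19]
  have h62 : s6.reg 2 = l := by rw [hr6 2 (by norm_num) (by norm_num)]; simp [r5, r4]
  have h60 : s6.reg 0 = n := by
    rw [h6 0 (by norm_num) (by norm_num) (by norm_num) (by norm_num)]; simp [r1, r0]
  have h61 : s6.reg 1 = 1 := by
    rw [h6 1 (by norm_num) (by norm_num) (by norm_num) (by norm_num)]; simp [r1]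
  have h68 : s6.reg 8 = 0 := by
    rw [h6 8 (by norm_num) (by norm_num) (by norm_num) (by norm_num)]; simp [r1, r0]
  have h69 : s6.reg 9 = 0 := by
    rw [h6 9 (by norm_num) (by norm_num) (by norm_num) (by norm_num)]; simp [r1, r0]
  let mem' : ℕ → ℕ := Function.update (fun _ => 0) (2 ^ l) 1
  let r7 := Function.update (Function.update (Function.update (Function.update (Function.update
    (Function.update s6.reg 4 (2 * 2 ^ l)) 10 (2 * 2 ^ l)) 5 (2 * l)) 6 (3 * l)) 7 (4 * l)) 11 n
  have e7 : Runs (4 * l) l input (.seq (.add 4 3 3) <| .seq (.store 3 1) <|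
      .seq (.move 10 4) <| .seq (.add 5 2 2) <| .seq (.add 6 5 2) <| .seq (.add 7 6 2) (.move 11 0))
      s6.tick ⟨r7, mem', ψ, s6.time + 8⟩ := Runs.of_exec fun _ => by
    have m1 : (2 ^ l + 2 ^ l) % 2 ^ (4 * l) = 2 * 2 ^ l := by
      rw [← two_mul]; exact Nat.mod_eq_of_lt (by omega)
    have m2 : (l + l) % 2 ^ (4 * l) = 2 * l := by rw [Nat.mod_eq_of_lt (by omega)]; omega
    have m3 : (l + l + l) % 2 ^ (4 * l) = 3 * l := by rw [Nat.mod_eq_of_lt (by omega)]; omega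
    have m4 : (2 * l + l + l) % 2 ^ (4 * l) = 4 * l := by rw [Nat.mod_eq_of_lt (by omega)]; omega
    simp [exec, State.tick, State.setReg, State.setMem, h63, h62, h60, h61, m1, m2, m3, m4, hm6, hv6,
      r7, mem']
  refine ⟨_, e1.seq <| e2.seq <| e3.seq <| e4.seq <| e5.seq <| e6.seq e7, ?_, by
    simp [hψ, normSq_single]⟩
  have hmem0 : ∀ u < n, mem' u = 0 := fun u hu => by
    simp [mem', show u ≠ 2 ^ l by omega]
  refine ⟨⟨⟨by simp [r7, h61], by simp [r7, h62, hl], by simp [r7, h63, hl], by simp [r7, hl], by simp [r7, hl],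
    by simp [r7, hl], by simp [r7, h68], fun j hj => ?_⟩, by simp [r7, h60], by simp [r7, hl],
    by simp [r7, h69], by simp [r7, hl], ⟨1, rfl⟩, ?_⟩, by simp [r7], ⟨fun u hu => (hmem0 u hu).le,
    fun u w hw h0 => absurd (hmem0 u hw.1) h0, fun j h1 h2 => by omega, fun j h1 h2 => by omega,
    fun h1 => by omega⟩, Or.inl rfl, fun a ha => ?_, ?_⟩
  · by_cases hj0 : j = 0
    · simp [mem', hl, hj0]
    · simp [mem', hl, hj0]
  · show r7 11 = uncoloured n mem'
    have : (Finset.range n).filter (fun u => mem' u = 0) = Finset.range n :=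
      Finset.filter_true_of_mem fun u hu => hmem0 u (Finset.mem_range.1 hu)
    rw [uncoloured, this, Finset.card_range]
    simp [r7]
  · show mem' a = 0
    simp [mem', show a ≠ 2 ^ l by rw [← hl] at ha; omega]
  · simp only; omega

/-- With high probability the program makes a colouring by extraction, in a time that is
proportional to the number of colours. -/
theorem colour_wp (hp : IsSearch n input p (NatAdj G) τ) (hn : 0 < n) :
    Wp (4 * n.size) n.size input (Prog.colour p) (initState n)
      (mass (fun s => OutputsColouring G s ∧
        s.time ≤ 6 * n.size + 18 + s.reg 0 * roundTime n τ) fun _ => 1)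
      (reliability n ^ (n * n)) := by
  obtain ⟨s, hs, hinv, hnorm⟩ := setup_runs (G := G) (τ := τ) (input := input) hn
  set T := 6 * n.size + 16
  refine hs.seq_wp ?_
  -- Each round colours at least one vertex, so the number of uncoloured vertices bounds the rounds
  -- to come. At most n rounds with n searches each give the exponent `n * n`.
  let I : ℕ → State → Prop := fun m t => (∃ k, ClassInv G τ T k t) ∧ t.reg 11 ≤ m
  let E : State → Prop := fun t => ∃ k, ClassInv G τ (T + 1) k t ∧ t.reg 11 = 0
  have hI : I n s := ⟨⟨0, hinv⟩, by have := hinv.le; omega⟩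
  have hrel : ∀ m, 0 ≤ reliability n ^ m := fun m => pow_nonneg (reliability_nonneg n) m
  refine Wp.seq (ψ := mass E fun _ => 1) ?_ fun t => ?_
  · have := Wp.loop (w := 4 * n.size) (len := n.size) (input := input) (r := 11)
      (p := Prog.colourClass p) (φ := mass E fun _ => 1)
      (fun m => mass (I m) fun _ => reliability n ^ (n * m)) ?_ n s
    · rwa [mass_of hI, hnorm, one_mul] at this
    intro m t
    by_cases ht : I m t
    swap
    · left; rw [mass_of_not ht]
    right
    rw [mass_of ht]
    obtain ⟨⟨k, hk⟩, hm⟩ := ht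
    by_cases h0 : t.reg 11 = 0
    · left
      refine ⟨h0, ?_⟩
      rw [mass_of]
      · exact mul_le_mul_of_nonneg_left (pow_le_one₀ (reliability_nonneg n) (reliability_le_one n))
          (normSq_nonneg _)
      refine ⟨k, ⟨hk.common.of_eq (fun _ _ => rfl) rfl rfl, hk.le, hk.colouring, hk.nonempty,
        hk.clear, ?_⟩, h0⟩
      have := hk.time
      show t.time + 1 ≤ _
      omega
    · right
      obtain ⟨m, rfl⟩ : ∃ m', m = m' + 1 := ⟨m - 1, by omega⟩
      refine ⟨m, rfl, h0, (colourClass_wp hp hn hk h0 (hrel (n * m))).mono (le_of_eq ?_)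
        fun s' => ?_⟩
      · rw [← pow_add]
        congr 2; ring
      · exact mass_le_mass (fun h => ⟨⟨⟨k + 1, h.1⟩, by have := h.2; omega⟩, le_rfl⟩) fun _ => hrel _
  · by_cases hE : E t
    swap
    · rw [mass_of_not hE]; exact Wp.of_nonpos le_rfl
    rw [mass_of hE]
    obtain ⟨k, hk, h0⟩ := hE
    have hr : Runs (4 * n.size) n.size input (.move 0 9) t
        ⟨Function.update t.reg 0 k, t.mem, t.vec, t.time + 1⟩ := Runs.of_exec fun _ => by
      simp [exec, State.tick, State.setReg, hk.common.colour]
    refine hr.wp ?_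
    rw [mass_of]
    refine ⟨?_, ?_⟩
    · have hno : ∀ u < n, t.mem u ≠ 0 := fun u hu hu0 => by
        have := uncoloured_pos hu hu0
        rw [← hk.common.count] at this
        omega
      have := hk.colouring.isColouringByExtraction hk.nonempty hno
      unfold OutputsColouring
      simpa using this
    · have := hk.time
      simp only [Function.update_self]
      omega

end

end QRam

/-! ## The bounds -/

namespace QRam

/-- The branches outside of the exhibited list have nonnegative weight and can only add to the
probability. -/
theorem Wp.exists_prob {A : Algorithm} {n : ℕ} {input : ℕ → ℕ → ℕ → ℕ} {P : State → Prop} {c : ℝ}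
    (h : Wp (A.wordFactor * n.size) n.size input A.prog (initState n) (mass P fun _ => 1) c) :
    ∃ fuel, c ≤ prob (A.run n input fuel) P := by
  obtain ⟨L, F, hF, hc⟩ := h
  refine ⟨F, hc.trans ?_⟩
  have e : prob (A.run n input F) P = ((A.run n input F).map (mass P fun _ => 1)).sum := by
    unfold prob
    congr 2
    funext s
    by_cases hs : P s
    · rw [mass_of hs, if_pos hs, mul_one]
    · rw [mass_of_not hs, if_neg hs]
  rw [e]
  refine ((hF F le_rfl).map _).sum_le_sum fun a ha => ?_
  obtain ⟨s, -, rfl⟩ := List.mem_map.1 ha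
  by_cases hs : P s
  · rw [mass_of hs, mul_one]; exact normSq_nonneg _
  · rw [mass_of_not hs]

/-- Bernoulli's inequality with error a = 8^(−size) per search: n < 2^size gives n³a < 1, that is
n²a < 1/n. -/
theorem lt_reliability_pow {n : ℕ} (hn : 0 < n) :
    1 - 1 / (n : ℝ) < reliability n ^ (n * n) := by
  have hn' : (0 : ℝ) < n := Nat.cast_pos.2 hn
  set a : ℝ := (1 / 2) ^ (3 * n.size) with ha
  have ha1 : a ≤ 1 := pow_le_one₀ (by norm_num) (by norm_num)
  have h1 := one_add_mul_le_pow (a := -a) (by linarith) (n * n)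
  have h2 : (n : ℝ) ^ 3 * a < 1 := by
    have : (n : ℝ) < 2 ^ n.size := by exact_mod_cast Nat.lt_size_self n
    have h3 : (n : ℝ) ^ 3 < (2 ^ n.size) ^ 3 := pow_lt_pow_left₀ this hn'.le (by norm_num)
    rw [ha, mul_comm 3, pow_mul, one_div, inv_pow, inv_pow, ← div_eq_mul_inv]
    exact (div_lt_one (by positivity)).2 h3
  have h4 : (n : ℝ) * n * a < 1 / n := by
    rw [lt_div_iff₀ hn']
    linarith [h2, show (n : ℝ) * n * a * n = n ^ 3 * a by ring]
  have h5 : reliability n = 1 + -a := by rw [reliability, sub_eq_add_neg]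
  rw [h5]
  push_cast at h1
  linarith

/-- For n ≥ 2 the length is l + 1 with l ≥ 1, hence at most 2l ≤ 2 log n / log 2, and 2 / log 2 < 3.
-/
theorem size_le_log {n : ℕ} (hn : 2 ≤ n) : (n.size : ℝ) ≤ 3 * Real.log n := by
  have h2 : 1 < n.size := Nat.lt_size.2 (by simpa using hn)
  obtain ⟨l, hl⟩ : ∃ l, n.size = l + 1 := ⟨n.size - 1, by omega⟩
  have h3 : 2 ^ l ≤ n := Nat.lt_size.1 (by omega)
  have h4 : (l : ℝ) * Real.log 2 ≤ Real.log n := by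
    rw [← Real.log_pow]
    exact Real.log_le_log (by positivity) (by exact_mod_cast h3)
  have h5 : (1 : ℝ) ≤ l := by exact_mod_cast (by omega : 1 ≤ l)
  rw [hl]
  push_cast
  nlinarith [Real.log_two_gt_d9]

/-- The ten extra operations are the ones that `roundTime` adds per vertex. The main term is 3 · 2 ·
38 = 228, from 10l + 28 ≤ 38 len; the rest is at most 6 len + 3 len + 21 ≤ 30 len. -/
theorem searchTime_le {len l : ℕ} (hlen : 1 ≤ len) (hl : l ≤ len) :
    searchTime len l + 10 ≤ 258 * len ^ 2 * 2 ^ ((l + 1) / 2) := by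
  have hy : 1 ≤ 2 ^ ((l + 1) / 2) := Nat.one_le_two_pow
  unfold searchTime
  rw [pow_succ]
  generalize 2 ^ ((l + 1) / 2) = y at hy ⊢
  have h1 : 10 * l + 28 ≤ 38 * len := by omega
  have h2 : y * 2 * (10 * l + 28) ≤ y * 2 * (38 * len) := Nat.mul_le_mul_left _ h1
  have h3 : len ≤ len ^ 2 * y := by nlinarith [Nat.mul_le_mul hlen hy]
  have h4 := Nat.mul_le_mul_left (3 * len) (Nat.add_le_add_right h2 2)
  have h5 : 3 * len * (y * 2 * (38 * len) + 2) = 228 * (len ^ 2 * y) + 6 * len := by ring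
  have h6 : 258 * len ^ 2 * y = 258 * (len ^ 2 * y) := by ring
  omega

/-- Passing from `d` to a power of two loses a factor of at most two, and rounding the exponent up
another one. The summand one is there for `d = 0`. -/
theorem two_pow_half_sq_le (d : ℕ) : (2 ^ ((d.size + 1) / 2)) ^ 2 ≤ 4 * (d + 1) := by
  rcases Nat.eq_zero_or_pos d with rfl | hd
  · simp
  · obtain ⟨l, hl⟩ : ∃ l, d.size = l + 1 := ⟨d.size - 1, by have := Nat.size_pos.2 hd; omega⟩
    have h : 2 ^ l ≤ d := Nat.lt_size.1 (by omega)
    calc (2 ^ ((d.size + 1) / 2)) ^ 2 = 2 ^ ((d.size + 1) / 2 * 2) := (pow_mul _ _ _).symm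
      _ ≤ 2 ^ (l + 2) := Nat.pow_le_pow_right (by norm_num) (by omega)
      _ = 4 * 2 ^ l := by ring
      _ ≤ 4 * (d + 1) := by omega

theorem IsColouringByExtraction.one_le {V : Type*} [Nonempty V] {G : SimpleGraph V} {k : ℕ}
    {c : V → ℕ} (h : IsColouringByExtraction G k c) : 1 ≤ k := by
  obtain ⟨v⟩ := ‹Nonempty V›
  have : c v ∈ Set.Icc 1 k := h.colours ▸ Set.mem_range_self v
  exact this.1.trans this.2

/-- The two models differ only in the sum over the vertices of the number of iterations, up to a
constant factor; `Z` stands for its bound. -/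
theorem colour_prob {n : ℕ} {G : SimpleGraph (Fin n)} {input : ℕ → ℕ → ℕ → ℕ} {p : Prog}
    {l : ℕ → ℕ} {Z : ℝ} (hn : 2 ≤ n)
    (hp : IsSearch n input p (NatAdj G) fun v => searchTime n.size (l v))
    (hl : ∀ v < n, l v ≤ n.size)
    (hZ : ((∑ v ∈ Finset.range n, 2 ^ ((l v + 1) / 2) : ℕ) : ℝ) ≤ 4 * Z) :
    ∃ fuel, 1 - 1 / (n : ℝ) < prob ((⟨4, Prog.colour p⟩ : Algorithm).run n input fuel) fun s =>
      OutputsColouring G s ∧ (s.time : ℝ) ≤ 10368 * (s.reg 0 : ℝ) * Z * Real.log n ^ 2 := by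
  set Y := ∑ v ∈ Finset.range n, 2 ^ ((l v + 1) / 2) with hY
  have hlen : 1 ≤ n.size := Nat.size_pos.2 (by omega)
  have hY1 : 1 ≤ Y := by
    calc 1 ≤ 2 ^ ((l 0 + 1) / 2) := Nat.one_le_two_pow
      _ ≤ Y := Finset.single_le_sum (f := fun v => 2 ^ ((l v + 1) / 2)) (fun _ _ => Nat.zero_le _)
        (Finset.mem_range.2 (by omega : 0 < n))
  have hround : roundTime n (fun v => searchTime n.size (l v)) ≤ 6 + 258 * n.size ^ 2 * Y := by
    rw [roundTime, hY, Finset.mul_sum]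
    exact Nat.add_le_add_left (Finset.sum_le_sum fun v hv =>
      searchTime_le hlen (hl v (Finset.mem_range.1 hv))) _
  have hlog := size_le_log hn
  have := (colour_wp hp (by omega : 0 < n)).mono le_rfl fun s =>
    mass_le_mass (s := s) (v := fun _ => 1) (v' := fun _ => 1) (P' := fun s => OutputsColouring G s ∧
      (s.time : ℝ) ≤ 10368 * (s.reg 0 : ℝ) * Z * Real.log n ^ 2) (fun h => ⟨⟨h.1, ?_⟩, le_rfl⟩)
      fun _ => zero_le_one
  · obtain ⟨fuel, h⟩ := Wp.exists_prob (A := ⟨4, Prog.colour p⟩) this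
    exact ⟨fuel, (lt_reliability_pow (by omega)).trans_le h⟩
  · obtain ⟨hcol, ht⟩ := h
    have : Nonempty (Fin n) := ⟨⟨0, by omega⟩⟩
    have hk : 1 ≤ s.reg 0 := IsColouringByExtraction.one_le hcol
    -- 288 = 258 + 30, where 30 = 6 + 18 + 6 covers the setup, the additive constant and the fixed
    -- cost of each round.
    have h1 : s.time ≤ 288 * (s.reg 0 * n.size ^ 2 * Y) := by
      have h2 := Nat.mul_le_mul_left (s.reg 0) hround
      have h3 : n.size ≤ n.size ^ 2 := Nat.le_self_pow (by norm_num) _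
      have h4 : n.size ^ 2 ≤ s.reg 0 * n.size ^ 2 * Y := by
        calc n.size ^ 2 = 1 * n.size ^ 2 * 1 := by ring
          _ ≤ s.reg 0 * n.size ^ 2 * Y := by gcongr
      have h5 : s.reg 0 ≤ s.reg 0 * n.size ^ 2 * Y := by
        calc s.reg 0 = s.reg 0 * 1 * 1 := by ring
          _ ≤ s.reg 0 * n.size ^ 2 * Y := by gcongr; exact Nat.one_le_pow _ _ hlen
      have h6 : s.reg 0 * (6 + 258 * n.size ^ 2 * Y) =
        6 * s.reg 0 + 258 * (s.reg 0 * n.size ^ 2 * Y) := by ring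
      omega
    -- 10368 = 288 · 3² · 4, with the 3 from `size_le_log` and the 4 from `hZ`.
    calc (s.time : ℝ) ≤ 288 * ((s.reg 0 : ℝ) * (n.size : ℝ) ^ 2 * Y) := by exact_mod_cast h1
      _ ≤ 288 * ((s.reg 0 : ℝ) * (3 * Real.log n) ^ 2 * (4 * Z)) := by gcongr
      _ = 10368 * (s.reg 0 : ℝ) * Z * Real.log n ^ 2 := by ring

theorem sum_matrix_le (n : ℕ) :
    ((∑ _v ∈ Finset.range n, 2 ^ ((n.size + 1) / 2) : ℕ) : ℝ) ≤ 4 * (n : ℝ) ^ (3 / 2 : ℝ) := by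
  rcases Nat.eq_zero_or_pos n with rfl | hn
  · simp
  have hn' : (1 : ℝ) ≤ n := by exact_mod_cast hn
  have h1 : ((2 ^ ((n.size + 1) / 2) : ℕ) : ℝ) ≤ 4 * Real.sqrt n := by
    refine le_of_sq_le_sq ?_ (by positivity)
    have : (((2 ^ ((n.size + 1) / 2)) ^ 2 : ℕ) : ℝ) ≤ (4 * (n + 1) : ℕ) :=
      Nat.cast_le.2 (two_pow_half_sq_le n)
    rw [mul_pow, Real.sq_sqrt (by positivity)]
    push_cast at this ⊢
    linarith
  have h2 : (n : ℝ) ^ (3 / 2 : ℝ) = n * Real.sqrt n := by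
    rw [Real.sqrt_eq_rpow, show (3 / 2 : ℝ) = 1 + 1 / 2 by norm_num, Real.rpow_add (by linarith),
      Real.rpow_one]
  rw [Finset.sum_const, Finset.card_range, smul_eq_mul, Nat.cast_mul, h2]
  nlinarith

theorem sum_natDegree {n : ℕ} (G : SimpleGraph (Fin n)) :
    ∑ v ∈ Finset.range n, natDegree G v = 2 * G.edgeSet.ncard := by
  classical
  have h := G.sum_degrees_eq_twice_card_edges
  have e : G.edgeSet.ncard = G.edgeFinset.card := by
    rw [← SimpleGraph.coe_edgeFinset, Set.ncard_coe_finset]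
  rw [e, ← h, Finset.sum_range]
  refine Finset.sum_congr rfl fun v _ => ?_
  rw [natDegree, dif_pos v.2, vertexDegree, ← SimpleGraph.card_neighborFinset_eq_degree,
    ← Set.ncard_coe_finset, SimpleGraph.coe_neighborFinset]

/-- Cauchy–Schwarz together with the sum of the degrees, 2m, bounds the square by 4n(2m + n) ≤ 12 n
· max(n, m). The summand n comes from the constant cost that even a vertex of degree zero has; it is
the reason for the maximum. -/
theorem sum_list_le {n : ℕ} (G : SimpleGraph (Fin n)) :
    ((∑ v ∈ Finset.range n, 2 ^ (((natDegree G v).size + 1) / 2) : ℕ) : ℝ) ≤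
      4 * Real.sqrt ((n : ℝ) * max (n : ℝ) (G.edgeSet.ncard : ℝ)) := by
  have h1 : (∑ v ∈ Finset.range n, 2 ^ (((natDegree G v).size + 1) / 2)) ^ 2 ≤
      n * (4 * (2 * G.edgeSet.ncard + n)) := by
    calc (∑ v ∈ Finset.range n, 2 ^ (((natDegree G v).size + 1) / 2)) ^ 2
        ≤ (Finset.range n).card *
          ∑ v ∈ Finset.range n, (2 ^ (((natDegree G v).size + 1) / 2)) ^ 2 := sq_sum_le_card_mul_sum_sq
      _ ≤ (Finset.range n).card * ∑ v ∈ Finset.range n, 4 * (natDegree G v + 1) :=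
        Nat.mul_le_mul_left _ (Finset.sum_le_sum fun v _ => two_pow_half_sq_le _)
      _ = n * (4 * (2 * G.edgeSet.ncard + n)) := by
        rw [← Finset.mul_sum, Finset.sum_add_distrib, sum_natDegree]; simp
  have h2 : ((∑ v ∈ Finset.range n, 2 ^ (((natDegree G v).size + 1) / 2) : ℕ) : ℝ) ^ 2 ≤
      n * (4 * (2 * G.edgeSet.ncard + n)) := by exact_mod_cast h1
  refine le_of_sq_le_sq (h2.trans ?_) (by positivity)
  rw [mul_pow, Real.sq_sqrt (by positivity)]
  have h3 := le_max_left (n : ℝ) (G.edgeSet.ncard : ℝ)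
  have h4 := le_max_right (n : ℝ) (G.edgeSet.ncard : ℝ)
  nlinarith [mul_nonneg (Nat.cast_nonneg (α := ℝ) n) (sub_nonneg.2 h3),
    mul_nonneg (Nat.cast_nonneg (α := ℝ) n) (sub_nonneg.2 h4)]

end QRam

theorem mainTheorem7 :
    -- adjacency matrix model
    (∃ (A : QRam.Algorithm) (C : ℝ), ∀ (n : ℕ) (G : SimpleGraph (Fin n)), 2 ≤ n →
      ∃ fuel : ℕ,
        1 - 1 / (n : ℝ) < QRam.prob (A.run n (matrixInput G) fuel) fun s =>
          OutputsColouring G s ∧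
          (s.time : ℝ) ≤ C * (s.reg 0 : ℝ) * (n : ℝ) ^ (3 / 2 : ℝ) * Real.log n ^ 2) ∧
    -- adjacency list model
    (∃ (A : QRam.Algorithm) (C : ℝ), ∀ (n : ℕ) (G : SimpleGraph (Fin n)) (L : AdjacencyLists G),
      2 ≤ n →
      ∃ fuel : ℕ,
        1 - 1 / (n : ℝ) < QRam.prob (A.run n (listInput G L) fuel) fun s =>
          OutputsColouring G s ∧
          (s.time : ℝ) ≤ C * (s.reg 0 : ℝ) *
            Real.sqrt ((n : ℝ) * max (n : ℝ) (G.edgeSet.ncard : ℝ)) * Real.log n ^ 2) := by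
  refine ⟨⟨⟨4, QRam.Prog.colour (QRam.Prog.search (.move 19 0) 8 5)⟩, 10368, fun n G hn => ?_⟩,
    ⟨⟨4, QRam.Prog.colour (QRam.Prog.search (.read 0 19 12 12) 5 6)⟩, 10368, fun n G L hn => ?_⟩⟩
  · exact QRam.colour_prob hn (QRam.isSearch_matrix G) (fun _ _ => le_rfl) (QRam.sum_matrix_le n)
  · refine QRam.colour_prob hn (QRam.isSearch_list G L) (fun v hv => Nat.size_le_size ?_)
      (QRam.sum_list_le G)
    rw [QRam.natDegree, dif_pos hv]
    exact (QRam.vertexDegree_lt G _).le
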